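/- Let $N\ge 1$, let $\mathbb{B}_N$ be the open unit ball of $\mathbb{C}^N$ and $S_N$ the unit sphere. Let $H^2(\mathbb{B}_N)$ be the Hardy space of holomorphic functions $f$ on $\mathbb{B}_N$ with $$\|f\|^2=\sup_{0<r<1}\int_{S_N}|f(r\zeta)|^2\,d\sigma(\zeta)<\infty ,$$ where $\sigma$ is normalized surface measure, and for $\alpha>-1$ let $A^2_\alpha(\mathbb{B}_N)$ be the weighted Bergman space of holomorphic functions $f$ on $\mathbb{B}_N$ with $$\|f\|^2=\int_{\mathbb{B}_N}|f(z)|^2c_\alpha(1-|z|^2)^\alpha\,dv(z)<\infty ,$$ where $v$ is Lebesgue measure and $c_\alpha$ makes $c_\alpha(1-|z|^2)^\alpha dv$ a probability measure. Both are Hilbert spaces. For $\gamma\ge 1$ put $\mathcal{H}_\gamma=H^2(\mathbb{B}_N)$ if $\gamma=1$ and $\mathcal{H}_\gamma=A^2_{\gamma-2}(\mathbb{B}_N)$ if $\gamma>1$. Let $\varphi$ be a (biholomorphic) automorphism of $\mathbb{B}_N$ that has no fixed point in $\mathbb{B}_N$ and whose continuous extension to $\overline{\mathbb{B}_N}$ fixes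 two distinct points $a\neq b$ of $S_N$, where $a$ is the Denjoy–Wolff point of $\varphi$, that is, the iterates of $\varphi$ converge to $a$ uniformly on compact subsets of $\mathbb{B}_N$. Let $\psi$ be continuous on $\overline{\mathbb{B}_N}$ and holomorphic on $\mathbb{B}_N$, with $\inf_{z\in\mathbb{B}_N}|\psi(z)|>0$. Then $\varphi$ extends holomorphically to a neighbourhood of $\overline{\mathbb{B}_N}$, the derivative $\varphi'(a)$ is invertible, and the spectral radius $\rho$ of $\varphi'(a)^{-1}$ is also the spectral radius of $\varphi'(b)$. For every $\gamma\ge 1$, with $K=(N-1+\gamma)/2$, the weighted composition operator $C_{\psi,\varphi}f=\psi\cdot(f\circ\varphi)$ is bounded on $\mathcal{H}_\gamma$ and its spectrum is $$\left\{\lambda\in\mathbb{C}:\ \min\{|\psi(a)|\rho^{K},|\psi(b)|\rho^{-K}\}\le|\lambda|\le\max\{|\psi(a)|\rho^{K},|\psi(b)|\rho^{-K}\}\right\}.$$ Moreover, every interior point of this set is an eigenvalue of $C_{\psi,\varphi}$ or of its adjoint $C_{\psi,\varphi}^*$. -/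

import Mathlib

open MeasureTheory Metric Set Filter Topology
open scoped ENNReal Pointwise

namespace WCO

/-- `ℂ^N` with its Euclidean norm. -/
abbrev CN (N : ℕ) : Type := EuclideanSpace ℂ (Fin N)

/-- The normalized surface measure on the unit sphere of `ℂ^N`. -/
noncomputable def surfaceMeasure (N : ℕ) : Measure (sphere (0 : CN N) 1) :=
  ((volume : Measure (CN N)).toSphere univ)⁻¹ • (volume : Measure (CN N)).toSphere

/-- `∫_{S_N} |f(rζ)|² dσ(ζ)`. -/
noncomputable def hardyMean {N : ℕ} (f : CN N → ℂ) (r : ℝ) : ℝ :=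
  ∫ ζ, ‖f (r • (ζ : CN N))‖ ^ 2 ∂(surfaceMeasure N)

/-- `∫_{S_N} ⟨f(rζ), g(rζ)⟩ dσ(ζ)`, conjugate-linear in `f`. -/
noncomputable def hardyPairing {N : ℕ} (f g : CN N → ℂ) (r : ℝ) : ℂ :=
  ∫ ζ, inner ℂ (f (r • (ζ : CN N))) (g (r • (ζ : CN N))) ∂(surfaceMeasure N)

section Sphere

variable {N : ℕ}

/-- Multiplication by a unimodular scalar, as a real linear isometry of `ℂ^N`. -/
noncomputable def rot (N : ℕ) (u : Circle) : CN N ≃ₗᵢ[ℝ] CN N where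
  toFun z := (u : ℂ) • z
  invFun z := ((u⁻¹ : Circle) : ℂ) • z
  map_add' x y := smul_add _ _ _
  map_smul' r x := smul_comm _ _ _
  left_inv z := by simp [smul_smul]
  right_inv z := by simp [smul_smul]
  norm_map' z := by
    change ‖(u : ℂ) • z‖ = ‖z‖
    rw [norm_smul, Circle.norm_coe, one_mul]

/-- The induced homeomorphism of the unit sphere. -/
noncomputable def rotSphere (N : ℕ) (u : Circle) : sphere (0 : CN N) 1 ≃ₜ sphere (0 : CN N) 1 where
  toFun ζ := ⟨rot N u ζ, by simp⟩
  invFun ζ := ⟨(rot N u).symm ζ, by simp⟩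
  left_inv ζ := by simp
  right_inv ζ := by simp
  continuous_toFun := by fun_prop
  continuous_invFun := by fun_prop

theorem measurePreserving_rotSphere (u : Circle) :
    MeasurePreserving (rotSphere N u) (surfaceMeasure N) (surfaceMeasure N) := by
  refine ⟨(rotSphere N u).continuous.measurable, ?_⟩
  rw [surfaceMeasure, Measure.map_smul]
  congr 1
  ext s hs
  rw [Measure.map_apply (rotSphere N u).continuous.measurable hs,
    Measure.toSphere_apply' _ hs,
    Measure.toSphere_apply' _ ((rotSphere N u).continuous.measurable hs)]
  congr 1
  have key : (Ioo (0 : ℝ) 1 • (Subtype.val '' (rotSphere N u ⁻¹' s)) : Set (CN N)) =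
      (rot N u) ⁻¹' (Ioo (0 : ℝ) 1 • (Subtype.val '' s)) := by
    ext z
    simp only [Set.mem_smul, mem_image, mem_preimage]
    constructor
    · rintro ⟨r, hr, _, ⟨ζ, hζ, rfl⟩, rfl⟩
      exact ⟨r, hr, _, ⟨_, hζ, rfl⟩, by simp [rotSphere]⟩
    · rintro ⟨r, hr, _, ⟨ζ, hζ, rfl⟩, h⟩
      refine ⟨r, hr, _, ⟨(rotSphere N u).symm ζ, by simpa using hζ, rfl⟩, ?_⟩
      apply (rot N u).injective
      rw [← h]
      simp [rotSphere]
  rw [key]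
  exact ((rot N u).measurePreserving).measure_preimage_equiv
    (f := (rot N u).toHomeomorph.toMeasurableEquiv) _

theorem integral_rot (u : Circle) (F : CN N → ℝ) :
    ∫ ζ, F ((u : ℂ) • (ζ : CN N)) ∂(surfaceMeasure N) = ∫ ζ, F (ζ : CN N) ∂(surfaceMeasure N) :=
  (measurePreserving_rotSphere u).integral_comp (rotSphere N u).measurableEmbedding
    (fun ζ : sphere (0 : CN N) 1 => F (ζ : CN N))

theorem smul_mem_ball {w : ℂ} (hw : ‖w‖ < 1) (ζ : sphere (0 : CN N) 1) :
    w • (ζ : CN N) ∈ ball (0 : CN N) 1 := by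
  simp [norm_smul, hw]

theorem rsmul_mem_ball {r : ℝ} (hr : r ∈ Ioo (0 : ℝ) 1) (ζ : sphere (0 : CN N) 1) :
    r • (ζ : CN N) ∈ ball (0 : CN N) 1 := by
  simp [norm_smul, abs_of_pos hr.1, hr.2]

theorem continuous_dilate {f : CN N → ℂ} (hf : ContinuousOn f (ball 0 1)) {r : ℝ}
    (hr : r ∈ Ioo (0 : ℝ) 1) : Continuous fun ζ : sphere (0 : CN N) 1 => f (r • (ζ : CN N)) :=
  hf.comp_continuous (by fun_prop) fun ζ => rsmul_mem_ball hr ζ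

theorem hardyMean_nonneg (f : CN N → ℂ) (r : ℝ) : 0 ≤ hardyMean f r :=
  integral_nonneg fun _ => by positivity

theorem hardyMean_smul (c : ℂ) (f : CN N → ℂ) (r : ℝ) :
    hardyMean (c • f) r = ‖c‖ ^ 2 * hardyMean f r := by
  rw [hardyMean, hardyMean, ← integral_const_mul]
  simp [mul_pow]

variable [NeZero N]

instance : Nontrivial (CN N) := by
  have : Nonempty (Fin N) := ⟨⟨0, Nat.pos_of_ne_zero (NeZero.ne N)⟩⟩
  exact inferInstanceAs (Nontrivial (EuclideanSpace ℂ (Fin N)))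

theorem toSphere_univ_ne_zero : (volume : Measure (CN N)).toSphere univ ≠ 0 := by
  rw [Ne, Measure.measure_univ_eq_zero]
  exact Measure.toSphere_ne_zero _

instance : IsProbabilityMeasure (surfaceMeasure N) := by
  constructor
  rw [surfaceMeasure, Measure.smul_apply, smul_eq_mul]
  exact ENNReal.inv_mul_cancel toSphere_univ_ne_zero (measure_ne_top _ _)

instance : (surfaceMeasure N).IsOpenPosMeasure := by
  constructor
  intro U hU hne
  rw [surfaceMeasure, Measure.smul_apply, smul_eq_mul]
  exact mul_ne_zero (ENNReal.inv_ne_zero.2 (measure_ne_top _ _)) (hU.measure_ne_zero _ hne)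

theorem integrable_of_continuous {F : Type*} [NormedAddCommGroup F]
    {h : sphere (0 : CN N) 1 → F} (hh : Continuous h) : Integrable h (surfaceMeasure N) :=
  hh.integrable_of_hasCompactSupport (HasCompactSupport.of_compactSpace _)

/-- Mean values over spheres of `|f|²` increase with the radius, for `f` holomorphic. -/
theorem hardyMean_mono {f : CN N → ℂ} (hf : DifferentiableOn ℂ f (ball 0 1)) :
    MonotoneOn (hardyMean f) (Ioo 0 1) := by
  intro r hr R hR hrR
  rcases hrR.eq_or_lt with rfl | hlt
  · exact le_rfl
  have hc := hf.continuousOn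
  have hrb : (r : ℂ) ∈ ball (0 : ℂ) R := by simpa [abs_of_pos hr.1] using hlt
  set P : ℝ → ℝ := fun θ => poissonKernel 0 (r : ℂ) (circleMap 0 R θ) with hP
  have hPpos : ∀ θ, 0 ≤ P θ := by
    intro θ
    simp only [hP, poissonKernel_def]
    apply div_nonneg _ (sq_nonneg _)
    simp only [sub_zero, norm_circleMap_zero, Complex.norm_real, Real.norm_eq_abs, sq_abs]
    nlinarith [hr.1]
  have hPc : Continuous P := by
    simp only [hP, poissonKernel_def]
    refine Continuous.div (by fun_prop) (by fun_prop) ?_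
    intro θ h0
    have h1 : circleMap 0 R θ = r := by
      simpa [sub_eq_zero] using h0
    have h2 := congrArg norm h1
    simp [abs_of_pos hr.1, abs_of_pos hR.1] at h2
    exact hlt.ne' h2
  have hP1 : (2 * Real.pi)⁻¹ * ∫ θ in (0 : ℝ)..2 * Real.pi, P θ = 1 := by
    have := DiffContOnCl.circleAverage_poissonKernel_smul (f := fun _ : ℂ => (1 : ℂ)) (c := 0)
      (R := R) (w := (r : ℂ)) (by exact diffContOnCl_const) hrb
    simp only [Real.circleAverage_def, Pi.smul_apply'] at this
    have h2 := congrArg Complex.re this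
    simp only [Complex.real_smul, mul_one] at h2
    rw [intervalIntegral.integral_ofReal] at h2
    exact_mod_cast h2
  have hsl : ∀ ζ : sphere (0 : CN N) 1, ‖f (r • (ζ : CN N))‖ ^ 2 ≤
      (2 * Real.pi)⁻¹ * ∫ θ in (0 : ℝ)..2 * Real.pi,
        P θ * ‖f ((circleMap 0 R θ) • (ζ : CN N))‖ ^ 2 := by
    intro ζ
    have hd : DifferentiableOn ℂ (fun w : ℂ => f (w • (ζ : CN N))) (ball 0 1) :=
      hf.comp (by fun_prop) fun w hw => smul_mem_ball (by simpa using hw) ζ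
    have hdc : DiffContOnCl ℂ (fun w : ℂ => f (w • (ζ : CN N))) (ball 0 R) :=
      (hd.mono (closure_ball_subset_closedBall.trans
        (closedBall_subset_ball hR.2))).diffContOnCl
    have hpo := DiffContOnCl.circleAverage_poissonKernel_smul hdc hrb
    simp only [Real.circleAverage_def, Pi.smul_apply'] at hpo
    have hcf : Continuous fun θ : ℝ => f ((circleMap 0 R θ) • (ζ : CN N)) :=
      hc.comp_continuous (by fun_prop) fun θ =>
        smul_mem_ball (by simp [abs_of_pos hR.1, hR.2]) ζ
    set c : ℂ := f ((r : ℂ) • (ζ : CN N)) with hcdef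
    have hrc : f (r • (ζ : CN N)) = c := by
      rw [hcdef, Complex.coe_smul]
    rw [hrc]
    have e1 : ‖c‖ ^ 2 = (2 * Real.pi)⁻¹ * ∫ θ in (0 : ℝ)..2 * Real.pi,
        P θ * (inner ℝ c (f ((circleMap 0 R θ) • (ζ : CN N)))) := by
      have h3 := (innerSL ℝ c).intervalIntegral_comp_comm (μ := volume)
        ((hPc.smul hcf).intervalIntegrable 0 (2 * Real.pi))
      have h4 : inner ℝ c c = ‖c‖ ^ 2 := real_inner_self_eq_norm_sq c
      simp only [innerSL_apply_apply, Pi.smul_apply', real_inner_smul_right] at h3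
      rw [← h4, h3, ← real_inner_smul_right]
      exact congrArg (inner ℝ c) hpo.symm
    have hs1 : Continuous fun θ => P θ * (‖c‖ ^ 2 / 2) := hPc.mul_const _
    have hs2 : Continuous fun θ => P θ * ‖f ((circleMap 0 R θ) • (ζ : CN N))‖ ^ 2 * 2⁻¹ :=
      (hPc.mul (hcf.norm.pow 2)).mul_const _
    have hsum := hs1.add hs2
    have e2 : ∫ θ in (0 : ℝ)..2 * Real.pi,
        P θ * (inner ℝ c (f ((circleMap 0 R θ) • (ζ : CN N)))) ≤
        ∫ θ in (0 : ℝ)..2 * Real.pi,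
          (P θ * (‖c‖ ^ 2 / 2) + P θ * ‖f ((circleMap 0 R θ) • (ζ : CN N))‖ ^ 2 * 2⁻¹) := by
      apply intervalIntegral.integral_mono_on (by positivity)
      · exact (hPc.mul (continuous_const.inner hcf)).intervalIntegrable _ _
      · exact hsum.intervalIntegrable _ _
      · intro θ _
        have h5 := real_inner_le_norm c (f ((circleMap 0 R θ) • (ζ : CN N)))
        have h6 := two_mul_le_add_sq ‖c‖ ‖f ((circleMap 0 R θ) • (ζ : CN N))‖
        have h7 : inner ℝ c (f ((circleMap 0 R θ) • (ζ : CN N))) ≤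
          ‖c‖ ^ 2 / 2 + ‖f ((circleMap 0 R θ) • (ζ : CN N))‖ ^ 2 * 2⁻¹ := by linarith
        nlinarith [mul_le_mul_of_nonneg_left h7 (hPpos θ)]
    rw [intervalIntegral.integral_add
        (hs1.intervalIntegrable _ _) (hs2.intervalIntegrable _ _),
      intervalIntegral.integral_mul_const, intervalIntegral.integral_mul_const] at e2
    have e3 := mul_le_mul_of_nonneg_left e2 (show 0 ≤ (2 * Real.pi)⁻¹ by positivity)
    rw [← e1, mul_add, ← mul_assoc, hP1, ← mul_assoc] at e3
    linarith
  have hcirc : ∀ θ : ℝ, ∫ ζ, ‖f ((circleMap 0 R θ) • (ζ : CN N))‖ ^ 2 ∂(surfaceMeasure N) =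
      hardyMean f R := by
    intro θ
    rw [hardyMean, ← integral_rot (Circle.exp θ) (fun z => ‖f (R • z)‖ ^ 2)]
    refine integral_congr_ae (Eventually.of_forall fun ζ => ?_)
    change ‖f (circleMap 0 R θ • (ζ : CN N))‖ ^ 2 = ‖f (R • ((Circle.exp θ : ℂ) • (ζ : CN N)))‖ ^ 2
    rw [← Complex.coe_smul, smul_smul, Circle.coe_exp, circleMap_zero]
  have hG : Continuous fun p : sphere (0 : CN N) 1 × ℝ =>
      P p.2 * ‖f ((circleMap 0 R p.2) • (p.1 : CN N))‖ ^ 2 := by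
    refine (hPc.comp continuous_snd).mul ((Continuous.norm ?_).pow 2)
    refine hc.comp_continuous ?_ fun p => smul_mem_ball (by simp [abs_of_pos hR.1, hR.2]) p.1
    fun_prop
  have hGi : Integrable (Function.uncurry fun (ζ : sphere (0 : CN N) 1) (θ : ℝ) =>
      P θ * ‖f ((circleMap 0 R θ) • (ζ : CN N))‖ ^ 2)
      ((surfaceMeasure N).prod (volume.restrict (Ioc 0 (2 * Real.pi)))) := by
    have h1 : IntegrableOn (fun p : sphere (0 : CN N) 1 × ℝ =>
        P p.2 * ‖f ((circleMap 0 R p.2) • (p.1 : CN N))‖ ^ 2)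
        (univ ×ˢ Icc 0 (2 * Real.pi)) ((surfaceMeasure N).prod volume) :=
      hG.continuousOn.integrableOn_compact (isCompact_univ.prod isCompact_Icc)
    have h2 := h1.mono_set (prod_mono_right (s := univ) (Ioc_subset_Icc_self))
    rw [IntegrableOn, ← Measure.prod_restrict, Measure.restrict_univ] at h2
    exact h2
  have hpi : (0 : ℝ) ≤ 2 * Real.pi := by positivity
  calc hardyMean f r
      ≤ ∫ ζ : sphere (0 : CN N) 1, ((2 * Real.pi)⁻¹ * ∫ θ in Ioc 0 (2 * Real.pi),
        P θ * ‖f ((circleMap 0 R θ) • (ζ : CN N))‖ ^ 2) ∂(surfaceMeasure N) := by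
        refine integral_mono (integrable_of_continuous ((continuous_dilate hc hr).norm.pow 2))
          (hGi.integral_prod_left.const_mul _) fun ζ => ?_
        have := hsl ζ
        rwa [intervalIntegral.integral_of_le hpi] at this
    _ = (2 * Real.pi)⁻¹ * ∫ θ in Ioc 0 (2 * Real.pi), P θ * hardyMean f R := by
        rw [integral_const_mul, integral_integral_swap hGi]
        simp_rw [integral_const_mul, hcirc]
    _ = hardyMean f R := by
        rw [integral_mul_const, ← intervalIntegral.integral_of_le hpi, ← mul_assoc, hP1, one_mul]

end Sphere

section Hardy

variable {N : ℕ} [NeZero N]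

theorem hardyMean_add_le {f g : CN N → ℂ} (hf : ContinuousOn f (ball 0 1))
    (hg : ContinuousOn g (ball 0 1)) {r : ℝ} (hr : r ∈ Ioo (0 : ℝ) 1) :
    hardyMean (f + g) r ≤ 2 * hardyMean f r + 2 * hardyMean g r := by
  have hfi : Integrable (fun ζ : sphere (0 : CN N) 1 => ‖f (r • (ζ : CN N))‖ ^ 2)
    (surfaceMeasure N) := integrable_of_continuous ((continuous_dilate hf hr).norm.pow 2)
  have hgi : Integrable (fun ζ : sphere (0 : CN N) 1 => ‖g (r • (ζ : CN N))‖ ^ 2)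
    (surfaceMeasure N) := integrable_of_continuous ((continuous_dilate hg hr).norm.pow 2)
  rw [hardyMean, hardyMean, hardyMean, ← integral_const_mul, ← integral_const_mul,
    ← integral_add (hfi.const_mul 2) (hgi.const_mul 2)]
  refine integral_mono (integrable_of_continuous
    ((continuous_dilate (hf.add hg) hr).norm.pow 2))
    ((hfi.const_mul 2).add (hgi.const_mul 2)) fun ζ => ?_
  have h1 := norm_add_le (f (r • (ζ : CN N))) (g (r • (ζ : CN N)))
  have h2 : ‖f (r • (ζ : CN N)) + g (r • (ζ : CN N))‖ ^ 2 ≤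
      (‖f (r • (ζ : CN N))‖ + ‖g (r • (ζ : CN N))‖) ^ 2 := by gcongr
  change ‖f (r • (ζ : CN N)) + g (r • (ζ : CN N))‖ ^ 2 ≤
    2 * ‖f (r • (ζ : CN N))‖ ^ 2 + 2 * ‖g (r • (ζ : CN N))‖ ^ 2
  nlinarith [sq_nonneg (‖f (r • (ζ : CN N))‖ - ‖g (r • (ζ : CN N))‖)]

/-- The holomorphic functions `f` on the unit ball with `sup_{0<r<1} ∫ |f(rζ)|² dσ(ζ) < ∞`.
A function on the ball is represented by its extension by zero to `ℂ^N`. -/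
def hardySubmodule (N : ℕ) [NeZero N] : Submodule ℂ (CN N → ℂ) where
  carrier := {f | DifferentiableOn ℂ f (ball 0 1) ∧ (∀ z ∉ ball (0 : CN N) 1, f z = 0) ∧
    BddAbove (hardyMean f '' Ioo 0 1)}
  zero_mem' := by
    refine ⟨differentiableOn_const 0, fun _ _ => rfl, 0, ?_⟩
    rintro _ ⟨r, _, rfl⟩
    simp [hardyMean]
  add_mem' := by
    rintro f g ⟨hf, hf0, A, hA⟩ ⟨hg, hg0, B, hB⟩
    refine ⟨hf.add hg, fun z hz => by simp [hf0 z hz, hg0 z hz], 2 * A + 2 * B, ?_⟩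
    rintro _ ⟨r, hr, rfl⟩
    have h1 := hA (mem_image_of_mem _ hr)
    have h2 := hB (mem_image_of_mem _ hr)
    have h3 := hardyMean_add_le hf.continuousOn hg.continuousOn hr
    linarith
  smul_mem' := by
    rintro c f ⟨hf, hf0, A, hA⟩
    refine ⟨hf.const_smul c, fun z hz => by simp [hf0 z hz], ‖c‖ ^ 2 * A, ?_⟩
    rintro _ ⟨r, hr, rfl⟩
    rw [hardyMean_smul]
    exact mul_le_mul_of_nonneg_left (hA (mem_image_of_mem _ hr)) (by positivity)

/-- The Hardy space `H²` of the unit ball of `ℂ^N`. -/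
def HardySpace (N : ℕ) [NeZero N] : Type := hardySubmodule N

namespace HardySpace

instance : AddCommGroup (HardySpace N) := inferInstanceAs (AddCommGroup (hardySubmodule N))

instance : Module ℂ (HardySpace N) := inferInstanceAs (Module ℂ (hardySubmodule N))

/-- The underlying function. -/
def toFun (f : HardySpace N) : CN N → ℂ := Subtype.val (p := (· ∈ hardySubmodule N)) f

instance : CoeFun (HardySpace N) fun _ => CN N → ℂ := ⟨toFun⟩

theorem mem (f : HardySpace N) : f.toFun ∈ hardySubmodule N :=
  Subtype.property (p := (· ∈ hardySubmodule N)) f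

theorem ext {f g : HardySpace N} (h : ∀ z, f z = g z) : f = g :=
  Subtype.ext (p := (· ∈ hardySubmodule N)) (funext h)

@[simp] theorem add_apply (f g : HardySpace N) (z : CN N) : (f + g) z = f z + g z := rfl

@[simp] theorem sub_apply (f g : HardySpace N) (z : CN N) : (f - g) z = f z - g z := rfl

@[simp] theorem smul_apply (c : ℂ) (f : HardySpace N) (z : CN N) : (c • f) z = c * f z := rfl

@[simp] theorem zero_apply (z : CN N) : (0 : HardySpace N) z = 0 := rfl

theorem differentiableOn (f : HardySpace N) : DifferentiableOn ℂ f (ball 0 1) := f.mem.1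

theorem tendsto_mean (f : HardySpace N) :
    Tendsto (hardyMean f) (𝓝[<] 1) (𝓝 (sSup (hardyMean f '' Ioo 0 1))) := by
  have hne : (Ioo (0 : ℝ) 1).Nonempty := ⟨1 / 2, by norm_num, by norm_num⟩
  exact (hardyMean_mono f.mem.1).tendsto_nhdsWithin_Ioo_left hne f.mem.2.2

theorem integrable_pairing (f g : HardySpace N) {r : ℝ} (hr : r ∈ Ioo (0 : ℝ) 1) :
    Integrable (fun ζ : sphere (0 : CN N) 1 => inner ℂ (f (r • (ζ : CN N))) (g (r • (ζ : CN N))))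
      (surfaceMeasure N) :=
  integrable_of_continuous ((continuous_dilate f.mem.1.continuousOn hr).inner
    (continuous_dilate g.mem.1.continuousOn hr))

theorem pairing_self (f : HardySpace N) (r : ℝ) : hardyPairing f f r = (hardyMean f r : ℂ) := by
  rw [hardyPairing, hardyMean, ← integral_complex_ofReal]
  simp [inner_self_eq_norm_sq_to_K]

theorem eventually_Ioo : ∀ᶠ r : ℝ in 𝓝[<] 1, r ∈ Ioo (0 : ℝ) 1 :=
  Ioo_mem_nhdsLT (by norm_num)

theorem exists_tendsto_pairing (f g : HardySpace N) :
    ∃ L, Tendsto (hardyPairing f g) (𝓝[<] 1) (𝓝 L) := by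
  have hM : ∀ h : HardySpace N, Tendsto (fun r => (hardyMean h r : ℂ)) (𝓝[<] 1)
      (𝓝 ((sSup (hardyMean h '' Ioo 0 1) : ℝ) : ℂ)) := fun h =>
    (Complex.continuous_ofReal.tendsto _).comp (tendsto_mean h)
  refine ⟨_, Tendsto.congr' ?_ ((((hM (f + g)).sub (hM (f - g))).add
    (((hM (f - Complex.I • g)).sub (hM (f + Complex.I • g))).mul_const Complex.I)).div_const 4)⟩
  filter_upwards [eventually_Ioo] with r hr
  have hi : ∀ h : HardySpace N, Integrable (fun ζ : sphere (0 : CN N) 1 =>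
      ((‖h (r • (ζ : CN N))‖ ^ 2 : ℝ) : ℂ)) (surfaceMeasure N) := fun h =>
    integrable_of_continuous (Complex.continuous_ofReal.comp
      ((continuous_dilate h.mem.1.continuousOn hr).norm.pow 2))
  have hi2 : ∀ h k : HardySpace N, Integrable (fun ζ : sphere (0 : CN N) 1 =>
      ((‖h (r • (ζ : CN N))‖ ^ 2 : ℝ) : ℂ) - ((‖k (r • (ζ : CN N))‖ ^ 2 : ℝ) : ℂ))
      (surfaceMeasure N) := fun h k => (hi h).sub (hi k)
  simp only [hardyMean, hardyPairing, ← integral_complex_ofReal]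
  rw [← integral_sub (hi _) (hi _), ← integral_sub (hi _) (hi _), ← integral_mul_const,
    ← integral_add (hi2 _ _) ((hi2 _ _).mul_const _), ← integral_div]
  refine integral_congr_ae (Eventually.of_forall fun ζ => ?_)
  simp only
  rw [inner_eq_sum_norm_sq_div_four]
  simp

/-- The inner product of `H²`: `lim_{r → 1⁻} ∫ ⟨f(rζ), g(rζ)⟩ dσ(ζ)`, conjugate-linear in `f`. -/
noncomputable def pair (f g : HardySpace N) : ℂ := limUnder (𝓝[<] (1 : ℝ)) (hardyPairing f g)

theorem tendsto_pairing (f g : HardySpace N) :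
    Tendsto (hardyPairing f g) (𝓝[<] 1) (𝓝 (pair f g)) :=
  tendsto_nhds_limUnder (exists_tendsto_pairing f g)

theorem pair_self_eq (f : HardySpace N) :
    pair f f = ((sSup (hardyMean f '' Ioo 0 1) : ℝ) : ℂ) := by
  refine tendsto_nhds_unique (tendsto_pairing f f) ?_
  refine ((Complex.continuous_ofReal.tendsto _).comp (tendsto_mean f)).congr fun r => ?_
  exact (pairing_self f r).symm

theorem mean_le_sSup (f : HardySpace N) {r : ℝ} (hr : r ∈ Ioo (0 : ℝ) 1) :
    hardyMean f r ≤ sSup (hardyMean f '' Ioo 0 1) :=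
  le_csSup f.mem.2.2 (mem_image_of_mem _ hr)

theorem eq_zero_of_mean (f : HardySpace N) (h : sSup (hardyMean f '' Ioo 0 1) = 0) : f = 0 := by
  have hr : ∀ r ∈ Ioo (0 : ℝ) 1, ∀ ζ : sphere (0 : CN N) 1, f (r • (ζ : CN N)) = 0 := by
    intro r hr
    have hc := continuous_dilate f.mem.1.continuousOn hr
    have h0 : hardyMean f r = 0 :=
      le_antisymm (h ▸ mean_le_sSup f hr) (hardyMean_nonneg _ _)
    have hc2 : Continuous fun ζ : sphere (0 : CN N) 1 => ‖f (r • (ζ : CN N))‖ ^ 2 :=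
      hc.norm.pow 2
    rw [hardyMean, integral_eq_zero_iff_of_nonneg (fun _ => sq_nonneg _)
      (integrable_of_continuous hc2)] at h0
    have h1 := (Continuous.ae_eq_iff_eq (surfaceMeasure N) hc2 continuous_zero).1 h0
    intro ζ
    simpa using congrFun h1 ζ
  have hne : ∀ z ∈ ball (0 : CN N) 1, z ≠ 0 → f z = 0 := by
    intro z hz hz0
    have hpos : 0 < ‖z‖ := norm_pos_iff.2 hz0
    have := hr ‖z‖ ⟨hpos, by simpa using hz⟩ ⟨‖z‖⁻¹ • z, by simp [norm_smul, hpos.ne']⟩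
    simpa [smul_smul, hpos.ne'] using this
  have h00 : f 0 = 0 := by
    have hcont : Tendsto f (𝓝[≠] (0 : CN N)) (𝓝 (f 0)) :=
      ((f.mem.1.continuousOn.continuousAt (ball_mem_nhds 0 one_pos)).tendsto).mono_left
        nhdsWithin_le_nhds
    refine tendsto_nhds_unique hcont (Tendsto.congr' ?_ tendsto_const_nhds)
    filter_upwards [self_mem_nhdsWithin, nhdsWithin_le_nhds (ball_mem_nhds (0 : CN N) one_pos)]
      with z hz hzb using (hne z hzb hz).symm
  refine ext fun z => ?_
  by_cases hz : z ∈ ball (0 : CN N) 1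
  · by_cases hz0 : z = 0
    · rw [hz0]; exact h00
    · exact hne z hz hz0
  · exact f.mem.2.1 z hz

/-- The inner product axioms for `pair`. -/
@[reducible] noncomputable def innerCore : InnerProductSpace.Core ℂ (HardySpace N) where
  inner := pair
  conj_inner_symm f g := by
    refine tendsto_nhds_unique ((Complex.continuous_conj.tendsto _).comp (tendsto_pairing g f))
      ((tendsto_pairing f g).congr fun r => ?_)
    simp only [Function.comp_apply, hardyPairing, ← integral_conj, inner_conj_symm]
  re_inner_nonneg f := by
    rw [pair_self_eq]
    simpa using (hardyMean_nonneg _ _).trans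
      (mean_le_sSup f (r := 1 / 2) ⟨by norm_num, by norm_num⟩)
  add_left f g h := by
    refine tendsto_nhds_unique (tendsto_pairing (f + g) h)
      (Tendsto.congr' ?_ ((tendsto_pairing f h).add (tendsto_pairing g h)))
    filter_upwards [eventually_Ioo] with r hr
    simp only [hardyPairing, add_apply, inner_add_left]
    rw [integral_add (integrable_pairing f h hr) (integrable_pairing g h hr)]
  smul_left f g c := by
    refine tendsto_nhds_unique (tendsto_pairing (c • f) g)
      (Tendsto.congr ?_ ((tendsto_pairing f g).const_mul _))
    intro r
    simp only [hardyPairing, smul_apply, ← smul_eq_mul (a := c), inner_smul_left]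
    rw [integral_const_mul]
  definite f h := by
    rw [pair_self_eq] at h
    exact eq_zero_of_mean f (by exact_mod_cast h)

noncomputable instance : NormedAddCommGroup (HardySpace N) :=
  (innerCore (N := N)).toNormedAddCommGroup

noncomputable instance : InnerProductSpace ℂ (HardySpace N) :=
  InnerProductSpace.ofCore (innerCore (N := N)).toCore

/-- The norm of `H²` is `‖f‖² = sup_{0<r<1} ∫ |f(rζ)|² dσ(ζ)`. -/
theorem norm_sq_eq (f : HardySpace N) : ‖f‖ ^ 2 = sSup (hardyMean f '' Ioo 0 1) := by
  have h : inner ℂ f f = _ := pair_self_eq f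
  have h2 : (inner ℂ f f : ℂ) = ((‖f‖ ^ 2 : ℝ) : ℂ) := by
    rw [inner_self_eq_norm_sq_to_K]; simp
  rw [h2] at h
  exact_mod_cast h

end HardySpace

end Hardy

section Bergman

/-- The measure `(1 - |z|²)^α dv(z)` on the unit ball. -/
noncomputable def ballWeight (N : ℕ) (α : ℝ) : Measure (CN N) :=
  (volume.restrict (ball 0 1)).withDensity fun z => ENNReal.ofReal ((1 - ‖z‖ ^ 2) ^ α)

/-- The normalized measure `dv_α(z) = c_α (1 - |z|²)^α dv(z)` on the unit ball. -/
noncomputable def bergmanMeasure (N : ℕ) (α : ℝ) : Measure (CN N) :=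
  (ballWeight N α univ)⁻¹ • ballWeight N α

variable {N : ℕ}

theorem measurable_weight (α : ℝ) :
    Measurable fun z : CN N => ENNReal.ofReal ((1 - ‖z‖ ^ 2) ^ α) := by
  fun_prop

theorem bergmanMeasure_absolutelyContinuous (α : ℝ) :
    bergmanMeasure N α ≪ volume.restrict (ball (0 : CN N) 1) :=
  (Measure.smul_absolutelyContinuous).trans (withDensity_absolutelyContinuous _ _)

theorem aestronglyMeasurable_bergman {f : CN N → ℂ} (hf : DifferentiableOn ℂ f (ball 0 1))
    (α : ℝ) : AEStronglyMeasurable f (bergmanMeasure N α) :=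
  (hf.continuousOn.aestronglyMeasurable measurableSet_ball).mono_ac
    (bergmanMeasure_absolutelyContinuous α)

theorem memLp_bergman_iff {f : CN N → ℂ} (hf : DifferentiableOn ℂ f (ball 0 1)) (α : ℝ) :
    MemLp f 2 (bergmanMeasure N α) ↔ Integrable (fun z => ‖f z‖ ^ 2) (bergmanMeasure N α) :=
  memLp_two_iff_integrable_sq_norm (aestronglyMeasurable_bergman hf α)

/-- The holomorphic functions `f` on the unit ball with `∫ |f|² dv_α < ∞`.
A function on the ball is represented by its extension by zero to `ℂ^N`. -/
def bergmanSubmodule (N : ℕ) (α : ℝ) : Submodule ℂ (CN N → ℂ) where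
  carrier := {f | DifferentiableOn ℂ f (ball 0 1) ∧ (∀ z ∉ ball (0 : CN N) 1, f z = 0) ∧
    Integrable (fun z => ‖f z‖ ^ 2) (bergmanMeasure N α)}
  zero_mem' := ⟨differentiableOn_const 0, fun _ _ => rfl, by simp⟩
  add_mem' := by
    rintro f g ⟨hf, hf0, hfi⟩ ⟨hg, hg0, hgi⟩
    refine ⟨hf.add hg, fun z hz => by simp [hf0 z hz, hg0 z hz], ?_⟩
    exact (memLp_bergman_iff (hf.add hg) α).1
      (((memLp_bergman_iff hf α).2 hfi).add ((memLp_bergman_iff hg α).2 hgi))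
  smul_mem' := by
    rintro c f ⟨hf, hf0, hfi⟩
    refine ⟨hf.const_smul c, fun z hz => by simp [hf0 z hz], ?_⟩
    exact (memLp_bergman_iff (hf.const_smul c) α).1 (((memLp_bergman_iff hf α).2 hfi).const_smul c)

variable [NeZero N] {α : ℝ}

theorem ballWeight_univ_ne_top (hα : -1 < α) : ballWeight N α univ ≠ ∞ := by
  have h1 : IntegrableOn (fun y : ℝ => (1 - y) ^ α) (Ioo 0 1) := by
    have h := (intervalIntegral.intervalIntegrable_rpow' (a := 0) (b := 1) hα).comp_sub_left 1
    simp only [sub_zero, sub_self] at h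
    have h' := h.symm
    rw [intervalIntegrable_iff_integrableOn_Ioo_of_le (by norm_num)] at h'
    exact h'
  have h2 : IntegrableOn (fun y : ℝ => y ^ (Module.finrank ℝ (CN N) - 1) • (1 - y ^ 2) ^ α)
      (Ioo 0 1) := by
    have h3 : IntegrableOn (fun y : ℝ =>
        (y ^ (Module.finrank ℝ (CN N) - 1) * (1 + y) ^ α) * (1 - y) ^ α) (Ioo 0 1) := by
      refine Integrable.bdd_mul (c := max 1 (2 ^ α)) h1 ?_ ?_
      · exact Measurable.aestronglyMeasurable (by fun_prop)
      · refine (ae_restrict_iff' measurableSet_Ioo).2 (Eventually.of_forall fun y hy => ?_)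
        have hy0 : 0 ≤ y ^ (Module.finrank ℝ (CN N) - 1) := pow_nonneg hy.1.le _
        have hy1 : y ^ (Module.finrank ℝ (CN N) - 1) ≤ 1 := pow_le_one₀ hy.1.le hy.2.le
        have hp : 0 ≤ (1 + y) ^ α := Real.rpow_nonneg (by linarith [hy.1]) _
        rw [Real.norm_of_nonneg (mul_nonneg hy0 hp)]
        refine (mul_le_of_le_one_left hp hy1).trans ?_
        rcases le_total 0 α with ha | ha
        · exact le_max_of_le_right (Real.rpow_le_rpow (by linarith [hy.1]) (by linarith [hy.2]) ha)
        · exact le_max_of_le_left (Real.rpow_le_one_of_one_le_of_nonpos (by linarith [hy.1]) ha)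
    refine h3.congr_fun (fun y hy => ?_) measurableSet_Ioo
    have e : (1 - y ^ 2 : ℝ) = (1 + y) * (1 - y) := by ring
    simp only [smul_eq_mul]
    rw [e, Real.mul_rpow (by linarith [hy.1]) (by linarith [hy.2]), mul_assoc]
  have h3 := (integrableOn_fun_norm_addHaar (volume : Measure (CN N))
    (f := fun y : ℝ => (1 - y ^ 2) ^ α) (r := 1)).2 h2
  rw [ballWeight, withDensity_apply _ MeasurableSet.univ, Measure.restrict_univ]
  exact (Integrable.lintegral_lt_top h3).ne

/-- The weighted Bergman space `A²_α` of the unit ball of `ℂ^N`, for `α > -1`. -/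
def BergmanSpace (N : ℕ) [NeZero N] {α : ℝ} (_ : -1 < α) : Type := bergmanSubmodule N α

namespace BergmanSpace

variable {hα : -1 < α}

instance : AddCommGroup (BergmanSpace N hα) :=
  inferInstanceAs (AddCommGroup (bergmanSubmodule N α))

instance : Module ℂ (BergmanSpace N hα) := inferInstanceAs (Module ℂ (bergmanSubmodule N α))

/-- The underlying function. -/
def toFun (f : BergmanSpace N hα) : CN N → ℂ := Subtype.val (p := (· ∈ bergmanSubmodule N α)) f

instance : CoeFun (BergmanSpace N hα) fun _ => CN N → ℂ := ⟨toFun⟩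

theorem mem (f : BergmanSpace N hα) : f.toFun ∈ bergmanSubmodule N α :=
  Subtype.property (p := (· ∈ bergmanSubmodule N α)) f

theorem ext {f g : BergmanSpace N hα} (h : ∀ z, f z = g z) : f = g :=
  Subtype.ext (p := (· ∈ bergmanSubmodule N α)) (funext h)

@[simp] theorem add_apply (f g : BergmanSpace N hα) (z : CN N) : (f + g) z = f z + g z := rfl

@[simp] theorem smul_apply (c : ℂ) (f : BergmanSpace N hα) (z : CN N) : (c • f) z = c * f z := rfl

@[simp] theorem zero_apply (z : CN N) : (0 : BergmanSpace N hα) z = 0 := rfl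

theorem memLp (f : BergmanSpace N hα) : MemLp f 2 (bergmanMeasure N α) :=
  (memLp_bergman_iff f.mem.1 α).2 f.mem.2.2

theorem integrable_inner (f g : BergmanSpace N hα) :
    Integrable (fun z => inner ℂ (f z) (g z)) (bergmanMeasure N α) := by
  have h := f.memLp.star.integrable_mul g.memLp
  refine h.congr (Eventually.of_forall fun z => ?_)
  simp [mul_comm]

/-- The inner product of `A²_α`: `∫ ⟨f, g⟩ dv_α`, conjugate-linear in `f`. -/
noncomputable def pair (f g : BergmanSpace N hα) : ℂ :=
  ∫ z, inner ℂ (f z) (g z) ∂(bergmanMeasure N α)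

theorem pair_self_eq (f : BergmanSpace N hα) :
    pair f f = ((∫ z, ‖f z‖ ^ 2 ∂(bergmanMeasure N α) : ℝ) : ℂ) := by
  rw [pair, ← integral_complex_ofReal]
  simp [inner_self_eq_norm_sq_to_K]

theorem eq_zero_of_integral (f : BergmanSpace N hα)
    (h : ∫ z, ‖f z‖ ^ 2 ∂(bergmanMeasure N α) = 0) : f = 0 := by
  rw [integral_eq_zero_iff_of_nonneg (fun _ => sq_nonneg _) f.mem.2.2, bergmanMeasure] at h
  have h1 : ∀ᵐ z ∂(ballWeight N α), ‖f z‖ ^ 2 = 0 :=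
    (Measure.ae_ennreal_smul_measure_iff
      (ENNReal.inv_ne_zero.2 (ballWeight_univ_ne_top hα))).1 h
  rw [ballWeight, ae_withDensity_iff (measurable_weight α)] at h1
  have h2 : f.toFun =ᵐ[volume.restrict (ball (0 : CN N) 1)] fun _ => 0 := by
    filter_upwards [h1, ae_restrict_mem measurableSet_ball] with z hz hzb
    have hlt : ‖z‖ < 1 := by simpa using hzb
    have hpos : 0 < (1 - ‖z‖ ^ 2) ^ α :=
      Real.rpow_pos_of_pos (by nlinarith [norm_nonneg z]) _
    simpa using hz (by simpa using hpos)
  have h3 := Measure.eqOn_open_of_ae_eq h2 isOpen_ball f.mem.1.continuousOn continuousOn_const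
  refine ext fun z => ?_
  by_cases hz : z ∈ ball (0 : CN N) 1
  · exact h3 hz
  · exact f.mem.2.1 z hz

/-- The inner product axioms for `pair`. -/
@[reducible] noncomputable def innerCore : InnerProductSpace.Core ℂ (BergmanSpace N hα) where
  inner := pair
  conj_inner_symm f g := by
    simp only [pair, ← integral_conj, inner_conj_symm]
  re_inner_nonneg f := by
    rw [pair_self_eq]
    simpa using integral_nonneg fun z => sq_nonneg ‖f z‖
  add_left f g h := by
    simp only [pair, add_apply, inner_add_left]
    exact integral_add (integrable_inner f h) (integrable_inner g h)
  smul_left f g c := by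
    simp only [pair, smul_apply, ← smul_eq_mul (a := c), inner_smul_left]
    rw [integral_const_mul]
  definite f h := by
    rw [pair_self_eq] at h
    exact eq_zero_of_integral f (by exact_mod_cast h)

noncomputable instance : NormedAddCommGroup (BergmanSpace N hα) :=
  (innerCore (N := N) (hα := hα)).toNormedAddCommGroup

noncomputable instance : InnerProductSpace ℂ (BergmanSpace N hα) :=
  InnerProductSpace.ofCore (innerCore (N := N) (hα := hα)).toCore

/-- The norm of `A²_α` is `‖f‖² = ∫ |f|² dv_α`. -/
theorem norm_sq_eq (f : BergmanSpace N hα) :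
    ‖f‖ ^ 2 = ∫ z, ‖f z‖ ^ 2 ∂(bergmanMeasure N α) := by
  have h : inner ℂ f f = _ := pair_self_eq f
  have h2 : (inner ℂ f f : ℂ) = ((‖f‖ ^ 2 : ℝ) : ℂ) := by
    rw [inner_self_eq_norm_sq_to_K]; simp
  rw [h2] at h
  exact_mod_cast h

end BergmanSpace

end Bergman

section Automorphisms

variable {N : ℕ}

/-- `φ` restricts to an automorphism of the unit ball: a holomorphic bijection of the ball onto
itself with holomorphic inverse. The values of `φ` off the open ball play no role. -/
def IsBallAut (φ : CN N → CN N) : Prop :=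
  DifferentiableOn ℂ φ (ball 0 1) ∧ MapsTo φ (ball 0 1) (ball 0 1) ∧
    ∃ χ : CN N → CN N, DifferentiableOn ℂ χ (ball 0 1) ∧ MapsTo χ (ball 0 1) (ball 0 1) ∧
      InvOn χ φ (ball 0 1) (ball 0 1)

/-- `a` is a boundary fixed point of `φ`: `φ(z) → a` as `z → a` in the ball. -/
def IsBoundaryFixedPt (φ : CN N → CN N) (a : CN N) : Prop :=
  a ∈ sphere (0 : CN N) 1 ∧ Tendsto φ (𝓝[ball 0 1] a) (𝓝 a)

/-- `a` is the Denjoy–Wolff point of `φ`: the iterates of `φ` converge to `a` uniformly on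
compact subsets of the ball. -/
def IsDenjoyWolffPt (φ : CN N → CN N) (a : CN N) : Prop :=
  ∀ C : Set (CN N), IsCompact C → C ⊆ ball 0 1 →
    TendstoUniformlyOn (fun k : ℕ => φ^[k]) (fun _ => a) atTop C

/-- `Φ` is a holomorphic map on a neighbourhood of the closed ball that extends `φ`. -/
def IsHolomorphicExtension (φ Φ : CN N → CN N) : Prop :=
  (∃ U : Set (CN N), IsOpen U ∧ closedBall 0 1 ⊆ U ∧ DifferentiableOn ℂ Φ U) ∧
    EqOn Φ φ (ball 0 1)

/-- The ball algebra: continuous on the closed ball and holomorphic inside. -/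
def MemBallAlgebra (ψ : CN N → ℂ) : Prop :=
  ContinuousOn ψ (closedBall 0 1) ∧ DifferentiableOn ℂ ψ (ball 0 1)

/-- `inf_{z ∈ ball} |ψ(z)| > 0`. -/
def BoundedAwayFromZero (ψ : CN N → ℂ) : Prop :=
  ∃ c : ℝ, 0 < c ∧ ∀ z ∈ ball (0 : CN N) 1, c ≤ ‖ψ z‖

/-- The closed annulus with radii `s` and `t`, in whichever order they fall. -/
def closedAnnulus (s t : ℝ) : Set ℂ := {l | min s t ≤ ‖l‖ ∧ ‖l‖ ≤ max s t}

/-- The spectral radius of a linear map of `ℂ^N`, as a real number. -/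
noncomputable def specRad (A : CN N →L[ℂ] CN N) : ℝ := (spectralRadius ℂ A).toReal

end Automorphisms

end WCO

open WCO

/-!
Every automorphism of the ball is a Möbius involution composed with a unitary map. With boundary
fixed points `a` and `b`, it multiplies the half-plane coordinate `h = (1 - ⟨z, b⟩) / (1 - ⟨z, a⟩)`
by a constant `ρ`, and `ρ > 1` because the iterates tend to `a`. Thus `log |h|` is a Lyapunov
function: all but boundedly many points of an orbit lie near `b` or near `a`.

Composition with the automorphism becomes contractive after multiplication by the Möbius weight, so
the growth of `Tⁿ`, where `T = C_{ψ,φ}`, is governed by products along orbits of `ψ` divided by this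
weight, which are close to `|ψ(b)| ρ^{-K}` near `b` and to `|ψ(a)| ρ^K` near `a`. The same applies
to `T⁻¹`, which puts the spectrum inside the annulus. Multiplication by `h^{it}` conjugates `T` to
`ρ^{it} T`, so the spectrum and the set of eigenvalues are invariant under rotation.

If `|ψ(b)| ρ^{-K} < r < |ψ(a)| ρ^K`, a function `g` vanishing to high order at `a` and at `b`
satisfies `‖Tⁿ g‖ ≲ sⁿ` with `s < r` and `‖T⁻ⁿ g‖ ≲ tⁿ` with `t < 1 / r`, and for some `θ` the
series `∑ r⁻ⁿ e^{inθ} Tⁿ g` over all integers `n` is a nonzero eigenvector. In the opposite case the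
adjoint and the reproducing kernel at the origin take the places of `T` and `g`.

The argument uses only a few properties shared by the two scales of spaces. For the Hardy space
these follow from those of the Bergman spaces as `α → -1`, when the measures concentrate on the
sphere.
-/

namespace WCO

section Moebius

variable {E : Type*} [NormedAddCommGroup E]

/-- The number `√(1 - |c|²)`, the scaling factor of the Möbius involution of the unit ball that
exchanges `0` and `c`. -/
noncomputable def defect (c : E) : ℝ := Real.sqrt (1 - ‖c‖ ^ 2)

theorem defect_sq {c : E} (hc : ‖c‖ < 1) : defect c ^ 2 = 1 - ‖c‖ ^ 2 :=
  Real.sq_sqrt (by nlinarith [norm_nonneg c])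

theorem defect_pos {c : E} (hc : ‖c‖ < 1) : 0 < defect c :=
  Real.sqrt_pos.2 (by nlinarith [norm_nonneg c])

theorem norm_mul_norm_lt_one {c z : E} (hc : ‖c‖ < 1) (hz : ‖z‖ ≤ 1) : ‖c‖ * ‖z‖ < 1 := by
  nlinarith [norm_nonneg c, norm_nonneg z]

theorem one_add_defect_ne_zero {c : E} (hc : ‖c‖ < 1) : (1 + defect c : ℂ) ≠ 0 := by
  have := defect_pos hc
  exact_mod_cast (by positivity : (1 + defect c) ≠ 0)

variable [InnerProductSpace ℂ E]

/-- The Möbius involution of the unit ball that exchanges `0` and `c`. Mathlib's inner product is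
conjugate-linear on the left, so `inner ℂ c z` is the `⟨z, c⟩` of complex analysis. The usual
formula divides by `|c|²`; the factor `1 / (1 + defect c)` agrees with it and also covers `c = 0`,
where the map is `z ↦ -z`. -/
noncomputable def moebius (c z : E) : E :=
  (1 - inner ℂ c z)⁻¹ • (c - (defect c : ℂ) • z - (inner ℂ c z / (1 + defect c)) • c)

theorem re_one_sub_inner_pos {c z : E} (h : ‖c‖ * ‖z‖ < 1) : 0 < (1 - inner ℂ c z : ℂ).re := by
  have := (Complex.abs_re_le_norm (inner ℂ c z)).trans (norm_inner_le_norm c z)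
  rw [Complex.sub_re, Complex.one_re]
  linarith [le_abs_self (inner ℂ c z : ℂ).re]

theorem one_sub_inner_ne_zero {c z : E} (h : ‖c‖ * ‖z‖ < 1) : (1 - inner ℂ c z : ℂ) ≠ 0 := by
  intro h0
  simpa [h0] using re_one_sub_inner_pos h

theorem inner_self_eq_one_sub_defect_sq {c : E} (hc : ‖c‖ < 1) :
    inner ℂ c c = (1 : ℂ) - (defect c : ℂ) ^ 2 := by
  rw [inner_self_eq_norm_sq_to_K, ← Complex.ofReal_pow, defect_sq hc]
  simp

theorem one_sub_inner_comm_ne_zero {c z : E} (hz : (1 - inner ℂ c z : ℂ) ≠ 0) :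
    (1 - inner ℂ z c : ℂ) ≠ 0 := by
  rw [← inner_conj_symm, ← map_one (starRingEnd ℂ), ← map_sub]
  exact (map_ne_zero _).2 hz

theorem one_sub_inner_moebius {c z w : E} (hc : ‖c‖ < 1) (hz : (1 - inner ℂ c z : ℂ) ≠ 0)
    (hw : (1 - inner ℂ c w : ℂ) ≠ 0) :
    1 - inner ℂ (moebius c w) (moebius c z) =
      ((defect c : ℂ) ^ 2 * (1 - inner ℂ w z)) /
        ((1 - inner ℂ c z) * (starRingEnd ℂ) (1 - inner ℂ c w)) := by
  have hw' := one_sub_inner_comm_ne_zero hw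
  have hs := one_add_defect_ne_zero hc
  simp only [moebius, inner_smul_left, inner_smul_right, inner_sub_left, inner_sub_right, map_inv₀,
    map_sub, map_one, map_div₀, map_add, Complex.conj_ofReal, inner_conj_symm,
    inner_self_eq_one_sub_defect_sq hc]
  field_simp
  ring

theorem one_sub_norm_sq_moebius {c z : E} (hc : ‖c‖ < 1) (hz : (1 - inner ℂ c z : ℂ) ≠ 0) :
    1 - ‖moebius c z‖ ^ 2 = defect c ^ 2 * (1 - ‖z‖ ^ 2) / ‖(1 - inner ℂ c z : ℂ)‖ ^ 2 := by
  have h := one_sub_inner_moebius hc hz hz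
  rw [inner_self_eq_norm_sq_to_K, inner_self_eq_norm_sq_to_K, Complex.mul_conj,
    Complex.normSq_eq_norm_sq] at h
  apply Complex.ofReal_injective
  push_cast at h ⊢
  exact h

theorem norm_moebius_lt_one {c z : E} (hc : ‖c‖ < 1) (hz : ‖z‖ < 1) : ‖moebius c z‖ < 1 := by
  have hD := one_sub_inner_ne_zero (norm_mul_norm_lt_one hc hz.le)
  have hpos : 0 < 1 - ‖moebius c z‖ ^ 2 := by
    rw [one_sub_norm_sq_moebius hc hD]
    have := defect_pos hc
    have : 0 < ‖(1 - inner ℂ c z : ℂ)‖ := norm_pos_iff.2 hD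
    have : 0 < 1 - ‖z‖ ^ 2 := by nlinarith [norm_nonneg z]
    positivity
  nlinarith [norm_nonneg (moebius c z)]

theorem one_sub_inner_moebius_right {c z : E} (hc : ‖c‖ < 1) (hz : (1 - inner ℂ c z : ℂ) ≠ 0) :
    1 - inner ℂ c (moebius c z) = (defect c : ℂ) ^ 2 / (1 - inner ℂ c z) := by
  have hs := one_add_defect_ne_zero hc
  simp only [moebius, inner_smul_right, inner_sub_right, inner_self_eq_one_sub_defect_sq hc]
  field_simp
  ring

theorem moebius_moebius {c z : E} (hc : ‖c‖ < 1) (hz : (1 - inner ℂ c z : ℂ) ≠ 0) :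
    moebius c (moebius c z) = z := by
  have hs := one_add_defect_ne_zero hc
  have hs0 : (defect c : ℂ) ≠ 0 := by exact_mod_cast (defect_pos hc).ne'
  have hinner : inner ℂ c (moebius c z) = 1 - (defect c : ℂ) ^ 2 / (1 - inner ℂ c z) := by
    rw [← one_sub_inner_moebius_right hc hz]; ring
  rw [moebius, hinner, moebius]
  set D := (1 - inner ℂ c z : ℂ) with hD
  rw [show inner ℂ c z = 1 - D by rw [hD]; ring]
  match_scalars
  · field_simp
    ring
  · field_simp
    ring

theorem moebius_zero (c : E) : moebius c 0 = c := by simp [moebius]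

theorem moebius_self {c : E} (hc : ‖c‖ < 1) : moebius c c = 0 := by
  simpa only [moebius_zero] using moebius_moebius (z := 0) hc (by simp)

theorem mapsTo_moebius {c : E} (hc : ‖c‖ < 1) : MapsTo (moebius c) (ball 0 1) (ball 0 1) :=
  fun _ hz => mem_ball_zero_iff.2 (norm_moebius_lt_one hc (mem_ball_zero_iff.1 hz))

theorem moebius_moebius_of_mem_ball {c z : E} (hc : ‖c‖ < 1) (hz : z ∈ ball (0 : E) 1) :
    moebius c (moebius c z) = z :=
  moebius_moebius hc (one_sub_inner_ne_zero
    (norm_mul_norm_lt_one hc (mem_ball_zero_iff.1 hz).le))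

theorem moebius_image_ball {c : E} (hc : ‖c‖ < 1) : moebius c '' ball 0 1 = ball 0 1 :=
  (mapsTo_moebius hc).image_subset.antisymm fun z hz =>
    ⟨moebius c z, mapsTo_moebius hc hz, moebius_moebius_of_mem_ball hc hz⟩

/-- The complex derivative of `moebius c` at `z`, written as a multiple of a transvection so that
its determinant can be read off. -/
noncomputable def moebiusDeriv (c z : E) : E →L[ℂ] E :=
  (-(defect c : ℂ) / (1 - inner ℂ c z)) • (ContinuousLinearMap.id ℂ E +
    (innerSL ℂ c).smulRight ((defect c : ℂ)⁻¹ • ((1 + defect c : ℂ)⁻¹ • c - moebius c z)))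

theorem hasFDerivAt_moebius {c z : E} (hc : ‖c‖ < 1) (hz : (1 - inner ℂ c z : ℂ) ≠ 0) :
    HasFDerivAt (moebius c) (moebiusDeriv c z) z := by
  have hs0 : (defect c : ℂ) ≠ 0 := by exact_mod_cast (defect_pos hc).ne'
  have hs := one_add_defect_ne_zero hc
  have hinner : HasFDerivAt (fun w : E => (inner ℂ c w : ℂ)) (innerSL ℂ c) z :=
    (innerSL ℂ c).hasFDerivAt
  have hdenom : HasFDerivAt (fun w : E => (1 - inner ℂ c w : ℂ)⁻¹) _ z :=
    (hasDerivAt_inv hz).comp_hasFDerivAt z (hinner.const_sub 1)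
  have hnum : HasFDerivAt (fun w : E => c - (defect c : ℂ) • w -
      (inner ℂ c w / (1 + defect c) : ℂ) • c) _ z :=
    (((hasFDerivAt_id z).const_smul (defect c : ℂ)).const_sub c).sub
      ((hinner.mul_const (1 + defect c : ℂ)⁻¹).smul_const c)
  refine (hdenom.smul hnum).congr_fderiv ?_
  ext1 h
  simp only [moebiusDeriv, moebius, Complex.coe_smul, smul_neg, neg_smul, neg_neg, add_apply,
    smul_apply, sub_apply, neg_apply, ContinuousLinearMap.id_apply,
    ContinuousLinearMap.smulRight_apply, coe_innerSL_apply, smul_eq_mul, smul_add]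
  match_scalars <;> field_simp <;> first | ring1 | rfl

theorem differentiableOn_moebius {c : E} (hc : ‖c‖ < 1) :
    DifferentiableOn ℂ (moebius c) (ball 0 1) := fun _ hz =>
  (hasFDerivAt_moebius hc (one_sub_inner_ne_zero (norm_mul_norm_lt_one hc
    (mem_ball_zero_iff.1 hz).le))).differentiableAt.differentiableWithinAt

/-- The automorphism of the unit ball that acts as the unitary map `V` followed by the Möbius
involution `moebius c`; every automorphism of the ball of `ℂ^N` has this form
(`IsBallAut.exists_eqOn_ballAut`). -/
noncomputable def ballAut (c : E) (V : E ≃ₗᵢ[ℂ] E) (z : E) : E := moebius c (V z)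

end Moebius

section Schwarz

variable {E F : Type*} [NormedAddCommGroup E] [NormedAddCommGroup F]

theorem eq_smul_deriv_of_norm_eq [NormedSpace ℂ E] [StrictConvexSpace ℝ E] {g : ℂ → E}
    (hg : DifferentiableOn ℂ g (ball 0 1)) (hn : ∀ t ∈ ball (0 : ℂ) 1, ‖g t‖ = ‖t‖) {t : ℂ}
    (ht : t ∈ ball (0 : ℂ) 1) : g t = t • deriv g 0 := by
  have hg0 : g 0 = 0 := by simpa using hn 0 (by simp)
  have hmaps : MapsTo g (ball 0 1) (closedBall (g 0) 1) := fun t ht => by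
    rw [hg0, mem_closedBall_zero_iff, hn t ht]
    exact (mem_ball_zero_iff.1 ht).le
  have hhalf : (2⁻¹ : ℂ) ∈ ball (0 : ℂ) 1 := by
    rw [mem_ball_zero_iff, norm_inv, Complex.norm_ofNat]; norm_num
  have hslope : ‖dslope g 0 2⁻¹‖ = 1 / 1 := by
    rw [dslope_of_ne _ (by norm_num), slope_def_module, hg0, sub_zero, sub_zero, norm_smul,
      hn _ hhalf]
    simp
  have hlin : EqOn g (fun t => t • dslope g 0 2⁻¹) (ball 0 1) := fun t ht => by
    simpa [hg0] using Complex.affine_of_mapsTo_ball_of_norm_dslope_eq_div hg hmaps hhalf hslope ht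
  have hderiv : deriv g 0 = dslope g 0 2⁻¹ := by
    rw [(hlin.eventuallyEq_of_mem (ball_mem_nhds 0 one_pos)).deriv_eq]
    simpa using ((hasDerivAt_id (0 : ℂ)).smul_const (dslope g 0 2⁻¹)).deriv
  rw [hlin ht, hderiv]

theorem eq_fderiv_of_norm_eq [NormedSpace ℂ E] [NormedSpace ℂ F] [StrictConvexSpace ℝ F]
    {G : E → F} (hG : DifferentiableOn ℂ G (ball 0 1))
    (hn : ∀ z ∈ ball (0 : E) 1, ‖G z‖ = ‖z‖) {z : E} (hz : z ∈ ball (0 : E) 1) :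
    G z = fderiv ℂ G 0 z := by
  rcases eq_or_ne z 0 with rfl | hz0
  · simpa using hn 0 hz
  have hzn : (‖z‖ : ℂ) ≠ 0 := by simpa using hz0
  obtain ⟨ζ, hζ, hzζ⟩ : ∃ ζ : E, ‖ζ‖ = 1 ∧ (‖z‖ : ℂ) • ζ = z :=
    ⟨(‖z‖ : ℂ)⁻¹ • z, by simp [norm_smul, hz0], smul_inv_smul₀ hzn z⟩
  have hmem : ∀ t ∈ ball (0 : ℂ) 1, t • ζ ∈ ball (0 : E) 1 := fun t ht => by
    simpa [norm_smul, hζ] using ht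
  have hline := eq_smul_deriv_of_norm_eq (g := fun t => G (t • ζ)) (hG.comp (by fun_prop) hmem)
    (fun t ht => by rw [hn _ (hmem t ht), norm_smul, hζ, mul_one])
    (t := ‖z‖) (by simpa using mem_ball_zero_iff.1 hz)
  have hd : HasDerivAt (fun t : ℂ => G (t • ζ)) (fderiv ℂ G 0 ζ) 0 := by
    have hG0 : HasFDerivAt G (fderiv ℂ G 0) ((0 : ℂ) • ζ) := by
      rw [zero_smul]
      exact (hG.differentiableAt (ball_mem_nhds 0 one_pos)).hasFDerivAt
    exact hG0.comp_hasDerivAt (0 : ℂ) (by simpa using (hasDerivAt_id (0 : ℂ)).smul_const ζ)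
  rw [hd.deriv, ← map_smul, hzζ] at hline
  exact hline

theorem norm_fderiv_of_norm_eq [NormedSpace ℂ E] [NormedSpace ℂ F] [StrictConvexSpace ℝ F]
    {G : E → F} (hG : DifferentiableOn ℂ G (ball 0 1))
    (hn : ∀ z ∈ ball (0 : E) 1, ‖G z‖ = ‖z‖) (z : E) : ‖fderiv ℂ G 0 z‖ = ‖z‖ := by
  set t : ℝ := (1 + ‖z‖)⁻¹
  have ht : 0 < t := by positivity
  have hz : (t : ℂ) • z ∈ ball (0 : E) 1 := by
    rw [mem_ball_zero_iff, norm_smul, Complex.norm_real, Real.norm_of_nonneg ht.le,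
      inv_mul_lt_one₀ (by positivity)]
    linarith
  have h := hn _ hz
  rw [eq_fderiv_of_norm_eq hG hn hz, map_smul, norm_smul, norm_smul] at h
  exact mul_left_cancel₀ (by simpa using ht.ne') h

theorem norm_eq_of_leftInvOn_ball [NormedSpace ℂ E] [NormedSpace ℂ F] {f : E → F} {g : F → E}
    (hf : DifferentiableOn ℂ f (ball 0 1)) (hg : DifferentiableOn ℂ g (ball 0 1))
    (hfm : MapsTo f (ball 0 1) (ball 0 1)) (hgm : MapsTo g (ball 0 1) (ball 0 1))
    (hgf : LeftInvOn g f (ball 0 1)) (h0 : f 0 = 0) {z : E} (hz : z ∈ ball (0 : E) 1) :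
    ‖f z‖ = ‖z‖ := by
  have hg0 : g 0 = 0 := by simpa [h0] using hgf (mem_ball_self (x := (0 : E)) one_pos)
  refine le_antisymm (Complex.norm_le_norm_of_mapsTo_ball hf
    (hfm.mono_right ball_subset_closedBall) h0 (mem_ball_zero_iff.1 hz)) ?_
  simpa only [hgf hz] using Complex.norm_le_norm_of_mapsTo_ball hg
    (hgm.mono_right ball_subset_closedBall) hg0 (mem_ball_zero_iff.1 (hfm hz))

/-- By the Schwarz lemma the automorphism `moebius (φ 0) ∘ φ`, which fixes the origin, preserves
norms, and hence it agrees with its derivative at the origin. -/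
theorem IsBallAut.exists_eqOn_ballAut {N : ℕ} {φ : CN N → CN N} (hφ : IsBallAut φ) :
    ∃ (c : CN N) (V : CN N ≃ₗᵢ[ℂ] CN N), ‖c‖ < 1 ∧ EqOn φ (ballAut c V) (ball 0 1) := by
  obtain ⟨hd, hm, χ, hχd, hχm, hχφ, -⟩ := hφ
  set c := φ 0
  have hc : ‖c‖ < 1 := mem_ball_zero_iff.1 (hm (mem_ball_self one_pos))
  have hGd : DifferentiableOn ℂ (moebius c ∘ φ) (ball 0 1) :=
    (differentiableOn_moebius hc).comp hd hm
  have hinv : LeftInvOn (χ ∘ moebius c) (moebius c ∘ φ) (ball 0 1) := fun w hw => by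
    simp only [Function.comp_apply, moebius_moebius_of_mem_ball hc (hm hw), hχφ hw]
  have hn : ∀ z ∈ ball (0 : CN N) 1, ‖(moebius c ∘ φ) z‖ = ‖z‖ := fun z hz =>
    norm_eq_of_leftInvOn_ball hGd
      (hχd.comp (differentiableOn_moebius hc) (mapsTo_moebius hc))
      ((mapsTo_moebius hc).comp hm) (hχm.comp (mapsTo_moebius hc)) hinv (moebius_self hc) hz
  let V : CN N →ₗᵢ[ℂ] CN N :=
    ⟨(fderiv ℂ (moebius c ∘ φ) 0 : CN N →ₗ[ℂ] CN N), norm_fderiv_of_norm_eq hGd hn⟩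
  refine ⟨c, V.toLinearIsometryEquiv rfl, hc, fun z hz => ?_⟩
  have hV : V z = moebius c (φ z) := (eq_fderiv_of_norm_eq hGd hn hz).symm
  rw [ballAut, LinearIsometry.coe_toLinearIsometryEquiv, hV,
    moebius_moebius_of_mem_ball hc (hm hz)]

end Schwarz

section BoundaryFixedPoint

variable {E : Type*} [NormedAddCommGroup E] [InnerProductSpace ℂ E]

theorem inner_self_eq_one {e : E} (he : ‖e‖ = 1) : inner ℂ e e = (1 : ℂ) := by
  rw [inner_self_eq_norm_sq_to_K, he]
  simp

theorem one_sub_inner_ne_zero_of_ne {a b : E} (ha : ‖a‖ = 1) (hb : ‖b‖ = 1) (hab : a ≠ b) :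
    (1 - inner ℂ a b : ℂ) ≠ 0 := fun h =>
  hab ((inner_eq_one_iff_of_norm_eq_one ha hb).1 (sub_eq_zero.1 h).symm)

theorem one_sub_inner_isometry_ne_zero {c e : E} (V : E ≃ₗᵢ[ℂ] E) (hc : ‖c‖ < 1) (he : ‖e‖ ≤ 1) :
    (1 - inner ℂ c (V e) : ℂ) ≠ 0 :=
  one_sub_inner_ne_zero (norm_mul_norm_lt_one hc (by rwa [V.norm_map]))

/-- The dilation factor of the automorphism `ballAut c V` at a boundary fixed point `e`: both the
eigenvalue of its derivative in the direction `e` and the square of the factor by which the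
derivative scales the complex tangent space at `e`. -/
noncomputable def dilation (c : E) (V : E ≃ₗᵢ[ℂ] E) (e : E) : ℝ :=
  defect c ^ 2 / ‖(1 - inner ℂ c (V e) : ℂ)‖ ^ 2

theorem dilation_pos {c e : E} (V : E ≃ₗᵢ[ℂ] E) (hc : ‖c‖ < 1) (he : ‖e‖ ≤ 1) :
    0 < dilation c V e := by
  have hs := defect_pos hc
  have hD := norm_pos_iff.2 (one_sub_inner_isometry_ne_zero V hc he)
  unfold dilation
  positivity

theorem one_sub_inner_ballAut {c z w : E} (V : E ≃ₗᵢ[ℂ] E) (hc : ‖c‖ < 1) (hz : ‖z‖ ≤ 1)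
    (hw : ‖w‖ ≤ 1) :
    1 - inner ℂ (ballAut c V w) (ballAut c V z) =
      ((defect c : ℂ) ^ 2 * (1 - inner ℂ w z)) /
        ((1 - inner ℂ c (V z)) * (starRingEnd ℂ) (1 - inner ℂ c (V w))) := by
  rw [ballAut, ballAut, one_sub_inner_moebius hc (one_sub_inner_isometry_ne_zero V hc hz)
    (one_sub_inner_isometry_ne_zero V hc hw), V.inner_map_map]

theorem conj_mul_eq_defect_sq {c a b : E} (V : E ≃ₗᵢ[ℂ] E) (hc : ‖c‖ < 1) (ha : ‖a‖ = 1)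
    (hb : ‖b‖ = 1) (hab : a ≠ b) (hfa : ballAut c V a = a) (hfb : ballAut c V b = b) :
    (1 - inner ℂ c (V b)) * (starRingEnd ℂ) (1 - inner ℂ c (V a)) = (defect c : ℂ) ^ 2 := by
  have h := one_sub_inner_ballAut V hc hb.le ha.le
  rw [hfa, hfb, eq_div_iff (mul_ne_zero (one_sub_inner_isometry_ne_zero V hc hb.le)
    ((map_ne_zero _).2 (one_sub_inner_isometry_ne_zero V hc ha.le))), mul_comm] at h
  exact mul_right_cancel₀ (one_sub_inner_ne_zero_of_ne ha hb hab) h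

theorem dilation_eq_inv {c a b : E} (V : E ≃ₗᵢ[ℂ] E) (hc : ‖c‖ < 1) (ha : ‖a‖ = 1)
    (hb : ‖b‖ = 1) (hab : a ≠ b) (hfa : ballAut c V a = a) (hfb : ballAut c V b = b) :
    dilation c V a = (dilation c V b)⁻¹ := by
  have h := congrArg norm (conj_mul_eq_defect_sq V hc ha hb hab hfa hfb)
  rw [norm_mul, RCLike.norm_conj, norm_pow, Complex.norm_real,
    Real.norm_of_nonneg (defect_pos hc).le] at h
  have hxa := norm_pos_iff.2 (one_sub_inner_isometry_ne_zero V hc ha.le)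
  have hxb := norm_pos_iff.2 (one_sub_inner_isometry_ne_zero V hc hb.le)
  rw [dilation, dilation, ← h]
  field_simp

/-- The coordinate `(1 - ⟨z, b⟩) / (1 - ⟨z, a⟩)` for distinct points `a`, `b` of the sphere. On the
ball it avoids the closed negative half-line; it blows up at `a` and vanishes at `b`. -/
noncomputable def halfPlane (a b z : E) : ℂ := (1 - inner ℂ b z) / (1 - inner ℂ a z)

theorem halfPlane_ballAut {c a b z : E} (V : E ≃ₗᵢ[ℂ] E) (hc : ‖c‖ < 1) (ha : ‖a‖ = 1)
    (hb : ‖b‖ = 1) (hab : a ≠ b) (hfa : ballAut c V a = a) (hfb : ballAut c V b = b)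
    (hz : ‖z‖ < 1) :
    halfPlane a b (ballAut c V z) = (dilation c V b : ℂ) * halfPlane a b z := by
  have hxz := one_sub_inner_isometry_ne_zero V hc hz.le
  have hxa := (map_ne_zero (starRingEnd ℂ)).2 (one_sub_inner_isometry_ne_zero V hc ha.le)
  have hxb := one_sub_inner_isometry_ne_zero V hc hb.le
  have hxb' := (map_ne_zero (starRingEnd ℂ)).2 hxb
  have hza : (1 - inner ℂ a z : ℂ) ≠ 0 := one_sub_inner_ne_zero (by rw [ha, one_mul]; exact hz)
  have hza' := one_sub_inner_ballAut V hc hz.le ha.le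
  have hzb' := one_sub_inner_ballAut V hc hz.le hb.le
  rw [hfa] at hza'
  rw [hfb] at hzb'
  rw [halfPlane, halfPlane, hza', hzb', dilation]
  push_cast
  rw [← Complex.mul_conj', ← conj_mul_eq_defect_sq V hc ha hb hab hfa hfb]
  field_simp

theorem inner_moebius_moebiusDeriv {c e : E} (hc : ‖c‖ < 1) (he : ‖e‖ = 1) (h : E) :
    inner ℂ (moebius c e) (moebiusDeriv c e h) =
      (defect c : ℂ) ^ 2 / (‖(1 - inner ℂ c e : ℂ)‖ : ℂ) ^ 2 * inner ℂ e h := by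
  have hD := one_sub_inner_ne_zero (norm_mul_norm_lt_one hc he.le)
  have hD' := one_sub_inner_comm_ne_zero hD
  have hs0 : (defect c : ℂ) ≠ 0 := by exact_mod_cast (defect_pos hc).ne'
  have hs := one_add_defect_ne_zero hc
  rw [← Complex.mul_conj', map_sub, map_one, inner_conj_symm]
  simp only [moebiusDeriv, moebius, smul_apply, add_apply,
    ContinuousLinearMap.id_apply, ContinuousLinearMap.smulRight_apply, innerSL_apply_apply,
    inner_smul_left, inner_smul_right, inner_sub_left, inner_sub_right, inner_add_right, map_inv₀,
    map_sub, map_one, map_div₀, map_add, Complex.conj_ofReal, inner_conj_symm, inner_self_eq_one he,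
    inner_self_eq_one_sub_defect_sq hc]
  field_simp
  ring

theorem inner_moebiusDeriv_moebiusDeriv {c e h : E} (hc : ‖c‖ < 1) (he : ‖e‖ = 1)
    (heh : inner ℂ e h = (0 : ℂ)) :
    inner ℂ (moebiusDeriv c e h) (moebiusDeriv c e h) =
      (defect c : ℂ) ^ 2 / (‖(1 - inner ℂ c e : ℂ)‖ : ℂ) ^ 2 * inner ℂ h h := by
  have hD := one_sub_inner_ne_zero (norm_mul_norm_lt_one hc he.le)
  have hD' := one_sub_inner_comm_ne_zero hD
  have hs0 : (defect c : ℂ) ≠ 0 := by exact_mod_cast (defect_pos hc).ne'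
  have hs := one_add_defect_ne_zero hc
  have hhe : inner ℂ h e = (0 : ℂ) := by rw [← inner_conj_symm, heh, map_zero]
  rw [← Complex.mul_conj', map_sub, map_one, inner_conj_symm]
  simp only [moebiusDeriv, moebius, smul_apply, add_apply,
    ContinuousLinearMap.id_apply, ContinuousLinearMap.smulRight_apply, innerSL_apply_apply,
    inner_smul_left, inner_smul_right, inner_sub_left, inner_sub_right, inner_add_left,
    inner_add_right, map_inv₀, map_sub, map_one, map_div₀, map_add, map_neg, Complex.conj_ofReal,
    inner_conj_symm, inner_self_eq_one he, inner_self_eq_one_sub_defect_sq hc, heh, hhe]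
  field_simp
  ring

/-- The shape of the derivative of a ball automorphism at a fixed point `e` of the sphere: the
normal component of a vector is multiplied by `t`, and complex tangent vectors are scaled by `√t`
(the parabolic scaling of the Siegel upper half-space). -/
structure IsBoundaryDilation (A : E →L[ℂ] E) (e : E) (t : ℝ) : Prop where
  inner_apply : ∀ h, inner ℂ e (A h) = (t : ℂ) * inner ℂ e h
  norm_sq_apply : ∀ h, inner ℂ e h = (0 : ℂ) → ‖A h‖ ^ 2 = t * ‖h‖ ^ 2

theorem hasFDerivAt_ballAut {c e : E} (V : E ≃ₗᵢ[ℂ] E) (hc : ‖c‖ < 1)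
    (he : (1 - inner ℂ c (V e) : ℂ) ≠ 0) :
    HasFDerivAt (ballAut c V) ((moebiusDeriv c (V e)).comp (V : E →L[ℂ] E)) e :=
  (hasFDerivAt_moebius hc he).comp e (V : E ≃L[ℂ] E).hasFDerivAt

theorem isBoundaryDilation_fderiv_ballAut {c e : E} (V : E ≃ₗᵢ[ℂ] E) (hc : ‖c‖ < 1)
    (he : ‖e‖ = 1) (hfe : ballAut c V e = e) :
    IsBoundaryDilation (fderiv ℂ (ballAut c V) e) e (dilation c V e) := by
  have hVe : ‖V e‖ = 1 := by rw [V.norm_map, he]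
  rw [(hasFDerivAt_ballAut V hc (one_sub_inner_isometry_ne_zero V hc he.le)).fderiv]
  constructor
  · intro h
    have hn := inner_moebius_moebiusDeriv hc hVe (V h)
    rw [← ballAut, hfe, V.inner_map_map] at hn
    simpa [dilation] using hn
  · intro h heh
    have heh' : inner ℂ (V e) (V h) = (0 : ℂ) := by rw [V.inner_map_map, heh]
    have ht := inner_moebiusDeriv_moebiusDeriv hc hVe heh'
    rw [inner_self_eq_norm_sq_to_K, inner_self_eq_norm_sq_to_K, V.norm_map] at ht
    apply Complex.ofReal_injective
    simpa [dilation] using ht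

end BoundaryFixedPoint

namespace IsBoundaryDilation

variable {E : Type*} [NormedAddCommGroup E] [InnerProductSpace ℂ E] {e : E} {t : ℝ}

theorem injective {A : E →L[ℂ] E} (hA : IsBoundaryDilation A e t) (ht : t ≠ 0) :
    Function.Injective A := by
  rw [injective_iff_map_eq_zero]
  intro v hv
  have hev : (inner ℂ e v : ℂ) = 0 := by simpa [hv, ht] using (hA.inner_apply v).symm
  simpa [hv, ht] using (hA.norm_sq_apply v hev).symm

theorem symm {A : E ≃L[ℂ] E} (hA : IsBoundaryDilation (A : E →L[ℂ] E) e t) (ht : t ≠ 0) :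
    IsBoundaryDilation (A.symm : E →L[ℂ] E) e t⁻¹ := by
  have htc : (t : ℂ) ≠ 0 := by exact_mod_cast ht
  have hinner : ∀ h, inner ℂ e (A.symm h) = ((t⁻¹ : ℝ) : ℂ) * inner ℂ e h := fun h => by
    have := hA.inner_apply (A.symm h)
    rw [ContinuousLinearEquiv.coe_coe, A.apply_symm_apply] at this
    rw [this, Complex.ofReal_inv, inv_mul_cancel_left₀ htc]
  refine ⟨hinner, fun h heh => ?_⟩
  have := hA.norm_sq_apply (A.symm h) (by rw [hinner, heh, mul_zero])
  rw [ContinuousLinearEquiv.coe_coe, A.apply_symm_apply] at this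
  rw [this, inv_mul_cancel_left₀ ht, ContinuousLinearEquiv.coe_coe]

theorem mem_spectrum {A : E →L[ℂ] E} (hA : IsBoundaryDilation A e t) (he : ‖e‖ = 1) :
    (t : ℂ) ∈ spectrum ℂ A := by
  rw [spectrum.mem_iff]
  rintro ⟨u, hu⟩
  have hh : (algebraMap ℂ (E →L[ℂ] E) t - A) (u⁻¹.val e) = e := by
    rw [← hu, ← mul_apply_eq_comp, u.mul_inv, one_apply_eq_self]
  simpa [Algebra.algebraMap_eq_smul_one, hA.inner_apply, he] using
    congrArg (fun v => (inner ℂ e v : ℂ)) hh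

theorem norm_le_of_apply_eq_smul {A : E →L[ℂ] E} (hA : IsBoundaryDilation A e t) (ht : 1 ≤ t)
    {k : ℂ} {v : E} (hv : v ≠ 0) (hAv : A v = k • v) : ‖k‖ ≤ t := by
  by_cases hev : (inner ℂ e v : ℂ) = 0
  · have hk := hA.norm_sq_apply v hev
    rw [hAv, norm_smul, mul_pow] at hk
    have hkt : ‖k‖ ^ 2 = t := mul_right_cancel₀ (by simpa using hv) hk
    nlinarith [norm_nonneg k]
  · have hk := hA.inner_apply v
    rw [hAv, inner_smul_right] at hk
    rw [mul_right_cancel₀ hev hk, Complex.norm_real, Real.norm_of_nonneg (by linarith)]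

end IsBoundaryDilation

section SpectralRadius

theorem exists_apply_eq_smul_of_mem_spectrum {E : Type*} [NormedAddCommGroup E] [NormedSpace ℂ E]
    [FiniteDimensional ℂ E] {A : E →L[ℂ] E} {k : ℂ} (hk : k ∈ spectrum ℂ A) :
    ∃ v ≠ 0, A v = k • v := by
  have : CompleteSpace E := FiniteDimensional.complete ℂ E
  have hker : ¬ Function.Injective (algebraMap ℂ (E →L[ℂ] E) k - A) := fun hi =>
    spectrum.mem_iff.1 hk (ContinuousLinearMap.isUnit_iff_bijective.2 ⟨hi,
      (LinearMap.injective_iff_surjective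
        (f := (algebraMap ℂ (E →L[ℂ] E) k - A : E →ₗ[ℂ] E))).1 hi⟩)
  rw [injective_iff_map_eq_zero] at hker
  push Not at hker
  obtain ⟨v, hv, hv0⟩ := hker
  exact ⟨v, hv0, (sub_eq_zero.1 (by simpa [Algebra.algebraMap_eq_smul_one] using hv)).symm⟩

variable {N : ℕ} {e : CN N} {t : ℝ}

theorem IsBoundaryDilation.specRad_eq {A : CN N →L[ℂ] CN N} (hA : IsBoundaryDilation A e t)
    (he : ‖e‖ = 1) (ht : 1 ≤ t) : specRad A = t := by
  have ht0 : 0 ≤ t := by linarith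
  have hrad : spectralRadius ℂ A = ENNReal.ofReal t := by
    refine le_antisymm (iSup₂_le fun k hk => ?_) ?_
    · obtain ⟨v, hv, hAv⟩ := exists_apply_eq_smul_of_mem_spectrum hk
      rw [← enorm_eq_nnnorm, ← ofReal_norm]
      exact ENNReal.ofReal_le_ofReal (hA.norm_le_of_apply_eq_smul ht hv hAv)
    · calc ENNReal.ofReal t = ‖(t : ℂ)‖₊ := by
            rw [← enorm_eq_nnnorm, ← ofReal_norm, Complex.norm_real, Real.norm_of_nonneg ht0]
        _ ≤ spectralRadius ℂ A :=
            le_iSup₂ (f := fun (k : ℂ) (_ : k ∈ spectrum ℂ A) => (‖k‖₊ : ℝ≥0∞)) _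
              (hA.mem_spectrum he)
  rw [specRad, hrad, ENNReal.toReal_ofReal ht0]

theorem IsBoundaryDilation.isInvertible {A : CN N →L[ℂ] CN N} (hA : IsBoundaryDilation A e t)
    (ht : t ≠ 0) : A.IsInvertible :=
  ⟨(LinearEquiv.ofInjectiveEndo (A : CN N →ₗ[ℂ] CN N)
    (hA.injective ht)).toContinuousLinearEquiv, rfl⟩

theorem IsBoundaryDilation.specRad_inverse_eq {A : CN N →L[ℂ] CN N}
    (hA : IsBoundaryDilation A e t) (he : ‖e‖ = 1) (ht0 : 0 < t) (ht : t ≤ 1) :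
    specRad A.inverse = t⁻¹ := by
  obtain ⟨M, rfl⟩ := hA.isInvertible ht0.ne'
  rw [ContinuousLinearMap.inverse_equiv]
  exact (hA.symm ht0.ne').specRad_eq he (one_le_inv_iff₀.2 ⟨ht0, ht⟩)

end SpectralRadius

section Jacobian

variable {N : ℕ}

theorem det_moebiusDeriv {c z : CN N} (hc : ‖c‖ < 1) (hz : (1 - inner ℂ c z : ℂ) ≠ 0) :
    (moebiusDeriv c z : CN N →ₗ[ℂ] CN N).det =
      (-(defect c : ℂ) / (1 - inner ℂ c z)) ^ N * ((defect c : ℂ) / (1 - inner ℂ c z)) := by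
  have hs0 : (defect c : ℂ) ≠ 0 := by exact_mod_cast (defect_pos hc).ne'
  have hs := one_add_defect_ne_zero hc
  have htransvection : (moebiusDeriv c z : CN N →ₗ[ℂ] CN N) =
      (-(defect c : ℂ) / (1 - inner ℂ c z)) • LinearMap.transvection
        (innerSL ℂ c : CN N →ₗ[ℂ] ℂ)
        ((defect c : ℂ)⁻¹ • ((1 + defect c : ℂ)⁻¹ • c - moebius c z)) := by
    ext1 h
    simp [moebiusDeriv, LinearMap.transvection.apply]
  have hinner : inner ℂ c (moebius c z) = 1 - (defect c : ℂ) ^ 2 / (1 - inner ℂ c z) := by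
    rw [← one_sub_inner_moebius_right hc hz]; ring
  rw [htransvection, LinearMap.det_smul, LinearMap.transvection.det, finrank_euclideanSpace_fin]
  congr 1
  simp only [ContinuousLinearMap.coe_coe, innerSL_apply_apply, inner_smul_right, inner_sub_right,
    hinner, inner_self_eq_one_sub_defect_sq hc]
  field_simp
  ring

theorem abs_det_moebiusDeriv {c z : CN N} (hc : ‖c‖ < 1) (hz : (1 - inner ℂ c z : ℂ) ≠ 0) :
    |((moebiusDeriv c z).restrictScalars ℝ).det| =
      (defect c ^ 2 / ‖(1 - inner ℂ c z : ℂ)‖ ^ 2) ^ (N + 1) := by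
  have hdet : ((moebiusDeriv c z).restrictScalars ℝ).det =
      ((moebiusDeriv c z : CN N →ₗ[ℂ] CN N).restrictScalars ℝ).det := rfl
  rw [hdet, LinearMap.det_restrictScalars, Algebra.norm_complex_apply, det_moebiusDeriv hc hz]
  simp only [Complex.normSq_eq_norm_sq, norm_mul, norm_pow, norm_div,
    norm_neg, Complex.norm_real, Real.norm_of_nonneg (defect_pos hc).le]
  rw [abs_of_nonneg (by positivity), ← pow_succ, ← pow_mul, mul_comm, pow_mul, div_pow]

theorem setLIntegral_moebius {c : CN N} (hc : ‖c‖ < 1) (g : CN N → ℝ≥0∞) :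
    ∫⁻ z in ball (0 : CN N) 1, g z = ∫⁻ z in ball (0 : CN N) 1,
      ENNReal.ofReal ((defect c ^ 2 / ‖(1 - inner ℂ c z : ℂ)‖ ^ 2) ^ (N + 1)) *
        g (moebius c z) := by
  have hD : ∀ z ∈ ball (0 : CN N) 1, (1 - inner ℂ c z : ℂ) ≠ 0 := fun z hz =>
    one_sub_inner_ne_zero (norm_mul_norm_lt_one hc (mem_ball_zero_iff.1 hz).le)
  have h := lintegral_image_eq_lintegral_abs_det_fderiv_mul (volume : Measure (CN N))
    (s := ball 0 1) measurableSet_ball (f := moebius c)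
    (f' := fun z => (moebiusDeriv c z).restrictScalars ℝ)
    (fun z hz => ((hasFDerivAt_moebius hc (hD z hz)).restrictScalars ℝ).hasFDerivWithinAt)
    (LeftInvOn.injOn fun z hz => moebius_moebius_of_mem_ball hc hz) g
  rw [moebius_image_ball hc] at h
  rw [h]
  refine setLIntegral_congr_fun measurableSet_ball fun z hz => ?_
  rw [abs_det_moebiusDeriv hc (hD z hz)]

theorem setLIntegral_isometry (V : CN N ≃ₗᵢ[ℂ] CN N) (g : CN N → ℝ≥0∞) :
    ∫⁻ z in ball (0 : CN N) 1, g (V z) = ∫⁻ z in ball (0 : CN N) 1, g z := by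
  let V' : CN N ≃ₗᵢ[ℝ] CN N := ⟨V.toLinearEquiv.restrictScalars ℝ, V.norm_map⟩
  have h := V'.measurePreserving.setLIntegral_comp_preimage_emb
    V'.toHomeomorph.toMeasurableEquiv.measurableEmbedding g (ball 0 1)
  have hball : V' ⁻¹' ball (0 : CN N) 1 = ball 0 1 := by
    ext z
    simp
  rwa [hball] at h

end Jacobian

section Polar

theorem lintegral_polar {E : Type*} [NormedAddCommGroup E] [NormedSpace ℝ E]
    [FiniteDimensional ℝ E] [MeasurableSpace E] [BorelSpace E] (μ : Measure E)
    [μ.IsAddHaarMeasure] [Nontrivial E] {F : E → ℝ≥0∞} (hF : Measurable F) :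
    ∫⁻ z, F z ∂μ = ∫⁻ r : Ioi (0 : ℝ), ∫⁻ ζ : sphere (0 : E) 1, F ((r : ℝ) • (ζ : E)) ∂μ.toSphere
      ∂(Measure.volumeIoiPow (Module.finrank ℝ E - 1)) := by
  have hFpolar : Measurable fun p : sphere (0 : E) 1 × Ioi (0 : ℝ) => F ((p.2 : ℝ) • (p.1 : E)) :=
    hF.comp (by fun_prop)
  calc ∫⁻ z, F z ∂μ = ∫⁻ z : ({0}ᶜ : Set E), F z ∂(μ.comap Subtype.val) := by
        rw [lintegral_subtype_comap (measurableSet_singleton _).compl, restrict_compl_singleton]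
    _ = ∫⁻ z : ({0}ᶜ : Set E), F (((homeomorphUnitSphereProd E z).2 : ℝ) •
          ((homeomorphUnitSphereProd E z).1 : E)) ∂(μ.comap Subtype.val) := by
        refine lintegral_congr fun z => ?_
        have hz : ‖(z : E)‖ ≠ 0 := norm_ne_zero_iff.2 z.2
        simp [smul_smul, hz]
    _ = _ := by
        rw [μ.measurePreserving_homeomorphUnitSphereProd.lintegral_comp hFpolar,
          lintegral_prod_symm _ hFpolar.aemeasurable]

variable {N : ℕ}

theorem measurable_indicator_ball_norm_sq_mul {f : CN N → ℂ} (hf : ContinuousOn f (ball 0 1))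
    {w : ℝ → ℝ≥0∞} (hw : Measurable w) :
    Measurable ((ball (0 : CN N) 1).indicator fun z => ENNReal.ofReal (‖f z‖ ^ 2) * w ‖z‖) := by
  have hfm : Measurable ((ball (0 : CN N) 1).indicator f) := by
    classical
    rw [← piecewise_eq_indicator]
    exact hf.measurable_piecewise continuousOn_const measurableSet_ball
  have hind : ((ball (0 : CN N) 1).indicator fun z => ENNReal.ofReal (‖f z‖ ^ 2) * w ‖z‖) =
      fun z => ENNReal.ofReal (‖(ball (0 : CN N) 1).indicator f z‖ ^ 2) * w ‖z‖ := by
    ext z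
    by_cases hz : z ∈ ball (0 : CN N) 1 <;> simp [hz, indicator_of_mem, indicator_of_notMem]
  rw [hind]
  exact Measurable.mul (by fun_prop) (hw.comp measurable_norm)

variable [NeZero N]

theorem lintegral_sphere_norm_sq {f : CN N → ℂ} (hf : ContinuousOn f (ball 0 1)) {r : ℝ}
    (hr : r ∈ Ioo (0 : ℝ) 1) :
    ∫⁻ ζ : sphere (0 : CN N) 1, ENNReal.ofReal (‖f (r • (ζ : CN N))‖ ^ 2)
        ∂(volume : Measure (CN N)).toSphere =
      ENNReal.ofReal (hardyMean f r) * (volume : Measure (CN N)).toSphere univ := by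
  rw [hardyMean, ofReal_integral_eq_lintegral_ofReal
    (f := fun ζ : sphere (0 : CN N) 1 => ‖f (r • (ζ : CN N))‖ ^ 2)
    (integrable_of_continuous ((continuous_dilate hf hr).norm.pow 2))
    (Eventually.of_forall fun _ => sq_nonneg _), surfaceMeasure, lintegral_smul_measure,
    smul_eq_mul, mul_right_comm, ENNReal.inv_mul_cancel toSphere_univ_ne_zero
      (measure_ne_top _ _), one_mul]

theorem setLIntegral_ball_eq_hardyMean {f : CN N → ℂ} (hf : ContinuousOn f (ball 0 1))
    {w : ℝ → ℝ≥0∞} (hw : Measurable w) :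
    ∫⁻ z in ball (0 : CN N) 1, ENNReal.ofReal (‖f z‖ ^ 2) * w ‖z‖ =
      ∫⁻ r : Ioi (0 : ℝ) in {r | (r : ℝ) < 1}, ENNReal.ofReal (hardyMean f r) * w r *
        (volume : Measure (CN N)).toSphere univ
        ∂(Measure.volumeIoiPow (Module.finrank ℝ (CN N) - 1)) := by
  rw [← lintegral_indicator measurableSet_ball,
    lintegral_polar volume (measurable_indicator_ball_norm_sq_mul hf hw),
    ← lintegral_indicator (measurableSet_lt measurable_subtype_coe measurable_const)]
  refine lintegral_congr fun r => ?_
  have hr0 : (0 : ℝ) < r := r.2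
  have hnorm : ∀ ζ : sphere (0 : CN N) 1, ‖(r : ℝ) • (ζ : CN N)‖ = r := fun ζ => by
    simp [norm_smul, abs_of_pos hr0]
  by_cases hr : (r : ℝ) < 1
  · have hmem : ∀ ζ : sphere (0 : CN N) 1, (r : ℝ) • (ζ : CN N) ∈ ball (0 : CN N) 1 :=
      rsmul_mem_ball ⟨hr0, hr⟩
    have hmeas : Measurable fun ζ : sphere (0 : CN N) 1 =>
        ENNReal.ofReal (‖f ((r : ℝ) • (ζ : CN N))‖ ^ 2) :=
      ((continuous_dilate hf ⟨hr0, hr⟩).norm.pow 2).measurable.ennreal_ofReal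
    rw [indicator_of_mem (by exact hr)]
    simp_rw [indicator_of_mem (hmem _), hnorm]
    rw [lintegral_mul_const _ hmeas, lintegral_sphere_norm_sq hf ⟨hr0, hr⟩, mul_right_comm]
  · have hmem : ∀ ζ : sphere (0 : CN N) 1, (r : ℝ) • (ζ : CN N) ∉ ball (0 : CN N) 1 := fun ζ h =>
      hr (by rwa [mem_ball_zero_iff, hnorm] at h)
    rw [indicator_of_notMem (by exact hr)]
    simp_rw [indicator_of_notMem (hmem _), lintegral_zero]

theorem setLIntegral_ball_radial {w : ℝ → ℝ≥0∞} (hw : Measurable w) :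
    ∫⁻ z in ball (0 : CN N) 1, w ‖z‖ =
      ∫⁻ r : Ioi (0 : ℝ) in {r | (r : ℝ) < 1}, w r * (volume : Measure (CN N)).toSphere univ
        ∂(Measure.volumeIoiPow (Module.finrank ℝ (CN N) - 1)) := by
  simpa [hardyMean] using
    setLIntegral_ball_eq_hardyMean (f := fun _ : CN N => (1 : ℂ)) continuousOn_const hw

theorem setLIntegral_ball_le_of_hardyMean_le {f : CN N → ℂ} (hf : ContinuousOn f (ball 0 1))
    {w : ℝ → ℝ≥0∞} (hw : Measurable w) {M : ℝ} (hM : ∀ r ∈ Ioo (0 : ℝ) 1, hardyMean f r ≤ M) :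
    ∫⁻ z in ball (0 : CN N) 1, ENNReal.ofReal (‖f z‖ ^ 2) * w ‖z‖ ≤
      ENNReal.ofReal M * ∫⁻ z in ball (0 : CN N) 1, w ‖z‖ := by
  rw [setLIntegral_ball_radial hw, setLIntegral_ball_eq_hardyMean hf hw,
    ← lintegral_const_mul _ (by fun_prop)]
  refine setLIntegral_mono' (measurableSet_lt measurable_subtype_coe measurable_const)
    fun r hr => ?_
  rw [mul_assoc]
  gcongr
  exact hM _ ⟨r.2, hr⟩

theorem le_setLIntegral_ball_of_le_hardyMean {f : CN N → ℂ} (hf : ContinuousOn f (ball 0 1))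
    {w : ℝ → ℝ≥0∞} (hw : Measurable w) {m : ℝ}
    (hm : ∀ r ∈ Ioo (0 : ℝ) 1, w r ≠ 0 → m ≤ hardyMean f r) :
    ENNReal.ofReal m * ∫⁻ z in ball (0 : CN N) 1, w ‖z‖ ≤
      ∫⁻ z in ball (0 : CN N) 1, ENNReal.ofReal (‖f z‖ ^ 2) * w ‖z‖ := by
  rw [setLIntegral_ball_radial hw, setLIntegral_ball_eq_hardyMean hf hw,
    ← lintegral_const_mul _ (by fun_prop)]
  refine setLIntegral_mono' (measurableSet_lt measurable_subtype_coe measurable_const)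
    fun r hr => ?_
  rw [mul_assoc]
  by_cases hwr : w r = 0
  · simp [hwr]
  gcongr
  exact hm _ ⟨r.2, hr⟩ hwr

/-- The means increase with the radius and tend to `‖f 0‖ ^ 2` as the radius tends to `0`. -/
theorem norm_sq_zero_le_hardyMean {f : CN N → ℂ} (hf : DifferentiableOn ℂ f (ball 0 1)) {r : ℝ}
    (hr : r ∈ Ioo (0 : ℝ) 1) : ‖f 0‖ ^ 2 ≤ hardyMean f r := by
  refine le_of_forall_sub_le fun ε hε => ?_
  have hcont : ContinuousAt (fun z => ‖f z‖ ^ 2) 0 :=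
    (hf.continuousOn.continuousAt (ball_mem_nhds 0 one_pos)).norm.pow 2
  obtain ⟨δ, hδ, hball⟩ := Metric.continuousAt_iff.1 hcont ε hε
  set q := min r (δ / 2)
  have hq0 : 0 < q := lt_min hr.1 (by positivity)
  have hq : q ∈ Ioo (0 : ℝ) 1 := ⟨hq0, (min_le_left _ _).trans_lt hr.2⟩
  have hlower : ∀ ζ : sphere (0 : CN N) 1, ‖f 0‖ ^ 2 - ε ≤ ‖f (q • (ζ : CN N))‖ ^ 2 := fun ζ => by
    have hdist : dist (q • (ζ : CN N)) 0 < δ := by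
      rw [dist_zero_right, norm_smul, Real.norm_of_nonneg hq0.le, norm_eq_of_mem_sphere, mul_one]
      linarith [min_le_right r (δ / 2)]
    have hclose := hball hdist
    rw [Real.dist_eq] at hclose
    linarith [(abs_lt.1 hclose).1]
  calc ‖f 0‖ ^ 2 - ε = ∫ _ : sphere (0 : CN N) 1, (‖f 0‖ ^ 2 - ε) ∂(surfaceMeasure N) := by simp
    _ ≤ hardyMean f q := integral_mono (integrable_const _)
        (integrable_of_continuous ((continuous_dilate hf.continuousOn hq).norm.pow 2)) hlower
    _ ≤ hardyMean f r := hardyMean_mono hf hq hr (min_le_left _ _)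

end Polar

section Weierstrass

theorem exists_tendstoUniformlyOn_of_uniformCauchySeqOn {α β ι κ : Type*} [UniformSpace β]
    [CompleteSpace β] [Nonempty β] [Nonempty κ] [SemilatticeSup κ] {F : κ → α → β}
    {s : ι → Set α} (h : ∀ i, UniformCauchySeqOn F atTop (s i)) :
    ∃ g, ∀ i, TendstoUniformlyOn F g atTop (s i) := by
  have hlim : ∀ x, ∃ y, ∀ i, x ∈ s i → Tendsto (fun n => F n x) atTop (𝓝 y) := fun x => by
    by_cases hx : ∃ i, x ∈ s i
    · obtain ⟨i, hi⟩ := hx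
      obtain ⟨y, hy⟩ := cauchySeq_tendsto_of_complete ((h i).cauchySeq hi)
      exact ⟨y, fun _ _ => hy⟩
    · exact ⟨Classical.arbitrary β, fun i hi => absurd ⟨i, hi⟩ hx⟩
  choose g hg using hlim
  exact ⟨g, fun i => (h i).tendstoUniformlyOn_of_tendsto fun x hx => hg x i hx⟩

variable {E F : Type*} [NormedAddCommGroup E] [NormedSpace ℂ E] [NormedAddCommGroup F]
  [NormedSpace ℂ F]

theorem norm_fderiv_le_of_forall_mem_ball {f : E → F} {z : E} {δ M : ℝ} (hδ : 0 < δ)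
    (hf : DifferentiableOn ℂ f (ball z δ)) (hM : ∀ x ∈ ball z δ, ‖f x‖ ≤ M) :
    ‖fderiv ℂ f z‖ ≤ 2 * M / δ := by
  refine Complex.norm_fderiv_le_div_of_mapsTo_ball hf (fun x hx => ?_) hδ
  rw [mem_closedBall, dist_eq_norm]
  linarith [norm_sub_le (f x) (f z), hM x hx, hM z (mem_ball_self hδ)]

theorem uniformCauchySeqOn_fderiv {f : ℕ → E → F} {s t : Set E} {δ : ℝ} (hδ : 0 < δ)
    (hst : ∀ z ∈ s, ball z δ ⊆ t) (hf : ∀ n, DifferentiableOn ℂ (f n) t)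
    (hc : UniformCauchySeqOn f atTop t) :
    UniformCauchySeqOn (fun n => fderiv ℂ (f n)) atTop s := by
  rw [Metric.uniformCauchySeqOn_iff] at hc ⊢
  intro ε hε
  obtain ⟨n₀, hn₀⟩ := hc (ε * δ / 4) (by positivity)
  refine ⟨n₀, fun m hm n hn z hz => ?_⟩
  have hd : ∀ k, DifferentiableAt ℂ (f k) z := fun k =>
    ((hf k).mono (hst z hz)).differentiableAt (ball_mem_nhds z hδ)
  rw [dist_eq_norm, ← fderiv_sub (hd m) (hd n)]
  calc ‖fderiv ℂ (f m - f n) z‖ ≤ 2 * (ε * δ / 4) / δ :=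
        norm_fderiv_le_of_forall_mem_ball hδ (((hf m).sub (hf n)).mono (hst z hz)) fun x hx => by
          simpa only [Pi.sub_apply, ← dist_eq_norm] using (hn₀ m hm n hn x (hst z hz hx)).le
    _ = ε / 2 := by field_simp; ring
    _ < ε := half_lt_self hε

variable [CompleteSpace F]

theorem differentiableAt_of_tendstoUniformlyOn_ball {f : ℕ → E → F} {g : E → F} {z : E} {R : ℝ}
    (hR : 0 < R) (hf : ∀ n, DifferentiableOn ℂ (f n) (ball z R))
    (hg : TendstoUniformlyOn f g atTop (ball z R)) : DifferentiableAt ℂ g z := by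
  have hhalf : ∀ x ∈ ball z (R / 2), ball x (R / 2) ⊆ ball z R := fun x hx =>
    ball_subset_ball' (by linarith [mem_ball.1 hx])
  have hz : ball z (R / 2) ⊆ ball z R := ball_subset_ball (by linarith)
  obtain ⟨g', hg'⟩ := exists_tendstoUniformlyOn_of_uniformCauchySeqOn (fun _ : Unit =>
    uniformCauchySeqOn_fderiv (half_pos hR) hhalf hf hg.uniformCauchySeqOn)
  exact (hasFDerivAt_of_tendstoLocallyUniformlyOn isOpen_ball (hg' ()).tendstoLocallyUniformlyOn
    (fun n x hx => ((hf n).differentiableAt (isOpen_ball.mem_nhds (hz hx))).hasFDerivAt)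
    (fun x hx => hg.tendsto_at (hz hx)) (mem_ball_self (half_pos hR))).differentiableAt

theorem differentiableOn_ball_of_tendstoUniformlyOn {f : ℕ → E → F} {g : E → F}
    (hf : ∀ n, DifferentiableOn ℂ (f n) (ball 0 1))
    (hg : ∀ r < 1, TendstoUniformlyOn f g atTop (ball 0 r)) :
    DifferentiableOn ℂ g (ball 0 1) := by
  intro z hz
  rw [mem_ball_zero_iff] at hz
  have hsub : ball z ((1 - ‖z‖) / 2) ⊆ ball 0 ((1 + ‖z‖) / 2) :=
    ball_subset_ball' (by rw [dist_zero_right]; linarith)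
  exact (differentiableAt_of_tendstoUniformlyOn_ball (by linarith)
    (fun n => (hf n).mono (hsub.trans (ball_subset_ball (by linarith))))
    ((hg _ (by linarith)).mono hsub)).differentiableWithinAt

end Weierstrass

/-- The multiplier `(s / (1 - ⟨z, c⟩))^p`, `s = √(1 - |c|²)`, that makes composition with a Möbius
involution isometric. -/
noncomputable def moebiusWeight {N : ℕ} (p : ℝ) (c z : CN N) : ℂ :=
  ((defect c : ℂ) / (1 - inner ℂ c z)) ^ (p : ℂ)

section Weight

variable {N : ℕ} {p : ℝ} {c z : CN N}

theorem re_defect_div_pos (hc : ‖c‖ < 1) (hz : ‖c‖ * ‖z‖ < 1) :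
    0 < ((defect c : ℂ) / (1 - inner ℂ c z)).re := by
  have hre := re_one_sub_inner_pos hz
  have hnormSq : 0 < Complex.normSq (1 - inner ℂ c z) :=
    Complex.normSq_pos.2 (one_sub_inner_ne_zero hz)
  have hs := defect_pos hc
  rw [Complex.div_re]
  simp only [Complex.ofReal_re, Complex.ofReal_im, zero_mul, zero_div, add_zero]
  positivity

theorem norm_moebiusWeight (hc : ‖c‖ < 1) :
    ‖moebiusWeight p c z‖ = (defect c / ‖(1 - inner ℂ c z : ℂ)‖) ^ p := by
  rw [moebiusWeight, Complex.norm_cpow_real, norm_div, Complex.norm_real,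
    Real.norm_of_nonneg (defect_pos hc).le]

theorem moebiusWeight_ne_zero (hc : ‖c‖ < 1) (hz : ‖c‖ * ‖z‖ < 1) : moebiusWeight p c z ≠ 0 := by
  rw [← norm_pos_iff, norm_moebiusWeight hc]
  have := defect_pos hc
  have := norm_pos_iff.2 (one_sub_inner_ne_zero hz)
  positivity

theorem differentiableAt_moebiusWeight (hc : ‖c‖ < 1) (hz : ‖c‖ * ‖z‖ < 1) :
    DifferentiableAt ℂ (moebiusWeight p c) z := by
  have hinner : DifferentiableAt ℂ (fun w : CN N => (inner ℂ c w : ℂ)) z :=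
    (innerSL ℂ c).differentiableAt
  have hbase : DifferentiableAt ℂ (fun w : CN N => (defect c : ℂ) / (1 - inner ℂ c w)) z := by
    simpa only [div_eq_mul_inv] using
      ((hinner.const_sub (1 : ℂ)).fun_inv (one_sub_inner_ne_zero hz)).const_mul (defect c : ℂ)
  exact hbase.cpow_const (Or.inl (re_defect_div_pos hc hz))

end Weight

/-- The properties of the Hardy and Bergman spaces of the unit ball that determine the spectra of
weighted composition operators: through the evaluation map `ev`, the elements of `H` are holomorphic
functions on the ball, with bounded evaluation at `0`, closed under locally uniform limits of
bounded sequences, with bounded holomorphic functions as multipliers and with contractive unitary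
and weighted Möbius compositions, for the weight of exponent `p`. -/
structure IsBallSpace (N : ℕ) (p : ℝ) {H : Type*} [NormedAddCommGroup H] [InnerProductSpace ℂ H]
    (ev : H →ₗ[ℂ] (CN N → ℂ)) : Prop where
  differentiableOn : ∀ f, DifferentiableOn ℂ (ev f) (ball 0 1)
  eq_zero : ∀ f, (∀ z ∈ ball (0 : CN N) 1, ev f z = 0) → f = 0
  norm_apply_zero_le : ∀ f, ‖ev f 0‖ ≤ ‖f‖
  exists_limit : ∀ (f : ℕ → H) (g : CN N → ℂ) (M : ℝ), DifferentiableOn ℂ g (ball 0 1) →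
    (∀ r < 1, TendstoUniformlyOn (fun n => ev (f n)) g atTop (ball 0 r)) →
    (∀ᶠ n in atTop, ‖f n‖ ≤ M) →
    ∃ h, (∀ z ∈ ball (0 : CN N) 1, ev h z = g z) ∧ ‖h‖ ≤ M
  exists_mul : ∀ (W : CN N → ℂ) (M : ℝ), DifferentiableOn ℂ W (ball 0 1) →
    (∀ z ∈ ball (0 : CN N) 1, ‖W z‖ ≤ M) → ∀ f,
    ∃ g, (∀ z ∈ ball (0 : CN N) 1, ev g z = W z * ev f z) ∧ ‖g‖ ≤ M * ‖f‖
  exists_moebius : ∀ c : CN N, ‖c‖ < 1 → ∀ f, ∃ g,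
    (∀ z ∈ ball (0 : CN N) 1, ev g z = moebiusWeight p c z * ev f (moebius c z)) ∧ ‖g‖ ≤ ‖f‖
  exists_isometry : ∀ (V : CN N ≃ₗᵢ[ℂ] CN N) (f), ∃ g,
    (∀ z ∈ ball (0 : CN N) 1, ev g z = ev f (V z)) ∧ ‖g‖ ≤ ‖f‖
  exists_one : ∃ f, ∀ z ∈ ball (0 : CN N) 1, ev f z = 1

namespace IsBallSpace

variable {N : ℕ} {p : ℝ} {H : Type*} [NormedAddCommGroup H] [InnerProductSpace ℂ H]
  {ev : H →ₗ[ℂ] (CN N → ℂ)}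

theorem ext (hH : IsBallSpace N p ev) {f g : H} (h : ∀ z ∈ ball (0 : CN N) 1, ev f z = ev g z) :
    f = g := by
  rw [← sub_eq_zero]
  refine hH.eq_zero _ fun z hz => ?_
  rw [map_sub, Pi.sub_apply, h z hz, sub_self]

theorem norm_apply_le (hH : IsBallSpace N p ev) {c : CN N} (hc : ‖c‖ < 1) (f : H) :
    ‖ev f c‖ ≤ (defect c ^ p)⁻¹ * ‖f‖ := by
  obtain ⟨g, hg, hgf⟩ := hH.exists_moebius c hc f
  have hg0 := hH.norm_apply_zero_le g
  rw [hg 0 (by simp), moebius_zero, norm_mul, norm_moebiusWeight hc, inner_zero_right, sub_zero,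
    norm_one, div_one] at hg0
  rw [← div_eq_inv_mul, le_div_iff₀ (Real.rpow_pos_of_pos (defect_pos hc) _)]
  linarith

theorem norm_apply_le_of_le (hH : IsBallSpace N p ev) (hp : 0 ≤ p) {r : ℝ} (hr : r < 1) {c : CN N}
    (hc : ‖c‖ ≤ r) (f : H) : ‖ev f c‖ ≤ (Real.sqrt (1 - r ^ 2) ^ p)⁻¹ * ‖f‖ := by
  have hr0 : 0 ≤ r := (norm_nonneg c).trans hc
  refine (hH.norm_apply_le (hc.trans_lt hr) f).trans ?_
  have hpos : 0 < Real.sqrt (1 - r ^ 2) := Real.sqrt_pos.2 (by nlinarith)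
  have hle : Real.sqrt (1 - r ^ 2) ≤ defect c := Real.sqrt_le_sqrt (by gcongr)
  gcongr

theorem uniformCauchySeqOn_ball (hH : IsBallSpace N p ev) (hp : 0 ≤ p) {f : ℕ → H}
    (hf : CauchySeq f) {r : ℝ} (hr : r < 1) :
    UniformCauchySeqOn (fun n => ev (f n)) atTop (ball 0 r) := by
  rw [Metric.uniformCauchySeqOn_iff]
  intro ε hε
  rcases le_or_gt r 0 with hr0 | hr0
  · exact ⟨0, fun _ _ _ _ x hx => by simp [ball_eq_empty.2 hr0] at hx⟩
  have hpos : 0 < Real.sqrt (1 - r ^ 2) ^ p :=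
    Real.rpow_pos_of_pos (Real.sqrt_pos.2 (by nlinarith)) _
  obtain ⟨n₀, hn₀⟩ := Metric.cauchySeq_iff.1 hf (ε * Real.sqrt (1 - r ^ 2) ^ p) (by positivity)
  refine ⟨n₀, fun m hm n hn x hx => ?_⟩
  have hmn := hn₀ m hm n hn
  rw [dist_eq_norm] at hmn ⊢
  calc ‖ev (f m) x - ev (f n) x‖ = ‖ev (f m - f n) x‖ := by rw [map_sub, Pi.sub_apply]
    _ ≤ (Real.sqrt (1 - r ^ 2) ^ p)⁻¹ * ‖f m - f n‖ :=
        hH.norm_apply_le_of_le hp hr (mem_ball_zero_iff.1 hx).le _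
    _ < (Real.sqrt (1 - r ^ 2) ^ p)⁻¹ * (ε * Real.sqrt (1 - r ^ 2) ^ p) := by gcongr
    _ = ε := by field_simp

theorem norm_sub_le_of_tendstoUniformlyOn (hH : IsBallSpace N p ev) {f : ℕ → H} {h : H}
    (hfh : ∀ r < 1, TendstoUniformlyOn (fun n => ev (f n)) (ev h) atTop (ball 0 r)) {n : ℕ} {M : ℝ}
    (hM : ∀ᶠ m in atTop, ‖f n - f m‖ ≤ M) : ‖f n - h‖ ≤ M := by
  have hlim : ∀ r < 1, TendstoUniformlyOn (fun m => ev (f n - f m)) (ev (f n - h)) atTop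
      (ball 0 r) := fun r hr => by
    rw [Metric.tendstoUniformlyOn_iff]
    intro η hη
    filter_upwards [Metric.tendstoUniformlyOn_iff.1 (hfh r hr) η hη] with m hm z hz
    rw [map_sub, map_sub, Pi.sub_apply, Pi.sub_apply, dist_sub_left]
    exact hm z hz
  obtain ⟨k, hk, hkM⟩ := hH.exists_limit _ _ M (hH.differentiableOn _) hlim hM
  rwa [← hH.ext hk]

theorem completeSpace (hH : IsBallSpace N p ev) (hp : 0 ≤ p) : CompleteSpace H := by
  refine UniformSpace.complete_of_cauchySeq_tendsto fun f hf => ?_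
  obtain ⟨g, hg⟩ := exists_tendstoUniformlyOn_of_uniformCauchySeqOn
    (fun r : Iio (1 : ℝ) => hH.uniformCauchySeqOn_ball hp hf r.2)
  have hfg : ∀ r < 1, TendstoUniformlyOn (fun n => ev (f n)) g atTop (ball 0 r) :=
    fun r hr => hg ⟨r, hr⟩
  obtain ⟨R, hR⟩ := hf.norm_bddAbove
  obtain ⟨h, hh, -⟩ := hH.exists_limit f g R
    (differentiableOn_ball_of_tendstoUniformlyOn (fun n => hH.differentiableOn (f n)) hfg) hfg
    (Eventually.of_forall fun n => hR (mem_range_self n))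
  have hfh : ∀ r < 1, TendstoUniformlyOn (fun n => ev (f n)) (ev h) atTop (ball 0 r) :=
    fun r hr => (hfg r hr).congr_right fun z hz => (hh z (ball_subset_ball hr.le hz)).symm
  refine ⟨h, Metric.tendsto_atTop.2 fun ε hε => ?_⟩
  obtain ⟨n₀, hn₀⟩ := Metric.cauchySeq_iff.1 hf (ε / 2) (by positivity)
  refine ⟨n₀, fun n hn => ?_⟩
  rw [dist_eq_norm]
  refine (hH.norm_sub_le_of_tendstoUniformlyOn hfh ?_).trans_lt (half_lt_self hε)
  filter_upwards [eventually_ge_atTop n₀] with m hm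
  rw [← dist_eq_norm]
  exact (hn₀ n hn m hm).le

end IsBallSpace

section WeightedIntegrals

variable {N : ℕ} {α : ℝ}

theorem lintegral_ballWeight (α : ℝ) (g : CN N → ℝ≥0∞) :
    ∫⁻ z, g z ∂(ballWeight N α) =
      ∫⁻ z in ball (0 : CN N) 1, g z * ENNReal.ofReal ((1 - ‖z‖ ^ 2) ^ α) := by
  rw [ballWeight, lintegral_withDensity_eq_lintegral_mul_non_measurable _ (measurable_weight α)
    (Eventually.of_forall fun _ => ENNReal.ofReal_lt_top)]
  simp only [Pi.mul_apply, mul_comm]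

theorem ballWeight_univ (α : ℝ) :
    ballWeight N α univ = ∫⁻ z in ball (0 : CN N) 1, ENNReal.ofReal ((1 - ‖z‖ ^ 2) ^ α) := by
  simpa using lintegral_ballWeight (N := N) α 1

theorem ballWeight_univ_ne_zero (α : ℝ) : ballWeight N α univ ≠ 0 := by
  rw [ballWeight_univ, ← pos_iff_ne_zero, setLIntegral_pos_iff (measurable_weight α)]
  have hsupport : ball (0 : CN N) 1 ⊆
      Function.support fun z : CN N => ENNReal.ofReal ((1 - ‖z‖ ^ 2) ^ α) := fun z hz => by
    have hw : 0 < 1 - ‖z‖ ^ 2 := by nlinarith [norm_nonneg z, mem_ball_zero_iff.1 hz]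
    rw [Function.mem_support, Ne, ENNReal.ofReal_eq_zero, not_le]
    positivity
  rw [inter_eq_right.2 hsupport]
  exact isOpen_ball.measure_pos volume ⟨0, by simp⟩

theorem ae_mem_ball_bergmanMeasure (α : ℝ) :
    ∀ᵐ z ∂(bergmanMeasure N α), z ∈ ball (0 : CN N) 1 :=
  (bergmanMeasure_absolutelyContinuous α).ae_le (ae_restrict_mem measurableSet_ball)

/-- The exponent `N + 1 + α` is the one for which the square of the weight is the Jacobian of the
Möbius map times the ratio of the densities. -/
theorem lintegral_ballWeight_moebius {c : CN N} (hc : ‖c‖ < 1) (α : ℝ) (g : CN N → ℝ≥0∞) :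
    ∫⁻ z, g z ∂(ballWeight N α) =
      ∫⁻ z, ENNReal.ofReal (‖moebiusWeight (N + 1 + α) c z‖ ^ 2) * g (moebius c z)
        ∂(ballWeight N α) := by
  rw [lintegral_ballWeight, lintegral_ballWeight, setLIntegral_moebius hc]
  refine setLIntegral_congr_fun measurableSet_ball fun z hz => ?_
  have hz1 : ‖z‖ < 1 := mem_ball_zero_iff.1 hz
  have hD := one_sub_inner_ne_zero (norm_mul_norm_lt_one hc hz1.le)
  have hs := defect_pos hc
  have hw : 0 < 1 - ‖z‖ ^ 2 := by nlinarith [norm_nonneg z]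
  set q := defect c / ‖(1 - inner ℂ c z : ℂ)‖ with hq
  have hq0 : 0 < q := by positivity
  have hdensity : 1 - ‖moebius c z‖ ^ 2 = q ^ 2 * (1 - ‖z‖ ^ 2) := by
    rw [one_sub_norm_sq_moebius hc hD, hq, div_pow]; ring
  have hweight : ‖moebiusWeight (N + 1 + α) c z‖ ^ 2 = (q ^ 2) ^ (N + 1) * (q ^ 2) ^ α := by
    rw [norm_moebiusWeight hc, ← hq, ← Real.rpow_mul_natCast hq0.le, mul_comm,
      Real.rpow_mul hq0.le, Real.rpow_natCast, Real.rpow_add (by positivity)]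
    norm_cast
  simp only [hdensity, hweight, ← div_pow, ← hq]
  rw [Real.mul_rpow (by positivity) hw.le, ENNReal.ofReal_mul (by positivity),
    ENNReal.ofReal_mul (by positivity)]
  ring

end WeightedIntegrals

section BergmanEnergy

variable {N : ℕ} {α : ℝ} {f : CN N → ℂ}

/-- The squared norm of `A²_α`, for arbitrary functions and possibly infinite. -/
noncomputable def bergmanEnergy (α : ℝ) (f : CN N → ℂ) : ℝ≥0∞ :=
  ∫⁻ z, ENNReal.ofReal (‖f z‖ ^ 2) ∂(bergmanMeasure N α)

theorem bergmanEnergy_eq (α : ℝ) (f : CN N → ℂ) :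
    bergmanEnergy α f =
      (ballWeight N α univ)⁻¹ * ∫⁻ z, ENNReal.ofReal (‖f z‖ ^ 2) ∂(ballWeight N α) := by
  rw [bergmanEnergy, bergmanMeasure, lintegral_smul_measure, smul_eq_mul]

theorem bergmanEnergy_congr {g : CN N → ℂ} (h : EqOn f g (ball 0 1)) :
    bergmanEnergy α f = bergmanEnergy α g :=
  lintegral_congr_ae <| by
    filter_upwards [ae_mem_ball_bergmanMeasure α] with z hz
    rw [h hz]

theorem bergmanEnergy_le_mul_of_norm_le {g : CN N → ℂ} {M : ℝ}
    (h : ∀ z ∈ ball (0 : CN N) 1, ‖f z‖ ≤ M * ‖g z‖) :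
    bergmanEnergy α f ≤ ENNReal.ofReal (M ^ 2) * bergmanEnergy α g := by
  rw [bergmanEnergy, bergmanEnergy, ← lintegral_const_mul' _ _ ENNReal.ofReal_ne_top]
  refine lintegral_mono_ae ?_
  filter_upwards [ae_mem_ball_bergmanMeasure α] with z hz
  rw [← ENNReal.ofReal_mul (sq_nonneg _), ← mul_pow]
  gcongr
  exact h z hz

theorem bergmanEnergy_mul_le {W : CN N → ℂ} {M : ℝ} (hM : ∀ z ∈ ball (0 : CN N) 1, ‖W z‖ ≤ M)
    (f : CN N → ℂ) :
    bergmanEnergy α (fun z => W z * f z) ≤ ENNReal.ofReal (M ^ 2) * bergmanEnergy α f :=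
  bergmanEnergy_le_mul_of_norm_le fun z hz => by
    rw [norm_mul]
    gcongr
    exact hM z hz

theorem bergmanEnergy_moebius {c : CN N} (hc : ‖c‖ < 1) (α : ℝ) (f : CN N → ℂ) :
    bergmanEnergy α (fun z => moebiusWeight (N + 1 + α) c z * f (moebius c z)) =
      bergmanEnergy α f := by
  rw [bergmanEnergy_eq, bergmanEnergy_eq,
    lintegral_ballWeight_moebius hc α fun z => ENNReal.ofReal (‖f z‖ ^ 2)]
  simp only [norm_mul, mul_pow, ENNReal.ofReal_mul (sq_nonneg _)]

theorem bergmanEnergy_isometry (V : CN N ≃ₗᵢ[ℂ] CN N) (α : ℝ) (f : CN N → ℂ) :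
    bergmanEnergy α (fun z => f (V z)) = bergmanEnergy α f := by
  rw [bergmanEnergy_eq, bergmanEnergy_eq, lintegral_ballWeight, lintegral_ballWeight,
    ← setLIntegral_isometry V fun z =>
      ENNReal.ofReal (‖f z‖ ^ 2) * ENNReal.ofReal ((1 - ‖z‖ ^ 2) ^ α)]
  simp only [V.norm_map]

theorem bergmanEnergy_le_of_tendsto {F : ℕ → CN N → ℂ} {M : ℝ≥0∞}
    (hF : ∀ n, DifferentiableOn ℂ (F n) (ball 0 1))
    (hlim : ∀ z ∈ ball (0 : CN N) 1, Tendsto (fun n => F n z) atTop (𝓝 (f z)))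
    (hM : ∀ᶠ n in atTop, bergmanEnergy α (F n) ≤ M) : bergmanEnergy α f ≤ M := by
  calc bergmanEnergy α f
      = ∫⁻ z, liminf (fun n => ENNReal.ofReal (‖F n z‖ ^ 2)) atTop ∂(bergmanMeasure N α) := by
        refine lintegral_congr_ae ?_
        filter_upwards [ae_mem_ball_bergmanMeasure α] with z hz
        exact (ENNReal.tendsto_ofReal ((hlim z hz).norm.pow 2)).liminf_eq.symm
    _ ≤ liminf (fun n => bergmanEnergy α (F n)) atTop := lintegral_liminf_le' fun n =>
        ((aestronglyMeasurable_bergman (hF n) α).norm.pow 2).aemeasurable.ennreal_ofReal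
    _ ≤ M := liminf_le_of_frequently_le' hM.frequently

theorem tendsto_apply_of_tendstoUniformlyOn_ball {F : ℕ → CN N → ℂ}
    (h : ∀ r < 1, TendstoUniformlyOn F f atTop (ball 0 r)) :
    ∀ z ∈ ball (0 : CN N) 1, Tendsto (fun n => F n z) atTop (𝓝 (f z)) := fun _ hz =>
  let ⟨r, hzr, hr⟩ := exists_between (mem_ball_zero_iff.1 hz)
  (h r hr).tendsto_at (mem_ball_zero_iff.2 hzr)

theorem measurable_radialWeight (α : ℝ) :
    Measurable fun r : ℝ => ENNReal.ofReal ((1 - r ^ 2) ^ α) := by fun_prop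

variable [NeZero N]

theorem isProbabilityMeasure_bergmanMeasure (hα : -1 < α) :
    IsProbabilityMeasure (bergmanMeasure N α) :=
  ⟨ENNReal.inv_mul_cancel (ballWeight_univ_ne_zero α) (ballWeight_univ_ne_top hα)⟩

theorem bergmanEnergy_one (hα : -1 < α) : bergmanEnergy α (fun _ : CN N => (1 : ℂ)) = 1 := by
  have := isProbabilityMeasure_bergmanMeasure (N := N) hα
  simp [bergmanEnergy]

theorem bergmanEnergy_le_of_hardyMean_le (hα : -1 < α) (hf : ContinuousOn f (ball 0 1)) {M : ℝ}
    (hM : ∀ r ∈ Ioo (0 : ℝ) 1, hardyMean f r ≤ M) : bergmanEnergy α f ≤ ENNReal.ofReal M := by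
  rw [bergmanEnergy_eq, ENNReal.inv_mul_le_iff (ballWeight_univ_ne_zero α)
    (ballWeight_univ_ne_top hα), mul_comm, lintegral_ballWeight, ballWeight_univ]
  exact setLIntegral_ball_le_of_hardyMean_le hf (measurable_radialWeight α) hM

theorem norm_sq_zero_le_bergmanEnergy (hα : -1 < α) (hf : DifferentiableOn ℂ f (ball 0 1)) :
    ENNReal.ofReal (‖f 0‖ ^ 2) ≤ bergmanEnergy α f := by
  rw [bergmanEnergy_eq, ← ENNReal.div_eq_inv_mul,
    ENNReal.le_div_iff_mul_le (Or.inl (ballWeight_univ_ne_zero α))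
      (Or.inl (ballWeight_univ_ne_top hα)), lintegral_ballWeight, ballWeight_univ]
  exact le_setLIntegral_ball_of_le_hardyMean hf.continuousOn (measurable_radialWeight α)
    fun r hr _ => norm_sq_zero_le_hardyMean hf hr

end BergmanEnergy

theorem differentiableOn_moebiusWeight_mul_comp {N : ℕ} {c : CN N} (hc : ‖c‖ < 1) (p : ℝ)
    {f : CN N → ℂ} (hf : DifferentiableOn ℂ f (ball 0 1)) :
    DifferentiableOn ℂ (fun z => moebiusWeight p c z * f (moebius c z)) (ball 0 1) :=
  DifferentiableOn.mul
    (fun _ hz => (differentiableAt_moebiusWeight hc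
      (norm_mul_norm_lt_one hc (mem_ball_zero_iff.1 hz).le)).differentiableWithinAt)
    (hf.comp (differentiableOn_moebius hc) (mapsTo_moebius hc))

theorem differentiableOn_comp_isometry {N : ℕ} (V : CN N ≃ₗᵢ[ℂ] CN N) {f : CN N → ℂ}
    (hf : DifferentiableOn ℂ f (ball 0 1)) :
    DifferentiableOn ℂ (fun z => f (V z)) (ball 0 1) :=
  hf.comp V.differentiable.differentiableOn fun z hz => by simpa using hz

namespace BergmanSpace

variable {N : ℕ} [NeZero N] {α : ℝ} {hα : -1 < α}

theorem bergmanEnergy_eq_norm_sq (f : BergmanSpace N hα) :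
    bergmanEnergy α f = ENNReal.ofReal (‖f‖ ^ 2) := by
  rw [norm_sq_eq, ofReal_integral_eq_lintegral_ofReal f.mem.2.2
    (Eventually.of_forall fun _ => sq_nonneg _), bergmanEnergy]

theorem exists_of_bergmanEnergy_le (hα : -1 < α) {f : CN N → ℂ}
    (hf : DifferentiableOn ℂ f (ball 0 1)) {M : ℝ} (hM : 0 ≤ M)
    (h : bergmanEnergy α f ≤ ENNReal.ofReal (M ^ 2)) :
    ∃ g : BergmanSpace N hα, (∀ z ∈ ball (0 : CN N) 1, g z = f z) ∧ ‖g‖ ≤ M := by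
  set F := (ball (0 : CN N) 1).indicator f
  have hFf : EqOn F f (ball 0 1) := fun z hz => indicator_of_mem hz f
  have hFd : DifferentiableOn ℂ F (ball 0 1) := hf.congr hFf
  have hintegrable : Integrable (fun z => ‖F z‖ ^ 2) (bergmanMeasure N α) := by
    refine ⟨(aestronglyMeasurable_bergman hFd α).norm.pow 2, ?_⟩
    rw [hasFiniteIntegral_iff_ofReal (Eventually.of_forall fun _ => sq_nonneg _)]
    exact ((bergmanEnergy_congr hFf).trans_le h).trans_lt ENNReal.ofReal_lt_top
  let g : BergmanSpace N hα := ⟨F, hFd, fun z hz => indicator_of_notMem hz f, hintegrable⟩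
  refine ⟨g, hFf, ?_⟩
  rw [← sq_le_sq₀ (norm_nonneg _) hM, ← ENNReal.ofReal_le_ofReal_iff (sq_nonneg M),
    ← bergmanEnergy_eq_norm_sq]
  exact (bergmanEnergy_congr hFf).trans_le h

/-- The inclusion of `A²_α` in the functions on `ℂ^N`. -/
def evalMap (N : ℕ) [NeZero N] {α : ℝ} (hα : -1 < α) :
    BergmanSpace N hα →ₗ[ℂ] (CN N → ℂ) where
  toFun f := f
  map_add' _ _ := rfl
  map_smul' _ _ := rfl

theorem isBallSpace (hα : -1 < α) : IsBallSpace N (N + 1 + α) (evalMap N hα) where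
  differentiableOn f := f.mem.1
  eq_zero f h := BergmanSpace.ext fun z => by
    by_cases hz : z ∈ ball (0 : CN N) 1
    · exact h z hz
    · exact f.mem.2.1 z hz
  norm_apply_zero_le f := by
    have h := norm_sq_zero_le_bergmanEnergy hα f.mem.1
    rwa [f.bergmanEnergy_eq_norm_sq, ENNReal.ofReal_le_ofReal_iff (sq_nonneg _),
      sq_le_sq₀ (norm_nonneg _) (norm_nonneg _)] at h
  exists_limit f g M hg hu hM := by
    obtain ⟨n, hn⟩ := hM.exists
    refine exists_of_bergmanEnergy_le hα hg ((norm_nonneg _).trans hn)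
      (bergmanEnergy_le_of_tendsto (fun n => (f n).mem.1)
        (tendsto_apply_of_tendstoUniformlyOn_ball hu) ?_)
    filter_upwards [hM] with n hn
    rw [bergmanEnergy_eq_norm_sq]
    gcongr
  exists_mul W M hW hWM f := by
    have hM : 0 ≤ M := (norm_nonneg _).trans (hWM 0 (by simp))
    refine exists_of_bergmanEnergy_le hα (hW.mul f.mem.1) (mul_nonneg hM (norm_nonneg f))
      ((bergmanEnergy_mul_le hWM f).trans_eq ?_)
    rw [f.bergmanEnergy_eq_norm_sq, mul_pow, ENNReal.ofReal_mul (sq_nonneg M)]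
  exists_moebius c hc f :=
    exists_of_bergmanEnergy_le hα (differentiableOn_moebiusWeight_mul_comp hc _ f.mem.1)
      (norm_nonneg f) ((bergmanEnergy_moebius hc α f).trans f.bergmanEnergy_eq_norm_sq).le
  exists_isometry V f :=
    exists_of_bergmanEnergy_le hα (differentiableOn_comp_isometry V f.mem.1) (norm_nonneg f)
      ((bergmanEnergy_isometry V α f).trans f.bergmanEnergy_eq_norm_sq).le
  exists_one :=
    let ⟨g, hg, _⟩ := exists_of_bergmanEnergy_le hα (differentiableOn_const (1 : ℂ)) zero_le_one
      (by rw [bergmanEnergy_one hα]; simp)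
    ⟨g, hg⟩

end BergmanSpace

section BoundaryConcentration

variable {N : ℕ}

theorem setLIntegral_volumeIoiPow (n : ℕ) {G : ℝ → ℝ≥0∞} (hG : Measurable G) :
    ∫⁻ r : Ioi (0 : ℝ) in {r | (r : ℝ) < 1}, G r ∂(Measure.volumeIoiPow n) =
      ∫⁻ r in Ioo (0 : ℝ) 1, ENNReal.ofReal (r ^ n) * G r := by
  have himage : Subtype.val '' {r : Ioi (0 : ℝ) | (r : ℝ) < 1} = Ioo (0 : ℝ) 1 := by
    ext x
    simp [and_comm]
  rw [Measure.volumeIoiPow,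
    restrict_withDensity (measurableSet_lt measurable_subtype_coe measurable_const),
    lintegral_withDensity_eq_lintegral_mul _ (by fun_prop)
      (show Measurable fun r : Ioi (0 : ℝ) => G r from hG.comp measurable_subtype_coe)]
  simp only [Pi.mul_apply]
  rw [setLIntegral_subtype measurableSet_Ioi _ fun a : ℝ => ENNReal.ofReal (a ^ n) * G a, himage]

theorem lintegral_one_sub_rpow {α : ℝ} (hα : -1 < α) {s : ℝ} (hs : s ≤ 1) :
    ∫⁻ r in Ioo s 1, ENNReal.ofReal ((1 - r) ^ α) =
      ENNReal.ofReal ((1 - s) ^ (α + 1) / (α + 1)) := by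
  have hintegrable : IntervalIntegrable (fun r : ℝ => (1 - r) ^ α) volume s 1 := by
    simpa using (intervalIntegral.intervalIntegrable_rpow' (a := 1 - s) (b := 0) hα).comp_sub_left 1
  rw [restrict_Ioo_eq_restrict_Ioc, ← ofReal_integral_eq_lintegral_ofReal hintegrable.1,
    ← intervalIntegral.integral_of_le hs,
    intervalIntegral.integral_comp_sub_left (fun x : ℝ => x ^ α) 1, integral_rpow (Or.inl hα),
    sub_self, Real.zero_rpow (by linarith), sub_zero]
  filter_upwards [ae_restrict_mem measurableSet_Ioc] with r hr
  exact Real.rpow_nonneg (sub_nonneg.2 hr.2) _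

theorem half_mul_one_sub_rpow_le {α r : ℝ} (hα : α ∈ Ioo (-1 : ℝ) 0) (hr : r ∈ Ioo (0 : ℝ) 1) :
    1 / 2 * (1 - r) ^ α ≤ (1 - r ^ 2) ^ α := by
  have hsub : 0 ≤ 1 - r := sub_nonneg.2 hr.2.le
  have hadd : 1 / 2 ≤ (1 + r) ^ α :=
    calc (1 / 2 : ℝ) = 2 ^ (-1 : ℝ) := by rw [Real.rpow_neg_one, one_div]
      _ ≤ 2 ^ α := Real.rpow_le_rpow_of_exponent_le one_le_two hα.1.le
      _ ≤ (1 + r) ^ α :=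
        Real.rpow_le_rpow_of_nonpos (by linarith [hr.1]) (by linarith [hr.2]) hα.2.le
  calc 1 / 2 * (1 - r) ^ α ≤ (1 + r) ^ α * (1 - r) ^ α := by gcongr
    _ = (1 - r ^ 2) ^ α := by
      rw [← Real.mul_rpow (by linarith [hr.1]) hsub]
      ring_nf

theorem ballWeight_ball_le {α r : ℝ} (hα : α ∈ Ioo (-1 : ℝ) 0) (hr : r ∈ Ioo (0 : ℝ) 1) :
    ballWeight N α (ball 0 r) ≤ ENNReal.ofReal (1 - r ^ 2)⁻¹ * volume (ball (0 : CN N) r) := by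
  have hr2 : 0 < 1 - r ^ 2 := by nlinarith [hr.1, hr.2]
  rw [ballWeight, withDensity_apply _ measurableSet_ball, ← setLIntegral_const]
  refine (setLIntegral_mono' measurableSet_ball fun z hz => ENNReal.ofReal_le_ofReal ?_).trans
    (lintegral_mono' (Measure.restrict_mono le_rfl Measure.restrict_le_self) le_rfl)
  have hzr : 1 - r ^ 2 ≤ 1 - ‖z‖ ^ 2 := by
    nlinarith [norm_nonneg z, mem_ball_zero_iff.1 hz]
  calc (1 - ‖z‖ ^ 2) ^ α ≤ (1 - r ^ 2) ^ α := Real.rpow_le_rpow_of_nonpos hr2 hzr hα.2.le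
    _ ≤ (1 - r ^ 2) ^ (-1 : ℝ) :=
      Real.rpow_le_rpow_of_exponent_ge hr2 (by nlinarith [hr.1]) hα.1.le
    _ = (1 - r ^ 2)⁻¹ := Real.rpow_neg_one _

variable [NeZero N]

theorem exists_mul_le_ballWeight_univ : ∃ c : ℝ≥0∞, c ≠ 0 ∧ ∀ α ∈ Ioo (-1 : ℝ) 0,
    c * ENNReal.ofReal (α + 1)⁻¹ ≤ ballWeight N α univ := by
  set n := Module.finrank ℝ (CN N) - 1
  set σ := (volume : Measure (CN N)).toSphere univ
  have hσ : σ ≠ 0 := toSphere_univ_ne_zero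
  refine ⟨ENNReal.ofReal ((1 / 2) ^ n * (1 / 2)) * σ * ENNReal.ofReal (1 / 2),
    by simp [hσ], fun α hα => ?_⟩
  have hα1 : 0 < α + 1 := by linarith [hα.1]
  have hpow : (1 / 2 : ℝ) ≤ (1 - 1 / 2) ^ (α + 1) := by
    have := Real.rpow_le_rpow_of_exponent_ge (x := 1 / 2) (y := 1) (z := α + 1)
      (by norm_num) (by norm_num) (by linarith [hα.2])
    norm_num at this ⊢
    exact this
  calc ENNReal.ofReal ((1 / 2) ^ n * (1 / 2)) * σ * ENNReal.ofReal (1 / 2) *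
        ENNReal.ofReal (α + 1)⁻¹
      ≤ ENNReal.ofReal ((1 / 2) ^ n * (1 / 2)) * σ *
          ENNReal.ofReal ((1 - 1 / 2) ^ (α + 1) / (α + 1)) := by
        rw [mul_assoc, ← ENNReal.ofReal_mul (by positivity), div_eq_mul_inv ((1 - 1 / 2 : ℝ) ^ _)]
        gcongr
    _ = ∫⁻ r in Ioo (1 / 2 : ℝ) 1, ENNReal.ofReal ((1 / 2) ^ n * (1 / 2)) * σ *
          ENNReal.ofReal ((1 - r) ^ α) := by
        rw [lintegral_const_mul _ (by fun_prop), lintegral_one_sub_rpow hα.1 (by norm_num)]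
    _ ≤ ∫⁻ r in Ioo (1 / 2 : ℝ) 1, ENNReal.ofReal (r ^ n) *
          (ENNReal.ofReal ((1 - r ^ 2) ^ α) * σ) := by
        refine setLIntegral_mono' measurableSet_Ioo fun r hr => ?_
        have hr0 : 0 < r := by linarith [hr.1]
        rw [mul_right_comm, ← ENNReal.ofReal_mul (by positivity), ← mul_assoc,
          ← ENNReal.ofReal_mul (by positivity), mul_assoc]
        gcongr
        · exact mul_nonneg (by norm_num) (Real.rpow_nonneg (by linarith [hr.2]) _)
        · exact hr.1.le
        · exact half_mul_one_sub_rpow_le hα ⟨hr0, hr.2⟩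
    _ ≤ ∫⁻ r in Ioo (0 : ℝ) 1, ENNReal.ofReal (r ^ n) * (ENNReal.ofReal ((1 - r ^ 2) ^ α) * σ) :=
        lintegral_mono_set (Ioo_subset_Ioo (by norm_num) le_rfl)
    _ = ballWeight N α univ := by
        rw [ballWeight_univ, setLIntegral_ball_radial (measurable_radialWeight α),
          ← setLIntegral_volumeIoiPow n (G := fun r => ENNReal.ofReal ((1 - r ^ 2) ^ α) * σ)
            (by fun_prop)]

theorem tendsto_bergmanMeasure_ball {r : ℝ} (hr : r ∈ Ioo (0 : ℝ) 1) :
    Tendsto (fun α => bergmanMeasure N α (ball 0 r)) (𝓝[>] (-1)) (𝓝 0) := by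
  obtain ⟨c, hc, hcα⟩ := exists_mul_le_ballWeight_univ (N := N)
  set C := ENNReal.ofReal (1 - r ^ 2)⁻¹ * volume (ball (0 : CN N) r)
  have hC : C ≠ ∞ := ENNReal.mul_ne_top ENNReal.ofReal_ne_top measure_ball_lt_top.ne
  have hlim : Tendsto (fun α : ℝ => c⁻¹ * C * ENNReal.ofReal (α + 1)) (𝓝[>] (-1)) (𝓝 0) := by
    have h : Tendsto (fun α : ℝ => ENNReal.ofReal (α + 1)) (𝓝 (-1)) (𝓝 0) := by
      simpa using ENNReal.tendsto_ofReal ((continuous_add_const (1 : ℝ)).tendsto (-1))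
    simpa using (ENNReal.Tendsto.const_mul h
      (Or.inr (ENNReal.mul_ne_top (ENNReal.inv_ne_top.2 hc) hC))).mono_left nhdsWithin_le_nhds
  refine tendsto_of_tendsto_of_tendsto_of_le_of_le' tendsto_const_nhds hlim
    (Eventually.of_forall fun _ => zero_le) ?_
  filter_upwards [Ioo_mem_nhdsGT (show (-1 : ℝ) < 0 by norm_num)] with α hα
  have hα1 : 0 < α + 1 := by linarith [hα.1]
  calc bergmanMeasure N α (ball 0 r) = (ballWeight N α univ)⁻¹ * ballWeight N α (ball 0 r) := by
        rw [bergmanMeasure, Measure.smul_apply, smul_eq_mul]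
    _ ≤ (c * ENNReal.ofReal (α + 1)⁻¹)⁻¹ * C := by
        gcongr
        · exact hcα α hα
        · exact ballWeight_ball_le hα hr
    _ = c⁻¹ * C * ENNReal.ofReal (α + 1) := by
        rw [ENNReal.mul_inv (Or.inl hc) (Or.inr (by simpa using hα1)),
          ENNReal.ofReal_inv_of_pos hα1, inv_inv, mul_right_comm]

theorem hardyMean_mul_bergmanMeasure_le {α : ℝ} {f : CN N → ℂ}
    (hf : DifferentiableOn ℂ f (ball 0 1)) {r : ℝ} (hr : r ∈ Ioo (0 : ℝ) 1) :
    ENNReal.ofReal (hardyMean f r) * bergmanMeasure N α (ball 0 r)ᶜ ≤ bergmanEnergy α f := by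
  set w : ℝ → ℝ≥0∞ := (Ici r).indicator fun s => ENNReal.ofReal ((1 - s ^ 2) ^ α) with hw
  have hmean : ∀ s ∈ Ioo (0 : ℝ) 1, w s ≠ 0 → hardyMean f r ≤ hardyMean f s := fun s hs hws =>
    hardyMean_mono hf hr hs (by_contra fun hsr => hws (indicator_of_notMem hsr _))
  have hmass : ballWeight N α (ball 0 r)ᶜ = ∫⁻ z in ball (0 : CN N) 1, w ‖z‖ := by
    rw [ballWeight, withDensity_apply _ measurableSet_ball.compl,
      ← lintegral_indicator measurableSet_ball.compl]
    refine lintegral_congr fun z => ?_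
    by_cases hz : r ≤ ‖z‖
    · rw [hw, indicator_of_mem (by simpa using hz), indicator_of_mem (mem_Ici.2 hz)]
    · rw [hw, indicator_of_notMem (by simpa using hz),
        indicator_of_notMem (notMem_Ici.2 (not_le.1 hz))]
  have henergy : ∫⁻ z in ball (0 : CN N) 1, ENNReal.ofReal (‖f z‖ ^ 2) * w ‖z‖ ≤
      ∫⁻ z, ENNReal.ofReal (‖f z‖ ^ 2) ∂(ballWeight N α) := by
    rw [lintegral_ballWeight]
    gcongr
    exact indicator_le_self _ _ _
  rw [bergmanEnergy_eq, bergmanMeasure, Measure.smul_apply, smul_eq_mul, mul_left_comm, hmass]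
  gcongr
  exact (le_setLIntegral_ball_of_le_hardyMean hf.continuousOn
    ((measurable_radialWeight α).indicator measurableSet_Ici) hmean).trans henergy

theorem hardyMean_le_of_bergmanEnergy_le {f : CN N → ℂ} (hf : DifferentiableOn ℂ f (ball 0 1))
    {M : ℝ} (hM : 0 ≤ M) {B : ℝ → ℝ≥0∞} (hB : Tendsto B (𝓝[>] (-1)) (𝓝 (ENNReal.ofReal M)))
    (h : ∀ α, -1 < α → bergmanEnergy α f ≤ B α) {r : ℝ} (hr : r ∈ Ioo (0 : ℝ) 1) :
    hardyMean f r ≤ M := by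
  have hcompl : Tendsto (fun α => bergmanMeasure N α (ball 0 r)ᶜ) (𝓝[>] (-1)) (𝓝 1) := by
    have hsub := ENNReal.Tendsto.sub (tendsto_const_nhds (x := (1 : ℝ≥0∞)))
      (tendsto_bergmanMeasure_ball (N := N) hr) (Or.inl ENNReal.one_ne_top)
    rw [tsub_zero] at hsub
    refine hsub.congr' ?_
    filter_upwards [self_mem_nhdsWithin] with α hα
    have := isProbabilityMeasure_bergmanMeasure (N := N) hα
    exact (prob_compl_eq_one_sub measurableSet_ball).symm
  have hmean := ENNReal.Tendsto.const_mul (a := ENNReal.ofReal (hardyMean f r)) hcompl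
    (Or.inl one_ne_zero)
  rw [mul_one] at hmean
  refine (ENNReal.ofReal_le_ofReal_iff hM).1 (le_of_tendsto_of_tendsto hmean hB ?_)
  filter_upwards [self_mem_nhdsWithin] with α hα
  exact (hardyMean_mul_bergmanMeasure_le hf hr).trans (h α hα)

end BoundaryConcentration

theorem norm_moebiusWeight_le {N : ℕ} {c z : CN N} {s : ℝ} (hc : ‖c‖ < 1) (hz : ‖z‖ < 1)
    (hs : 0 ≤ s) (p : ℝ) :
    ‖moebiusWeight p c z‖ ≤ (2 / defect c) ^ s * ‖moebiusWeight (p + s) c z‖ := by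
  have hδ := defect_pos hc
  have hczl := norm_mul_norm_lt_one hc hz.le
  have hD := norm_pos_iff.2 (one_sub_inner_ne_zero hczl)
  have hD2 : ‖(1 - inner ℂ c z : ℂ)‖ ≤ 2 :=
    (norm_sub_le _ _).trans (by
      rw [norm_one]
      linarith [norm_inner_le_norm (𝕜 := ℂ) c z])
  rw [norm_moebiusWeight hc, norm_moebiusWeight hc, Real.rpow_add (by positivity), mul_left_comm,
    ← Real.mul_rpow (by positivity) (by positivity)]
  refine le_mul_of_one_le_right (by positivity) (Real.one_le_rpow ?_ hs)
  rw [div_mul_div_cancel₀ hδ.ne']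
  exact (one_le_div hD).2 hD2

namespace HardySpace

variable {N : ℕ} [NeZero N]

theorem hardyMean_le (f : HardySpace N) {r : ℝ} (hr : r ∈ Ioo (0 : ℝ) 1) :
    hardyMean f r ≤ ‖f‖ ^ 2 := by
  rw [f.norm_sq_eq]
  exact f.mean_le_sSup hr

theorem bergmanEnergy_le (f : HardySpace N) {α : ℝ} (hα : -1 < α) :
    bergmanEnergy α f ≤ ENNReal.ofReal (‖f‖ ^ 2) :=
  bergmanEnergy_le_of_hardyMean_le hα f.mem.1.continuousOn fun _ hr => f.hardyMean_le hr

theorem exists_of_hardyMean_le {f : CN N → ℂ} (hf : DifferentiableOn ℂ f (ball 0 1)) {M : ℝ}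
    (hM : 0 ≤ M) (h : ∀ r ∈ Ioo (0 : ℝ) 1, hardyMean f r ≤ M ^ 2) :
    ∃ g : HardySpace N, (∀ z ∈ ball (0 : CN N) 1, g z = f z) ∧ ‖g‖ ≤ M := by
  set F := (ball (0 : CN N) 1).indicator f
  have hFf : EqOn F f (ball 0 1) := fun z hz => indicator_of_mem hz f
  have hFd : DifferentiableOn ℂ F (ball 0 1) := hf.congr hFf
  have hbound : M ^ 2 ∈ upperBounds (hardyMean F '' Ioo 0 1) := by
    rintro _ ⟨r, hr, rfl⟩
    simpa only [hardyMean, hFf (rsmul_mem_ball hr _)] using h r hr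
  let g : HardySpace N := ⟨F, hFd, fun z hz => indicator_of_notMem hz f, M ^ 2, hbound⟩
  refine ⟨g, hFf, ?_⟩
  rw [← sq_le_sq₀ (norm_nonneg _) hM, HardySpace.norm_sq_eq]
  exact csSup_le ((nonempty_Ioo.2 one_pos).image _) hbound

theorem exists_of_bergmanEnergy_le {f : CN N → ℂ} (hf : DifferentiableOn ℂ f (ball 0 1)) {M : ℝ}
    (hM : 0 ≤ M) {B : ℝ → ℝ≥0∞} (hB : Tendsto B (𝓝[>] (-1)) (𝓝 (ENNReal.ofReal (M ^ 2))))
    (h : ∀ α, -1 < α → bergmanEnergy α f ≤ B α) :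
    ∃ g : HardySpace N, (∀ z ∈ ball (0 : CN N) 1, g z = f z) ∧ ‖g‖ ≤ M :=
  exists_of_hardyMean_le hf hM fun _ hr => hardyMean_le_of_bergmanEnergy_le hf (sq_nonneg M) hB h hr

theorem bergmanEnergy_moebius_le (f : HardySpace N) {c : CN N} (hc : ‖c‖ < 1) {α : ℝ}
    (hα : -1 < α) :
    bergmanEnergy α (fun z => moebiusWeight N c z * f (moebius c z)) ≤
      ENNReal.ofReal (((2 / defect c) ^ (1 + α)) ^ 2) * ENNReal.ofReal (‖f‖ ^ 2) := by
  calc bergmanEnergy α (fun z => moebiusWeight N c z * f (moebius c z))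
      ≤ ENNReal.ofReal (((2 / defect c) ^ (1 + α)) ^ 2) *
          bergmanEnergy α (fun z => moebiusWeight (N + 1 + α) c z * f (moebius c z)) := by
        refine bergmanEnergy_le_mul_of_norm_le fun z hz => ?_
        rw [norm_mul, norm_mul, ← mul_assoc, add_assoc]
        gcongr
        exact norm_moebiusWeight_le hc (mem_ball_zero_iff.1 hz) (by linarith) _
    _ = ENNReal.ofReal (((2 / defect c) ^ (1 + α)) ^ 2) * bergmanEnergy α f := by
        rw [bergmanEnergy_moebius hc]
    _ ≤ _ := by
        gcongr
        exact f.bergmanEnergy_le hα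

theorem tendsto_moebius_bound {δ : ℝ} (hδ : 0 < δ) (M : ℝ) :
    Tendsto (fun α : ℝ => ENNReal.ofReal (((2 / δ) ^ (1 + α)) ^ 2) * ENNReal.ofReal M)
      (𝓝[>] (-1)) (𝓝 (ENNReal.ofReal M)) := by
  have hcont : Continuous fun α : ℝ => ((2 / δ) ^ (1 + α)) ^ 2 :=
    ((Real.continuous_const_rpow (by positivity)).comp (continuous_const_add 1)).pow 2
  simpa using ENNReal.Tendsto.mul_const
    (ENNReal.tendsto_ofReal ((hcont.tendsto (-1)).mono_left nhdsWithin_le_nhds))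
    (Or.inr ENNReal.ofReal_ne_top)

/-- The inclusion of `H²` in the functions on `ℂ^N`. -/
def evalMap (N : ℕ) [NeZero N] : HardySpace N →ₗ[ℂ] (CN N → ℂ) where
  toFun f := f
  map_add' _ _ := rfl
  map_smul' _ _ := rfl

theorem isBallSpace : IsBallSpace N N (evalMap N) where
  differentiableOn f := f.mem.1
  eq_zero f h := HardySpace.ext fun z => by
    by_cases hz : z ∈ ball (0 : CN N) 1
    · exact h z hz
    · exact f.mem.2.1 z hz
  norm_apply_zero_le f := by
    obtain ⟨r, hr⟩ := nonempty_Ioo.2 (zero_lt_one' ℝ)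
    exact (sq_le_sq₀ (norm_nonneg _) (norm_nonneg _)).1
      ((norm_sq_zero_le_hardyMean f.mem.1 hr).trans (f.hardyMean_le hr))
  exists_limit f g M hg hu hM := by
    obtain ⟨n, hn⟩ := hM.exists
    refine exists_of_bergmanEnergy_le hg ((norm_nonneg _).trans hn) tendsto_const_nhds
      fun α hα => bergmanEnergy_le_of_tendsto (fun n => (f n).mem.1)
        (tendsto_apply_of_tendstoUniformlyOn_ball hu) ?_
    filter_upwards [hM] with n hn
    exact ((f n).bergmanEnergy_le hα).trans (by gcongr)
  exists_mul W M hW hWM f := by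
    have hM : 0 ≤ M := (norm_nonneg _).trans (hWM 0 (by simp))
    refine exists_of_bergmanEnergy_le (hW.mul f.mem.1) (mul_nonneg hM (norm_nonneg f))
      tendsto_const_nhds fun α hα => (bergmanEnergy_mul_le hWM f).trans ?_
    rw [mul_pow, ENNReal.ofReal_mul (sq_nonneg M)]
    gcongr
    exact f.bergmanEnergy_le hα
  exists_moebius c hc f :=
    exists_of_bergmanEnergy_le (differentiableOn_moebiusWeight_mul_comp hc _ f.mem.1)
      (norm_nonneg f) (tendsto_moebius_bound (defect_pos hc) _)
      fun _ hα => f.bergmanEnergy_moebius_le hc hα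
  exists_isometry V f :=
    exists_of_bergmanEnergy_le (differentiableOn_comp_isometry V f.mem.1) (norm_nonneg f)
      tendsto_const_nhds fun α hα => (bergmanEnergy_isometry V α f).trans_le (f.bergmanEnergy_le hα)
  exists_one :=
    let ⟨g, hg, _⟩ := exists_of_hardyMean_le (differentiableOn_const (1 : ℂ)) zero_le_one
      fun r _ => by simp [hardyMean]
    ⟨g, hg⟩

end HardySpace

section Laurent

variable {E : Type*} [NormedAddCommGroup E] [NormedSpace ℂ E]

theorem integral_exp_neg_int_mul_I (n : ℤ) :
    ∫ θ in (0 : ℝ)..2 * Real.pi, Complex.exp (-(n : ℂ) * Complex.I * θ) =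
      if n = 0 then ((2 * Real.pi : ℝ) : ℂ) else 0 := by
  split_ifs with hn
  · simp [hn]
  · have hc : -(n : ℂ) * Complex.I ≠ 0 :=
      mul_ne_zero (neg_ne_zero.2 (by exact_mod_cast hn)) Complex.I_ne_zero
    have hperiod : -(n : ℂ) * Complex.I * ((2 * Real.pi : ℝ) : ℂ) =
        ((-n : ℤ) : ℂ) * (2 * Real.pi * Complex.I) := by
      push_cast
      ring
    rw [integral_exp_mul_complex hc, hperiod, Complex.exp_int_mul_two_pi_mul_I]
    simp

theorem norm_exp_neg_int_mul_I_smul (n : ℤ) (θ : ℝ) (v : E) :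
    ‖Complex.exp (-(n : ℂ) * Complex.I * θ) • v‖ = ‖v‖ := by
  rw [norm_smul, Complex.norm_exp]
  simp

theorem hasSum_integral_exp_smul {a : ℤ → E} (ha : Summable fun n => ‖a n‖) :
    HasSum (fun n : ℤ => ∫ θ in (0 : ℝ)..2 * Real.pi, Complex.exp (-(n : ℂ) * Complex.I * θ) • a n)
      (∫ θ in (0 : ℝ)..2 * Real.pi, ∑' n : ℤ, Complex.exp (-(n : ℂ) * Complex.I * θ) • a n) := by
  let F : ℤ → C(ℝ, E) := fun n =>
    ⟨fun θ => Complex.exp (-(n : ℂ) * Complex.I * θ) • a n, by fun_prop⟩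
  refine intervalIntegral.hasSum_intervalIntegral_of_summable_norm (f := F)
    (.of_nonneg_of_le (fun _ => norm_nonneg _) (fun n => ?_) ha)
  exact (ContinuousMap.norm_le _ (norm_nonneg _)).2 fun θ => (norm_exp_neg_int_mul_I_smul n θ _).le

/-- The zeroth coefficient is the mean of the series over the circle. -/
theorem exists_tsum_exp_smul_ne_zero [CompleteSpace E] {a : ℤ → E} (ha : Summable fun n => ‖a n‖)
    (h0 : a 0 ≠ 0) :
    ∃ θ : ℝ, ∑' n : ℤ, Complex.exp (-(n : ℂ) * Complex.I * θ) • a n ≠ 0 := by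
  by_contra! hzero
  have hsum := hasSum_integral_exp_smul ha
  simp only [hzero, intervalIntegral.integral_zero, intervalIntegral.integral_smul_const,
    integral_exp_neg_int_mul_I, ite_smul, zero_smul] at hsum
  have hpi : ((2 * Real.pi : ℝ) : ℂ) ≠ 0 := by exact_mod_cast Real.two_pi_pos.ne'
  refine smul_ne_zero hpi h0 ((hasSum_single 0 fun n hn => if_neg hn).unique hsum |>.symm ▸ ?_)
  simp

theorem exists_hasEigenvalue_of_map_eq_smul_succ [CompleteSpace E] {T : E →L[ℂ] E} {a : ℤ → E}
    (ha : Summable fun n => ‖a n‖) (h0 : a 0 ≠ 0) {r : ℂ} (hT : ∀ n, T (a n) = r • a (n + 1)) :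
    ∃ l : ℂ, ‖l‖ = ‖r‖ ∧ Module.End.HasEigenvalue (T : E →ₗ[ℂ] E) l := by
  obtain ⟨θ, hθ⟩ := exists_tsum_exp_smul_ne_zero ha h0
  have hsum : Summable fun n : ℤ => Complex.exp (-(n : ℂ) * Complex.I * θ) • a n :=
    .of_norm (ha.congr fun n => (norm_exp_neg_int_mul_I_smul n θ _).symm)
  refine ⟨r * Complex.exp (Complex.I * θ), ?_, Module.End.hasEigenvalue_of_hasEigenvector
    ⟨Module.End.mem_eigenspace_iff.2 ?_, hθ⟩⟩
  · rw [norm_mul, Complex.norm_exp]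
    simp
  · rw [ContinuousLinearMap.coe_coe, T.map_tsum hsum, ← tsum_const_smul'',
      ← (Equiv.addRight (1 : ℤ)).tsum_eq fun n => (r * Complex.exp (Complex.I * θ)) •
        Complex.exp (-(n : ℂ) * Complex.I * θ) • a n]
    refine tsum_congr fun n => ?_
    have hexp : Complex.exp (-(n : ℂ) * Complex.I * θ) =
        Complex.exp (Complex.I * θ) * Complex.exp (-((n + 1 : ℤ) : ℂ) * Complex.I * θ) := by
      rw [← Complex.exp_add]
      congr 1
      push_cast
      ring
    rw [map_smul, hT, hexp, Equiv.coe_addRight, smul_smul, smul_smul]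
    congr 1
    ring

theorem summable_norm_zpow_smul_apply (u : (E →L[ℂ] E)ˣ) {g : E} {r s t C D : ℝ} (hr : 0 < r)
    (hs : 0 ≤ s) (hsr : s < r) (ht : 0 ≤ t) (htr : t < r⁻¹)
    (hfwd : ∀ n : ℕ, ‖((u : E →L[ℂ] E) ^ n) g‖ ≤ C * s ^ n)
    (hbwd : ∀ n : ℕ, ‖((↑u⁻¹ : E →L[ℂ] E) ^ n) g‖ ≤ D * t ^ n) :
    Summable fun n : ℤ => ‖(r : ℂ) ^ (-n) • (↑(u ^ n) : E →L[ℂ] E) g‖ := by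
  refine Summable.of_nat_of_neg ?_ ?_
  · refine .of_nonneg_of_le (fun _ => norm_nonneg _) (fun n => ?_)
      ((summable_geometric_of_lt_one (r := s / r) (by positivity)
        ((div_lt_one hr).2 hsr)).mul_left C)
    rw [zpow_neg, zpow_natCast, zpow_natCast, Units.val_pow_eq_pow_val, norm_smul, norm_inv,
      norm_pow, Complex.norm_real, Real.norm_of_nonneg hr.le, div_pow, ← div_eq_inv_mul,
      ← mul_div_assoc]
    gcongr
    exact hfwd n
  · refine .of_nonneg_of_le (fun _ => norm_nonneg _) (fun n => ?_)
      ((summable_geometric_of_lt_one (r := r * t) (by positivity)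
        ((lt_inv_mul_iff₀ hr).1 (by rwa [mul_one]))).mul_left D)
    rw [neg_neg, zpow_natCast, zpow_neg, zpow_natCast, ← inv_pow, Units.val_pow_eq_pow_val,
      norm_smul, norm_pow, Complex.norm_real, Real.norm_of_nonneg hr.le, mul_pow, mul_left_comm]
    gcongr
    exact hbwd n

theorem exists_hasEigenvalue_of_norm_pow_apply_le [CompleteSpace E] (u : (E →L[ℂ] E)ˣ) {g : E}
    (hg : g ≠ 0) {r s t C D : ℝ} (hs : 0 ≤ s) (hsr : s < r) (ht : 0 ≤ t) (htr : t < r⁻¹)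
    (hfwd : ∀ n : ℕ, ‖((u : E →L[ℂ] E) ^ n) g‖ ≤ C * s ^ n)
    (hbwd : ∀ n : ℕ, ‖((↑u⁻¹ : E →L[ℂ] E) ^ n) g‖ ≤ D * t ^ n) :
    ∃ l : ℂ, ‖l‖ = r ∧ Module.End.HasEigenvalue ((u : E →L[ℂ] E) : E →ₗ[ℂ] E) l := by
  have hr : 0 < r := hs.trans_lt hsr
  have hrc : (r : ℂ) ≠ 0 := by exact_mod_cast hr.ne'
  have hshift (n : ℤ) : (u : E →L[ℂ] E) ((r : ℂ) ^ (-n) • (↑(u ^ n) : E →L[ℂ] E) g) =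
      (r : ℂ) • (r : ℂ) ^ (-(n + 1)) • (↑(u ^ (n + 1)) : E →L[ℂ] E) g := by
    rw [map_smul, ← mul_apply_eq_comp, ← Units.val_mul, ← zpow_one_add, add_comm 1 n,
      smul_smul, ← zpow_one_add₀ hrc]
    congr 2
    ring
  obtain ⟨l, hl, heig⟩ := exists_hasEigenvalue_of_map_eq_smul_succ
    (summable_norm_zpow_smul_apply u hr hs hsr ht htr hfwd hbwd) (by simpa using hg) hshift
  exact ⟨l, by rw [hl, Complex.norm_real, Real.norm_of_nonneg hr.le], heig⟩

end Laurent

section AnnularSpectrum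

variable {E : Type*} [NormedAddCommGroup E] [InnerProductSpace ℂ E]

/-- `T` is similar to each of its rotations `exp(iθ) T`. -/
def IsRotationInvariant (T : E →L[ℂ] E) : Prop :=
  ∀ θ : ℝ, ∃ P : (E →L[ℂ] E)ˣ, T * P = Complex.exp (θ * Complex.I) • (P * T)

theorem interior_closedAnnulus_subset {s t : ℝ} (hs : 0 < s) (ht : 0 < t) :
    interior (closedAnnulus s t) ⊆ {l | min s t < ‖l‖ ∧ ‖l‖ < max s t} := by
  have heq : closedAnnulus s t = (ball 0 (min s t))ᶜ ∩ closedBall 0 (max s t) := by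
    ext l
    simp only [closedAnnulus, mem_inter_iff, mem_compl_iff, mem_ball_zero_iff, not_lt,
      mem_closedBall_zero_iff, mem_ofPred_eq]
  rw [heq, interior_inter, interior_compl, closure_ball _ (lt_min hs ht).ne',
    interior_closedBall _ (hs.trans_le (le_max_left s t)).ne']
  rintro l ⟨hl, hl'⟩
  exact ⟨not_le.1 (mem_closedBall_zero_iff.not.1 hl), mem_ball_zero_iff.1 hl'⟩

theorem exists_eq_exp_mul_of_norm_eq {l l' : ℂ} (h : ‖l'‖ = ‖l‖) :
    ∃ θ : ℝ, l' = Complex.exp (θ * Complex.I) * l := by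
  refine ⟨l'.arg - l.arg, ?_⟩
  calc l' = ‖l‖ * Complex.exp (l'.arg * Complex.I) := by rw [← h, Complex.norm_mul_exp_arg_mul_I]
    _ = Complex.exp ((l'.arg - l.arg) * Complex.I) * (‖l‖ * Complex.exp (l.arg * Complex.I)) := by
      rw [mul_left_comm, ← Complex.exp_add]
      ring_nf
    _ = Complex.exp ((l'.arg - l.arg : ℝ) * Complex.I) * l := by
      rw [Complex.norm_mul_exp_arg_mul_I, Complex.ofReal_sub]

namespace IsRotationInvariant

variable {T : E →L[ℂ] E} {l l' : ℂ}

theorem hasEigenvalue (hT : IsRotationInvariant T) (h : ‖l'‖ = ‖l‖)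
    (hl : Module.End.HasEigenvalue (T : E →ₗ[ℂ] E) l) :
    Module.End.HasEigenvalue (T : E →ₗ[ℂ] E) l' := by
  obtain ⟨θ, rfl⟩ := exists_eq_exp_mul_of_norm_eq h
  obtain ⟨P, hTP⟩ := hT θ
  obtain ⟨v, hv⟩ := hl.exists_hasEigenvector
  have hTv : T v = l • v := hv.apply_eq_smul
  refine Module.End.hasEigenvalue_of_hasEigenvector (x := (P : E →L[ℂ] E) v)
    ⟨Module.End.mem_eigenspace_iff.2 ?_, fun hPv => hv.2 ?_⟩
  · rw [ContinuousLinearMap.coe_coe, ← mul_apply_eq_comp, hTP,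
      smul_apply, mul_apply_eq_comp, hTv, map_smul, smul_smul]
  · calc v = ((↑P⁻¹ : E →L[ℂ] E) * P) v := by rw [P.inv_mul, one_apply_eq_self]
      _ = 0 := by rw [mul_apply_eq_comp, hPv, map_zero]

theorem mem_spectrum (hT : IsRotationInvariant T) (h : ‖l'‖ = ‖l‖) (hl : l ∈ spectrum ℂ T) :
    l' ∈ spectrum ℂ T := by
  obtain ⟨θ, rfl⟩ := exists_eq_exp_mul_of_norm_eq h
  obtain ⟨P, hTP⟩ := hT θ
  have hconj : T = Complex.exp (θ * Complex.I) • ((P : E →L[ℂ] E) * T * (↑P⁻¹ : E →L[ℂ] E)) := by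
    rw [← smul_mul_assoc, ← hTP, Units.mul_inv_cancel_right]
  have hrotate := spectrum.unit_smul_eq_smul ((P : E →L[ℂ] E) * T * (↑P⁻¹ : E →L[ℂ] E))
    (Units.mk0 _ (Complex.exp_ne_zero (θ * Complex.I)))
  rw [spectrum.units_conjugate] at hrotate
  rw [hconj]
  exact hrotate.ge (smul_mem_smul_set hl)

theorem adjoint [CompleteSpace E] (hT : IsRotationInvariant T) :
    IsRotationInvariant (ContinuousLinearMap.adjoint T) := by
  intro θ
  obtain ⟨P, hTP⟩ := hT θ
  have hunit : Complex.exp (θ * Complex.I) * star (Complex.exp (θ * Complex.I)) = 1 := by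
    rw [Complex.star_def, Complex.mul_conj, Complex.normSq_eq_norm_sq,
      Complex.norm_exp_ofReal_mul_I]
    simp
  have hstar := congrArg star hTP
  rw [star_smul, star_mul, star_mul] at hstar
  exact ⟨star P, by
    rw [← ContinuousLinearMap.star_eq_adjoint, Units.coe_star, hstar, smul_smul, hunit, one_smul]⟩

end IsRotationInvariant

variable {T : E →L[ℂ] E} {l : ℂ} {s t : ℝ}

theorem mem_spectrum_of_hasEigenvalue (h : Module.End.HasEigenvalue (T : E →ₗ[ℂ] E) l) :
    l ∈ spectrum ℂ T := by
  rintro ⟨u, hu⟩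
  obtain ⟨v, hv⟩ := h.exists_hasEigenvector
  have hTv : T v = l • v := hv.apply_eq_smul
  have huv : (u : E →L[ℂ] E) v = 0 := by
    rw [hu, sub_apply, hTv, Algebra.algebraMap_eq_smul_one]
    simp
  refine hv.2 ?_
  calc v = ((↑u⁻¹ : E →L[ℂ] E) * u) v := by rw [u.inv_mul, one_apply_eq_self]
    _ = 0 := by rw [mul_apply_eq_comp, huv, map_zero]

variable [CompleteSpace E]

theorem star_mem_spectrum_of_hasEigenvalue_adjoint
    (h : Module.End.HasEigenvalue (ContinuousLinearMap.adjoint T : E →ₗ[ℂ] E) l) :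
    star l ∈ spectrum ℂ T := by
  have hl : l ∈ spectrum ℂ (star T) := mem_spectrum_of_hasEigenvalue h
  rwa [spectrum.map_star] at hl

theorem norm_le_of_mem_spectrum_of_norm_pow_le {C μ : ℝ} (hμ : 0 < μ)
    (h : ∀ n : ℕ, ‖T ^ n‖ ≤ C * μ ^ n) (hl : l ∈ spectrum ℂ T) : ‖l‖ ≤ μ := by
  by_contra! hlt
  obtain ⟨n, hn⟩ := pow_unbounded_of_one_lt C ((one_lt_div hμ).2 hlt)
  have : Nontrivial E := by
    by_contra hE
    have := not_nontrivial_iff_subsingleton.1 hE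
    simp [spectrum.of_subsingleton] at hl
  have hpow := spectrum.norm_le_norm_of_mem (spectrum.pow_mem_pow T n hl)
  rw [norm_pow] at hpow
  rw [div_pow, lt_div_iff₀ (by positivity)] at hn
  exact (hn.trans_le (hpow.trans (h n))).false

theorem norm_le_of_mem_spectrum_of_growth (hs : 0 ≤ s)
    (h : ∀ μ, s < μ → ∃ C, ∀ n : ℕ, ‖T ^ n‖ ≤ C * μ ^ n) (hl : l ∈ spectrum ℂ T) : ‖l‖ ≤ s := by
  refine le_of_forall_gt_imp_ge_of_dense fun μ hμ => ?_
  obtain ⟨C, hC⟩ := h μ hμ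
  exact norm_le_of_mem_spectrum_of_norm_pow_le (hs.trans_lt hμ) hC hl

theorem spectrum_subset_closedAnnulus (u : (E →L[ℂ] E)ˣ) (hs : 0 < s) (ht : 0 < t)
    (hfwd : ∀ μ, max s t < μ → ∃ C, ∀ n : ℕ, ‖(u : E →L[ℂ] E) ^ n‖ ≤ C * μ ^ n)
    (hbwd : ∀ μ, max t⁻¹ s⁻¹ < μ → ∃ C, ∀ n : ℕ, ‖(↑u⁻¹ : E →L[ℂ] E) ^ n‖ ≤ C * μ ^ n) :
    spectrum ℂ (u : E →L[ℂ] E) ⊆ closedAnnulus s t := by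
  intro l hl
  refine ⟨?_, norm_le_of_mem_spectrum_of_growth (hs.le.trans (le_max_left s t)) hfwd hl⟩
  have hl0 : l ≠ 0 := spectrum.ne_zero_of_mem_of_unit (a := u) hl
  have hinv : l⁻¹ ∈ spectrum ℂ (↑u⁻¹ : E →L[ℂ] E) :=
    (spectrum.inv_mem_iff (r := Units.mk0 l hl0) (a := u)).1 hl
  have hle := norm_le_of_mem_spectrum_of_growth
    ((inv_pos.2 ht).le.trans (le_max_left t⁻¹ s⁻¹)) hbwd hinv
  rw [norm_inv, le_max_iff, inv_le_inv₀ (norm_pos_iff.2 hl0) ht,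
    inv_le_inv₀ (norm_pos_iff.2 hl0) hs] at hle
  exact min_le_iff.2 hle.symm

/-- The spectrum of `T` is the closed annulus with radii `s` and `t` (in either order), and its
interior points are eigenvalues of `T` or of its adjoint. -/
def HasAnnularSpectrum (T : E →L[ℂ] E) (s t : ℝ) : Prop :=
  spectrum ℂ T = closedAnnulus s t ∧ ∀ l ∈ interior (closedAnnulus s t),
    Module.End.HasEigenvalue (T : E →ₗ[ℂ] E) l ∨
      Module.End.HasEigenvalue (ContinuousLinearMap.adjoint T : E →ₗ[ℂ] E) l

theorem IsRotationInvariant.closedAnnulus_subset_spectrum [Nontrivial E]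
    (hT : IsRotationInvariant T) (hs : 0 < s) (ht : 0 < t)
    (hsub : spectrum ℂ T ⊆ closedAnnulus s t)
    (hmem : ∀ r ∈ Ioo (min s t) (max s t), ∃ l ∈ spectrum ℂ T, ‖l‖ = r) :
    closedAnnulus s t ⊆ spectrum ℂ T := by
  intro l hl
  rcases (min_le_max : min s t ≤ max s t).eq_or_lt with heq | hlt
  · obtain ⟨l', hl'⟩ := spectrum.nonempty T
    exact hT.mem_spectrum (le_antisymm (hl.2.trans (heq ▸ (hsub hl').1))
      ((hsub hl').2.trans (heq ▸ hl.1))) hl'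
  · have hclosed : IsClosed {r : ℝ | (r : ℂ) ∈ spectrum ℂ T} :=
      (spectrum.isClosed T).preimage Complex.continuous_ofReal
    have hopen : Ioo (min s t) (max s t) ⊆ {r : ℝ | (r : ℂ) ∈ spectrum ℂ T} := by
      intro r hr
      obtain ⟨l', hl', hnorm⟩ := hmem r hr
      refine hT.mem_spectrum ?_ hl'
      rw [hnorm, Complex.norm_real, Real.norm_of_nonneg ((lt_min hs ht).trans hr.1).le]
    have hIcc : Icc (min s t) (max s t) ⊆ {r : ℝ | (r : ℂ) ∈ spectrum ℂ T} :=
      closure_Ioo hlt.ne ▸ hclosed.closure_subset_iff.2 hopen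
    exact hT.mem_spectrum (by simp) (hIcc hl)

theorem IsRotationInvariant.hasAnnularSpectrum [Nontrivial E] (hT : IsRotationInvariant T)
    (hs : 0 < s) (ht : 0 < t) (hsub : spectrum ℂ T ⊆ closedAnnulus s t)
    (heig : ∀ r ∈ Ioo (min s t) (max s t), ∃ l : ℂ, ‖l‖ = r ∧
      (Module.End.HasEigenvalue (T : E →ₗ[ℂ] E) l ∨
        Module.End.HasEigenvalue (ContinuousLinearMap.adjoint T : E →ₗ[ℂ] E) l)) :
    HasAnnularSpectrum T s t := by
  refine ⟨hsub.antisymm (hT.closedAnnulus_subset_spectrum hs ht hsub fun r hr => ?_),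
    fun l hl => ?_⟩
  · obtain ⟨l, hlr, hl | hl⟩ := heig r hr
    · exact ⟨l, mem_spectrum_of_hasEigenvalue hl, hlr⟩
    · exact ⟨star l, star_mem_spectrum_of_hasEigenvalue_adjoint hl, by rw [norm_star, hlr]⟩
  · obtain ⟨l', hl', h | h⟩ := heig ‖l‖ (interior_closedAnnulus_subset hs ht hl)
    · exact Or.inl (hT.hasEigenvalue hl'.symm h)
    · exact Or.inr (hT.adjoint.hasEigenvalue hl'.symm h)

end AnnularSpectrum

section Cocycle

variable {X : Type*} {Ω : Set X} {φ : X → X} {W ℓ : X → ℝ} {τ M μ : ℝ}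

/-- The function `ℓ` increases by `τ` along orbits, so an orbit spends a bounded time in the region
where `W` exceeds `μ`, and a monotone `k` that increases by `τ` in this region measures it. -/
theorem exists_prod_iterate_le (hφ : MapsTo φ Ω Ω) (hℓ : ∀ z ∈ Ω, ℓ (φ z) = ℓ z + τ)
    (hτ : 0 < τ) (hμ : 0 < μ) (hW : ∀ z, 0 ≤ W z) (hWM : ∀ z ∈ Ω, W z ≤ M) :
    ∃ c : ℝ, 0 ≤ c ∧ ∀ k : ℝ → ℝ, Monotone k →
      (∀ z ∈ Ω, W z ≤ μ ∨ k (ℓ z + τ) = k (ℓ z) + τ) → ∀ (n : ℕ), ∀ z ∈ Ω,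
      ∏ j ∈ Finset.range n, W (φ^[j] z) ≤ μ ^ n * Real.exp (c * (k (ℓ (φ^[n] z)) - k (ℓ z))) := by
  set c := Real.log (max M μ / μ) / τ with hc
  have hratio : 1 ≤ max M μ / μ := (one_le_div hμ).2 (le_max_right _ _)
  have hc0 : 0 ≤ c := div_nonneg (Real.log_nonneg hratio) hτ.le
  have hcM : M ≤ μ * Real.exp (c * τ) := by
    rw [hc, div_mul_cancel₀ _ hτ.ne', Real.exp_log (by linarith), mul_div_cancel₀ _ hμ.ne']
    exact le_max_left _ _
  refine ⟨c, hc0, fun k hk hkW n => ?_⟩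
  have hstep : ∀ z ∈ Ω, W z ≤ μ * Real.exp (c * (k (ℓ (φ z)) - k (ℓ z))) := by
    intro z hz
    rw [hℓ z hz]
    rcases hkW z hz with hWμ | hkτ
    · refine hWμ.trans (le_mul_of_one_le_right hμ.le (Real.one_le_exp (mul_nonneg hc0 ?_)))
      exact sub_nonneg.2 (hk (le_add_of_nonneg_right hτ.le))
    · rw [hkτ, add_sub_cancel_left]
      exact (hWM z hz).trans hcM
  induction n with
  | zero => simp
  | succ n ih =>
    intro z hz
    rw [Finset.prod_range_succ']
    simp only [Function.iterate_succ_apply, Function.iterate_zero, id_eq]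
    calc (∏ j ∈ Finset.range n, W (φ^[j] (φ z))) * W z
        ≤ (μ ^ n * Real.exp (c * (k (ℓ (φ^[n] (φ z))) - k (ℓ (φ z))))) *
          (μ * Real.exp (c * (k (ℓ (φ z)) - k (ℓ z)))) :=
          mul_le_mul (ih (φ z) (hφ hz)) (hstep z hz) (hW z) (by positivity)
      _ = μ ^ (n + 1) * Real.exp (c * (k (ℓ (φ^[n] (φ z))) - k (ℓ z))) := by
          rw [mul_mul_mul_comm, ← pow_succ, ← Real.exp_add]
          ring_nf

end Cocycle

section WeightedComposition

variable {N : ℕ} {p : ℝ} {H : Type*} [NormedAddCommGroup H] [InnerProductSpace ℂ H]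
  {ev : H →ₗ[ℂ] (CN N → ℂ)}

/-- `T` is the weighted composition operator `f ↦ w · (f ∘ φ)` on a space whose elements are
evaluated by `ev`. -/
def IsWeightedComp (ev : H →ₗ[ℂ] (CN N → ℂ)) (w : CN N → ℂ) (φ : CN N → CN N)
    (T : H →L[ℂ] H) : Prop :=
  ∀ f, ∀ z ∈ ball (0 : CN N) 1, ev (T f) z = w z * ev f (φ z)

namespace IsBallSpace

theorem exists_isWeightedComp (hH : IsBallSpace N p ev) {w : CN N → ℂ} {φ : CN N → CN N} {C : ℝ}
    (h : ∀ f, ∃ g, (∀ z ∈ ball (0 : CN N) 1, ev g z = w z * ev f (φ z)) ∧ ‖g‖ ≤ C * ‖f‖) :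
    ∃ T : H →L[ℂ] H, IsWeightedComp ev w φ T ∧ ∀ f, ‖T f‖ ≤ C * ‖f‖ := by
  choose t ht hbound using h
  let L : H →ₗ[ℂ] H :=
    { toFun := t
      map_add' := fun f g => hH.ext fun z hz => by
        rw [ht _ z hz, map_add, map_add, Pi.add_apply, Pi.add_apply, ht _ z hz, ht _ z hz, mul_add]
      map_smul' := fun a f => hH.ext fun z hz => by
        rw [ht _ z hz, RingHom.id_apply, map_smul, map_smul, Pi.smul_apply, Pi.smul_apply,
          ht _ z hz, smul_eq_mul, smul_eq_mul, mul_left_comm] }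
  exact ⟨L.mkContinuous C hbound, ht, hbound⟩

theorem exists_multiplication (hH : IsBallSpace N p ev) {w : CN N → ℂ} {M : ℝ}
    (hw : DifferentiableOn ℂ w (ball 0 1)) (hM : ∀ z ∈ ball (0 : CN N) 1, ‖w z‖ ≤ M) :
    ∃ T : H →L[ℂ] H, IsWeightedComp ev w id T :=
  (hH.exists_isWeightedComp fun f => hH.exists_mul w M hw hM f).imp fun _ => And.left

theorem exists_contraction_ballAut (hH : IsBallSpace N p ev) {c : CN N} (hc : ‖c‖ < 1)
    (V : CN N ≃ₗᵢ[ℂ] CN N) :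
    ∃ U : H →L[ℂ] H, IsWeightedComp ev (fun z => moebiusWeight p c (V z)) (ballAut c V) U ∧
      ∀ f, ‖U f‖ ≤ ‖f‖ := by
  suffices hU : ∃ U : H →L[ℂ] H, IsWeightedComp ev (fun z => moebiusWeight p c (V z))
      (ballAut c V) U ∧ ∀ f, ‖U f‖ ≤ 1 * ‖f‖ by simpa only [one_mul] using hU
  refine hH.exists_isWeightedComp fun f => ?_
  obtain ⟨g, hg, hgf⟩ := hH.exists_moebius c hc f
  obtain ⟨k, hk, hkg⟩ := hH.exists_isometry V g
  refine ⟨k, fun z hz => ?_, by rw [one_mul]; exact hkg.trans hgf⟩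
  rw [hk z hz, hg (V z) (by simpa using hz), ballAut]

end IsBallSpace

theorem differentiableOn_iterate {φ : CN N → CN N} {Ω : Set (CN N)} (hφ : MapsTo φ Ω Ω)
    (hφd : DifferentiableOn ℂ φ Ω) (n : ℕ) : DifferentiableOn ℂ (φ^[n]) Ω := by
  induction n with
  | zero => exact differentiableOn_id
  | succ n ih => exact ih.comp hφd hφ

theorem differentiableOn_prod_iterate {φ : CN N → CN N} {W : CN N → ℂ} {Ω : Set (CN N)}
    (hφ : MapsTo φ Ω Ω) (hφd : DifferentiableOn ℂ φ Ω) (hW : DifferentiableOn ℂ W Ω) (n : ℕ) :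
    DifferentiableOn ℂ (fun z => ∏ j ∈ Finset.range n, W (φ^[j] z)) Ω := by
  induction n with
  | zero => simp
  | succ n ih =>
    simp only [Finset.prod_range_succ]
    exact ih.mul (hW.comp (differentiableOn_iterate hφ hφd n) (hφ.iterate n))

theorem leftInvOn_iterate {X : Type*} {φ χ : X → X} {Ω : Set X} (hφ : MapsTo φ Ω Ω)
    (h : LeftInvOn χ φ Ω) (n : ℕ) : LeftInvOn (χ^[n]) (φ^[n]) Ω := by
  induction n with
  | zero => exact fun _ _ => rfl
  | succ n ih =>
    intro z hz
    rw [Function.iterate_succ_apply, Function.iterate_succ_apply', h (hφ.iterate n hz), ih hz]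

/-- A factorization of `T` as multiplication by the bounded holomorphic function `W` after a
contractive weighted composition operator `U` with symbol `φ` and weight `k`. -/
structure IsContractiveFactorization (ev : H →ₗ[ℂ] (CN N → ℂ)) (φ : CN N → CN N)
    (k W : CN N → ℂ) (U T : H →L[ℂ] H) : Prop where
  mapsTo : MapsTo φ (ball 0 1) (ball 0 1)
  differentiableOn_symbol : DifferentiableOn ℂ φ (ball 0 1)
  isWeightedComp : IsWeightedComp ev k φ U
  norm_apply_le : ∀ f, ‖U f‖ ≤ ‖f‖
  differentiableOn_weight : DifferentiableOn ℂ W (ball 0 1)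
  exists_norm_weight_le : ∃ M, ∀ z ∈ ball (0 : CN N) 1, ‖W z‖ ≤ M
  ev_apply : ∀ f, ∀ z ∈ ball (0 : CN N) 1, ev (T f) z = W z * ev (U f) z

namespace IsContractiveFactorization

variable {W k : CN N → ℂ} {φ χ : CN N → CN N} {T U : H →L[ℂ] H} {ℓ : CN N → ℝ} {τ μ r : ℝ}

theorem norm_pow_apply_le (hT : IsContractiveFactorization ev φ k W U T) (n : ℕ) (f : H) :
    ‖(U ^ n) f‖ ≤ ‖f‖ := by
  induction n with
  | zero => simp
  | succ n ih =>
    rw [pow_succ', mul_apply_eq_comp]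
    exact (hT.norm_apply_le _).trans ih

theorem ev_pow_eq_prod (hT : IsContractiveFactorization ev φ k W U T) (n : ℕ) (f : H) :
    ∀ z ∈ ball (0 : CN N) 1,
      ev ((T ^ n) f) z = (∏ j ∈ Finset.range n, W (φ^[j] z)) * ev ((U ^ n) f) z := by
  induction n with
  | zero => simp
  | succ n ih =>
    intro z hz
    rw [pow_succ', pow_succ', Finset.prod_range_succ', mul_apply_eq_comp, mul_apply_eq_comp,
      hT.ev_apply _ z hz, hT.isWeightedComp _ z hz, hT.isWeightedComp _ z hz,
      ih _ (hT.mapsTo hz)]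
    simp only [Function.iterate_succ_apply, Function.iterate_zero, id_eq]
    ring

theorem ev_pow_mul (hT : IsContractiveFactorization ev φ k W U T) {q f : H} {m : CN N → ℂ}
    (hq : ∀ z ∈ ball (0 : CN N) 1, ev q z = m z * ev f z) (n : ℕ) :
    ∀ z ∈ ball (0 : CN N) 1, ev ((U ^ n) q) z = m (φ^[n] z) * ev ((U ^ n) f) z := by
  induction n with
  | zero => simpa using hq
  | succ n ih =>
    intro z hz
    rw [pow_succ', mul_apply_eq_comp, mul_apply_eq_comp, hT.isWeightedComp _ z hz,
      hT.isWeightedComp _ z hz, ih _ (hT.mapsTo hz), Function.iterate_succ_apply, mul_left_comm]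

theorem exists_norm_prod_le (hT : IsContractiveFactorization ev φ k W U T)
    (hℓ : ∀ z ∈ ball (0 : CN N) 1, ℓ (φ z) = ℓ z + τ) (hτ : 0 < τ) (hμ : 0 < μ) :
    ∃ c : ℝ, 0 ≤ c ∧ ∀ k : ℝ → ℝ, Monotone k →
      (∀ z ∈ ball (0 : CN N) 1, ‖W z‖ ≤ μ ∨ k (ℓ z + τ) = k (ℓ z) + τ) →
      ∀ (n : ℕ), ∀ z ∈ ball (0 : CN N) 1, ‖∏ j ∈ Finset.range n, W (φ^[j] z)‖ ≤
        μ ^ n * Real.exp (c * (k (ℓ (φ^[n] z)) - k (ℓ z))) := by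
  obtain ⟨M, hM⟩ := hT.exists_norm_weight_le
  simp_rw [norm_prod]
  exact exists_prod_iterate_le hT.mapsTo hℓ hτ hμ (fun z => norm_nonneg (W z)) hM

theorem norm_pow_le_of_norm_prod_le (hT : IsContractiveFactorization ev φ k W U T)
    (hH : IsBallSpace N p ev) {n : ℕ} {D : ℝ}
    (hD : ∀ z ∈ ball (0 : CN N) 1, ‖∏ j ∈ Finset.range n, W (φ^[j] z)‖ ≤ D) :
    ‖T ^ n‖ ≤ D := by
  have hD0 : 0 ≤ D := (norm_nonneg _).trans (hD 0 (mem_ball_self one_pos))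
  refine ContinuousLinearMap.opNorm_le_bound _ hD0 fun f => ?_
  obtain ⟨g, hg, hgn⟩ := hH.exists_mul _ _
    (differentiableOn_prod_iterate hT.mapsTo hT.differentiableOn_symbol
      hT.differentiableOn_weight n) hD ((U ^ n) f)
  have hTg : (T ^ n) f = g := hH.ext fun z hz => by rw [hg z hz, hT.ev_pow_eq_prod n f z hz]
  rw [hTg]
  exact hgn.trans (mul_le_mul_of_nonneg_left (hT.norm_pow_apply_le n f) hD0)

/-- If `W` is at most `μ` near both ends of the orbits, then `Tⁿ` grows at most like `μⁿ`. -/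
theorem exists_norm_pow_le (hT : IsContractiveFactorization ev φ k W U T)
    (hH : IsBallSpace N p ev) (hℓ : ∀ z ∈ ball (0 : CN N) 1, ℓ (φ z) = ℓ z + τ) (hτ : 0 < τ)
    (hμ : 0 < μ) (hr : 0 ≤ r) (hW : ∀ z ∈ ball (0 : CN N) 1, r ≤ |ℓ z| → ‖W z‖ ≤ μ) :
    ∃ C : ℝ, ∀ n : ℕ, ‖T ^ n‖ ≤ C * μ ^ n := by
  obtain ⟨c, hc, hprod⟩ := hT.exists_norm_prod_le hℓ hτ hμ
  let clamp : ℝ → ℝ := fun x => max (-r) (min x (r + τ))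
  have hmono : Monotone clamp := fun x y hxy => max_le_max le_rfl (min_le_min hxy le_rfl)
  have hclamp : ∀ z ∈ ball (0 : CN N) 1, ‖W z‖ ≤ μ ∨ clamp (ℓ z + τ) = clamp (ℓ z) + τ := by
    intro z hz
    refine (le_or_gt r |ℓ z|).imp (hW z hz) fun hlt => ?_
    obtain ⟨hlower, hupper⟩ := abs_lt.1 hlt
    simp only [clamp]
    rw [min_eq_left (by linarith), min_eq_left (by linarith), max_eq_right (by linarith),
      max_eq_right (by linarith)]
  refine ⟨Real.exp (c * (2 * r + τ)), fun n => hT.norm_pow_le_of_norm_prod_le hH fun z hz => ?_⟩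
  refine (hprod clamp hmono hclamp n z hz).trans ?_
  rw [mul_comm]
  gcongr
  have hupper : clamp (ℓ (φ^[n] z)) ≤ r + τ := max_le (by linarith) (min_le_right _ _)
  have hlower : -r ≤ clamp (ℓ z) := le_max_left _ _
  linarith

theorem norm_pow_apply_le_of_norm_prod_mul_le (hT : IsContractiveFactorization ev φ k W U T)
    (hH : IsBallSpace N p ev) (hχ : MapsTo χ (ball 0 1) (ball 0 1))
    (hχd : DifferentiableOn ℂ χ (ball 0 1)) (hχφ : LeftInvOn χ φ (ball 0 1))
    (hφχ : LeftInvOn φ χ (ball 0 1)) {e f : H} (he : ∀ z ∈ ball (0 : CN N) 1, ev e z = 1)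
    {n : ℕ} {D : ℝ} (hD : ∀ z ∈ ball (0 : CN N) 1,
      ‖∏ j ∈ Finset.range n, W (φ^[j] z)‖ * ‖ev f (φ^[n] z)‖ ≤ D) :
    ‖(T ^ n) f‖ ≤ D * ‖e‖ := by
  set m : CN N → ℂ := fun z => ∏ j ∈ Finset.range n, W (φ^[j] (χ^[n] z)) with hm
  have hmd : DifferentiableOn ℂ m (ball 0 1) :=
    (differentiableOn_prod_iterate hT.mapsTo hT.differentiableOn_symbol
      hT.differentiableOn_weight n).comp (differentiableOn_iterate hχ hχd n) (hχ.iterate n)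
  have hmD : ∀ z ∈ ball (0 : CN N) 1, ‖m z * ev f z‖ ≤ D := by
    intro z hz
    have hDz := hD _ (hχ.iterate n hz)
    rwa [leftInvOn_iterate hχ hφχ n hz, ← norm_mul] at hDz
  obtain ⟨q, hq, hqn⟩ := hH.exists_mul _ _ (hmd.mul (hH.differentiableOn f)) hmD e
  have hqf : ∀ z ∈ ball (0 : CN N) 1, ev q z = m z * ev f z := fun z hz => by
    rw [hq z hz, he z hz, mul_one, Pi.mul_apply]
  have hTq : (T ^ n) f = (U ^ n) q := hH.ext fun z hz => by
    rw [hT.ev_pow_eq_prod n f z hz, hT.ev_pow_mul hqf n z hz, hm]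
    simp only [leftInvOn_iterate hT.mapsTo hχφ n hz]
  rw [hTq]
  exact (hT.norm_pow_apply_le n q).trans hqn

/-- The decay of `f` where `ℓ` is large makes up for a bound on `W` only where `ℓ` is small. -/
theorem exists_norm_pow_apply_le (hT : IsContractiveFactorization ev φ k W U T)
    (hH : IsBallSpace N p ev) (hχ : MapsTo χ (ball 0 1) (ball 0 1))
    (hχd : DifferentiableOn ℂ χ (ball 0 1)) (hχφ : LeftInvOn χ φ (ball 0 1))
    (hφχ : LeftInvOn φ χ (ball 0 1)) (hℓ : ∀ z ∈ ball (0 : CN N) 1, ℓ (φ z) = ℓ z + τ)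
    (hτ : 0 < τ) (hμ : 0 < μ) (hr : 0 ≤ r)
    (hW : ∀ z ∈ ball (0 : CN N) 1, ℓ z ≤ -r → ‖W z‖ ≤ μ) :
    ∃ c : ℝ, ∀ (f : H) (B : ℝ),
      (∀ z ∈ ball (0 : CN N) 1, ‖ev f z‖ * Real.exp (c * max (ℓ z) 0) ≤ B) →
      ∃ C : ℝ, ∀ n : ℕ, ‖(T ^ n) f‖ ≤ C * μ ^ n := by
  obtain ⟨c, hc, hprod⟩ := hT.exists_norm_prod_le hℓ hτ hμ
  have hclamp : ∀ z ∈ ball (0 : CN N) 1,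
      ‖W z‖ ≤ μ ∨ max (-r) (ℓ z + τ) = max (-r) (ℓ z) + τ := by
    refine fun z hz => (le_or_gt (ℓ z) (-r)).imp (hW z hz) fun hlt => ?_
    rw [max_eq_right (by linarith), max_eq_right (by linarith)]
  obtain ⟨e, he⟩ := hH.exists_one
  refine ⟨c, fun f B hB => ⟨Real.exp (c * r) * B * ‖e‖, fun n => ?_⟩⟩
  rw [mul_right_comm]
  refine hT.norm_pow_apply_le_of_norm_prod_mul_le hH hχ hχd hχφ hφχ he fun z hz => ?_
  have hexp : Real.exp (c * (max (-r) (ℓ (φ^[n] z)) - max (-r) (ℓ z))) ≤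
      Real.exp (c * r) * Real.exp (c * max (ℓ (φ^[n] z)) 0) := by
    rw [← Real.exp_add, ← mul_add]
    gcongr
    have hlower : -r ≤ max (-r) (ℓ z) := le_max_left _ _
    have hupper : max (-r) (ℓ (φ^[n] z)) ≤ max (ℓ (φ^[n] z)) 0 :=
      max_le (by linarith [le_max_right (ℓ (φ^[n] z)) 0]) (le_max_left _ _)
    linarith
  calc ‖∏ j ∈ Finset.range n, W (φ^[j] z)‖ * ‖ev f (φ^[n] z)‖
      ≤ (μ ^ n * (Real.exp (c * r) * Real.exp (c * max (ℓ (φ^[n] z)) 0))) *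
          ‖ev f (φ^[n] z)‖ := by
        gcongr
        refine (hprod _ (fun x y hxy => max_le_max le_rfl hxy) hclamp n z hz).trans ?_
        gcongr
    _ = Real.exp (c * r) * (‖ev f (φ^[n] z)‖ * Real.exp (c * max (ℓ (φ^[n] z)) 0)) * μ ^ n := by
        ring
    _ ≤ Real.exp (c * r) * B * μ ^ n := by
        gcongr
        exact hB _ (hT.mapsTo.iterate n hz)

/-- The orbit of `0` sees only the values of `W` where `ℓ` is large. -/
theorem exists_norm_ev_pow_le (hT : IsContractiveFactorization ev φ k W U T)
    (hH : IsBallSpace N p ev) (hℓ : ∀ z ∈ ball (0 : CN N) 1, ℓ (φ z) = ℓ z + τ) (hτ : 0 < τ)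
    (hμ : 0 < μ) (hW : ∀ z ∈ ball (0 : CN N) 1, r ≤ ℓ z → ‖W z‖ ≤ μ) :
    ∃ C : ℝ, 0 ≤ C ∧ ∀ (n : ℕ) (f : H), ‖ev ((T ^ n) f) 0‖ ≤ C * μ ^ n * ‖f‖ := by
  have hzero : (0 : CN N) ∈ ball (0 : CN N) 1 := mem_ball_self one_pos
  obtain ⟨c, hc, hprod⟩ := hT.exists_norm_prod_le hℓ hτ hμ
  have hclamp : ∀ z ∈ ball (0 : CN N) 1,
      ‖W z‖ ≤ μ ∨ min (ℓ z + τ) (r + τ) = min (ℓ z) (r + τ) + τ := by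
    refine fun z hz => (le_or_gt r (ℓ z)).imp (hW z hz) fun hlt => ?_
    rw [min_eq_left (by linarith), min_eq_left (by linarith)]
  refine ⟨Real.exp (c * (r + τ - min (ℓ 0) (r + τ))), by positivity, fun n f => ?_⟩
  rw [hT.ev_pow_eq_prod n f 0 hzero, norm_mul]
  refine mul_le_mul ?_ ((hH.norm_apply_zero_le _).trans (hT.norm_pow_apply_le n f))
    (norm_nonneg _) (by positivity)
  rw [mul_comm]
  refine (hprod _ (fun x y hxy => min_le_min hxy le_rfl) hclamp n 0 hzero).trans ?_
  gcongr
  exact min_le_right _ _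

end IsContractiveFactorization

end WeightedComposition

section HalfPlane

theorem norm_mul_norm_lt_one_of_mem_ball {E : Type*} [SeminormedAddCommGroup E] {a z : E}
    (ha : ‖a‖ = 1) (hz : z ∈ ball (0 : E) 1) : ‖a‖ * ‖z‖ < 1 := by
  rw [ha, one_mul]
  exact mem_ball_zero_iff.1 hz

variable {E : Type*} [NormedAddCommGroup E] [InnerProductSpace ℂ E] {a b z : E}

theorem one_sub_inner_ne_zero_of_mem_ball (ha : ‖a‖ = 1) (hz : z ∈ ball (0 : E) 1) :
    (1 - inner ℂ a z : ℂ) ≠ 0 :=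
  one_sub_inner_ne_zero (norm_mul_norm_lt_one_of_mem_ball ha hz)

theorem norm_one_sub_inner_le_two (ha : ‖a‖ ≤ 1) (hz : ‖z‖ ≤ 1) :
    ‖(1 - inner ℂ a z : ℂ)‖ ≤ 2 :=
  calc ‖(1 - inner ℂ a z : ℂ)‖ ≤ ‖(1 : ℂ)‖ + ‖(inner ℂ a z : ℂ)‖ := norm_sub_le _ _
    _ ≤ 1 + 1 := by
        gcongr
        · exact norm_one.le
        · exact (norm_inner_le_norm a z).trans (mul_le_one₀ ha (norm_nonneg _) hz)
    _ = 2 := one_add_one_eq_two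

theorem halfPlane_zero (a b : E) : halfPlane a b 0 = 1 := by
  simp [halfPlane]

theorem halfPlane_ne_zero (ha : ‖a‖ = 1) (hb : ‖b‖ = 1) (hz : z ∈ ball (0 : E) 1) :
    halfPlane a b z ≠ 0 :=
  div_ne_zero (one_sub_inner_ne_zero_of_mem_ball hb hz) (one_sub_inner_ne_zero_of_mem_ball ha hz)

theorem halfPlane_mem_slitPlane (ha : ‖a‖ = 1) (hb : ‖b‖ = 1) (hz : z ∈ ball (0 : E) 1) :
    halfPlane a b z ∈ Complex.slitPlane := by
  rw [Complex.mem_slitPlane_iff]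
  by_contra! hneg
  have hrea := re_one_sub_inner_pos (norm_mul_norm_lt_one_of_mem_ball ha hz)
  have hreb := re_one_sub_inner_pos (norm_mul_norm_lt_one_of_mem_ball hb hz)
  have hmul : halfPlane a b z * (1 - inner ℂ a z) = 1 - inner ℂ b z :=
    div_mul_cancel₀ _ (one_sub_inner_ne_zero_of_mem_ball ha hz)
  rw [← hmul, Complex.mul_re, hneg.2, zero_mul, sub_zero] at hreb
  nlinarith [hneg.1]

theorem differentiableOn_one_sub_inner (a : E) (s : Set E) :
    DifferentiableOn ℂ (fun z => (1 - inner ℂ a z : ℂ)) s :=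
  ((innerSL ℂ a).differentiable.const_sub 1).differentiableOn

theorem differentiableOn_halfPlane (ha : ‖a‖ = 1) :
    DifferentiableOn ℂ (halfPlane a b) (ball 0 1) :=
  ((differentiableOn_one_sub_inner b (ball 0 1)).mul
    ((differentiableOn_one_sub_inner a (ball 0 1)).fun_inv fun _ hz =>
      one_sub_inner_ne_zero_of_mem_ball ha hz)).congr fun _ _ => div_eq_mul_inv _ _

/-- The logarithm of the modulus of the half-plane coordinate. It serves as a Lyapunov function:
an automorphism that attracts to `a` and repels from `b` increases it by a constant. -/
noncomputable def height (a b z : E) : ℝ := Real.log ‖halfPlane a b z‖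

theorem height_swap (a b z : E) : height a b z = -height b a z := by
  rw [height, height, halfPlane, halfPlane, norm_div, norm_div, ← Real.log_inv, inv_div]

theorem exp_height (ha : ‖a‖ = 1) (hb : ‖b‖ = 1) (hz : z ∈ ball (0 : E) 1) :
    Real.exp (height a b z) = ‖(1 - inner ℂ b z : ℂ)‖ / ‖(1 - inner ℂ a z : ℂ)‖ := by
  rw [height, Real.exp_log (norm_pos_iff.2 (halfPlane_ne_zero ha hb hz)), halfPlane, norm_div]

theorem exp_height_le (ha : ‖a‖ = 1) (hb : ‖b‖ = 1) (hz : z ∈ ball (0 : E) 1) :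
    Real.exp (height a b z) ≤ 2 / ‖(1 - inner ℂ a z : ℂ)‖ := by
  rw [exp_height ha hb hz]
  gcongr
  exact norm_one_sub_inner_le_two hb.le (mem_ball_zero_iff.1 hz).le

theorem norm_sub_sq_le (ha : ‖a‖ = 1) (hz : ‖z‖ ≤ 1) :
    ‖z - a‖ ^ 2 ≤ 2 * ‖(1 - inner ℂ a z : ℂ)‖ := by
  have hre : RCLike.re (inner ℂ z a : ℂ) = (inner ℂ a z : ℂ).re := by
    rw [← inner_conj_symm]
    exact Complex.conj_re _
  have hle : 1 - (inner ℂ a z : ℂ).re ≤ ‖(1 - inner ℂ a z : ℂ)‖ := by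
    simpa using Complex.re_le_norm (1 - inner ℂ a z : ℂ)
  rw [norm_sub_sq (𝕜 := ℂ), ha, hre]
  nlinarith [norm_nonneg z]

theorem exists_dist_lt_of_le_height (ha : ‖a‖ = 1) (hb : ‖b‖ = 1) {δ : ℝ} (hδ : 0 < δ) :
    ∃ r : ℝ, 0 ≤ r ∧ ∀ z ∈ ball (0 : E) 1, r ≤ height a b z → dist z a < δ := by
  refine ⟨max 0 (Real.log (8 / δ ^ 2)), le_max_left _ _, fun z hz hr => ?_⟩
  have hpos := norm_pos_iff.2 (one_sub_inner_ne_zero_of_mem_ball ha hz)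
  have hexp : 8 / δ ^ 2 ≤ 2 / ‖(1 - inner ℂ a z : ℂ)‖ :=
    ((Real.log_le_iff_le_exp (by positivity)).1 ((le_max_right _ _).trans hr)).trans
      (exp_height_le ha hb hz)
  rw [div_le_div_iff₀ (by positivity) hpos] at hexp
  rw [dist_eq_norm]
  refine lt_of_pow_lt_pow_left₀ 2 hδ.le ?_
  nlinarith [norm_sub_sq_le ha (mem_ball_zero_iff.1 hz).le, pow_pos hδ 2]

theorem exists_norm_le_of_le_height {F : Type*} [SeminormedAddCommGroup F] {W : E → F} {s μ : ℝ}
    (ha : ‖a‖ = 1) (hb : ‖b‖ = 1) (hW : Tendsto (fun z => ‖W z‖) (𝓝[ball 0 1] a) (𝓝 s))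
    (hμ : s < μ) :
    ∃ r, 0 ≤ r ∧ ∀ z ∈ ball (0 : E) 1, r ≤ height a b z → ‖W z‖ ≤ μ := by
  obtain ⟨δ, hδ, hball⟩ := Metric.mem_nhdsWithin_iff.1 (hW.eventually_lt_const hμ)
  obtain ⟨r, hr, hheight⟩ := exists_dist_lt_of_le_height ha hb hδ
  exact ⟨r, hr, fun z hz hzr => le_of_lt (hball ⟨hheight z hz hzr, hz⟩)⟩

theorem exp_mul_max_height_le (ha : ‖a‖ = 1) (hb : ‖b‖ = 1) (hz : z ∈ ball (0 : E) 1) {c : ℝ}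
    {m : ℕ} (hm : c ≤ m) :
    Real.exp (c * max (height a b z) 0) ≤ (2 / ‖(1 - inner ℂ a z : ℂ)‖) ^ m := by
  have hpos := norm_pos_iff.2 (one_sub_inner_ne_zero_of_mem_ball ha hz)
  have hone : Real.exp 0 ≤ 2 / ‖(1 - inner ℂ a z : ℂ)‖ := by
    rw [Real.exp_zero, one_le_div hpos]
    exact norm_one_sub_inner_le_two ha.le (mem_ball_zero_iff.1 hz).le
  have hmax : Real.exp (max (height a b z) 0) ≤ 2 / ‖(1 - inner ℂ a z : ℂ)‖ := by
    rcases max_cases (height a b z) 0 with h | h <;> rw [h.1]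
    exacts [exp_height_le ha hb hz, hone]
  calc Real.exp (c * max (height a b z) 0) ≤ Real.exp (m * max (height a b z) 0) := by
        gcongr
    _ = Real.exp (max (height a b z) 0) ^ m := Real.exp_nat_mul _ _
    _ ≤ _ := by gcongr

theorem nhdsWithin_ball_neBot (ha : ‖a‖ = 1) : (𝓝[ball (0 : E) 1] a).NeBot := by
  rw [← mem_closure_iff_nhdsWithin_neBot, closure_ball _ one_ne_zero, mem_closedBall_zero_iff]
  exact ha.le

end HalfPlane

section ImaginaryPower

variable {E : Type*} [NormedAddCommGroup E] [InnerProductSpace ℂ E] {a b z w : E}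

/-- The bounded holomorphic function `h ^ (i t)`, where `h` is the half-plane coordinate. -/
noncomputable def halfPlanePow (a b : E) (t : ℝ) (z : E) : ℂ :=
  Complex.exp (Complex.I * t * Complex.log (halfPlane a b z))

theorem differentiableOn_halfPlanePow (ha : ‖a‖ = 1) (hb : ‖b‖ = 1) (t : ℝ) :
    DifferentiableOn ℂ (halfPlanePow a b t) (ball 0 1) :=
  (((differentiableOn_halfPlane ha).clog fun _ hz =>
    halfPlane_mem_slitPlane ha hb hz).const_mul _).cexp

theorem norm_halfPlanePow_le (a b : E) (t : ℝ) (z : E) :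
    ‖halfPlanePow a b t z‖ ≤ Real.exp (|t| * Real.pi) := by
  have hre : (Complex.I * t * Complex.log (halfPlane a b z)).re =
      -(t * (halfPlane a b z).arg) := by
    simp [Complex.log_im]
  rw [halfPlanePow, Complex.norm_exp, hre]
  gcongr
  calc -(t * (halfPlane a b z).arg) ≤ |t * (halfPlane a b z).arg| := neg_le_abs _
    _ = |t| * |(halfPlane a b z).arg| := abs_mul _ _
    _ ≤ |t| * Real.pi := by
        gcongr
        exact Complex.abs_arg_le_pi _

theorem halfPlanePow_mul_neg (a b : E) (t : ℝ) (z : E) :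
    halfPlanePow a b t z * halfPlanePow a b (-t) z = 1 := by
  rw [halfPlanePow, halfPlanePow, ← Complex.exp_add, ← Complex.exp_zero]
  congr 1
  push_cast
  ring

theorem halfPlanePow_eq_mul {κ : ℝ} (ha : ‖a‖ = 1) (hb : ‖b‖ = 1) (hκ : 0 < κ)
    (hz : z ∈ ball (0 : E) 1) (hw : halfPlane a b w = κ * halfPlane a b z) (t : ℝ) :
    halfPlanePow a b t w = Complex.exp ((t * Real.log κ : ℝ) * Complex.I) *
      halfPlanePow a b t z := by
  rw [halfPlanePow, halfPlanePow, hw, Complex.log_ofReal_mul hκ (halfPlane_ne_zero ha hb hz),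
    ← Complex.exp_add, mul_add]
  push_cast
  ring_nf

end ImaginaryPower

section Hyperbolic

variable {N : ℕ} {φ : CN N → CN N} {a b : CN N} {κ : ℝ}

/-- `φ` restricts to a hyperbolic automorphism of the ball with attracting fixed point `a` and
repelling fixed point `b` on the sphere, and with dilation factor `κ` at `b`. -/
structure IsHyperbolicAut (φ : CN N → CN N) (a b : CN N) (κ : ℝ) : Prop where
  norm_attracting : ‖a‖ = 1
  norm_repelling : ‖b‖ = 1
  ne : a ≠ b
  one_lt : 1 < κ
  exists_eqOn_ballAut : ∃ (c : CN N) (V : CN N ≃ₗᵢ[ℂ] CN N), ‖c‖ < 1 ∧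
    EqOn φ (ballAut c V) (ball 0 1) ∧ ballAut c V a = a ∧ ballAut c V b = b ∧ dilation c V b = κ

theorem mapsTo_ballAut {c : CN N} (V : CN N ≃ₗᵢ[ℂ] CN N) (hc : ‖c‖ < 1) :
    MapsTo (ballAut c V) (ball 0 1) (ball 0 1) := fun z hz =>
  mapsTo_moebius hc (by simpa using hz)

namespace IsHyperbolicAut

theorem pos (hφ : IsHyperbolicAut φ a b κ) : 0 < κ :=
  one_pos.trans hφ.one_lt

theorem mapsTo (hφ : IsHyperbolicAut φ a b κ) : MapsTo φ (ball 0 1) (ball 0 1) := by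
  obtain ⟨c, V, hc, hφV, -⟩ := hφ.exists_eqOn_ballAut
  exact (mapsTo_ballAut V hc).congr hφV.symm

theorem halfPlane_apply (hφ : IsHyperbolicAut φ a b κ) :
    ∀ z ∈ ball (0 : CN N) 1, halfPlane a b (φ z) = κ * halfPlane a b z := by
  obtain ⟨c, V, hc, hφV, hfa, hfb, rfl⟩ := hφ.exists_eqOn_ballAut
  intro z hz
  rw [hφV hz]
  exact halfPlane_ballAut V hc hφ.norm_attracting hφ.norm_repelling hφ.ne hfa hfb
    (mem_ball_zero_iff.1 hz)

theorem height_apply (hφ : IsHyperbolicAut φ a b κ) :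
    ∀ z ∈ ball (0 : CN N) 1, height a b (φ z) = height a b z + Real.log κ := by
  intro z hz
  have hne := norm_ne_zero_iff.2 (halfPlane_ne_zero hφ.norm_attracting hφ.norm_repelling hz)
  rw [height, hφ.halfPlane_apply z hz, norm_mul, Complex.norm_real,
    Real.norm_of_nonneg hφ.pos.le, Real.log_mul hφ.pos.ne' hne, height, add_comm]

end IsHyperbolicAut

end Hyperbolic

section WeightRatio

variable {N : ℕ} {p : ℝ} {c e : CN N}

theorem norm_moebiusWeight_eq_dilation (V : CN N ≃ₗᵢ[ℂ] CN N) (hc : ‖c‖ < 1) :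
    ‖moebiusWeight p c (V e)‖ = dilation c V e ^ (p / 2) := by
  have hs := defect_pos hc
  rw [norm_moebiusWeight hc, dilation, ← div_pow, ← Real.rpow_natCast _ 2,
    ← Real.rpow_mul (by positivity)]
  congr 1
  push_cast
  ring

theorem moebiusWeight_isometry_ne_zero (V : CN N ≃ₗᵢ[ℂ] CN N) (hc : ‖c‖ < 1) (he : ‖e‖ ≤ 1) :
    moebiusWeight p c (V e) ≠ 0 :=
  moebiusWeight_ne_zero hc (norm_mul_norm_lt_one hc (by rwa [V.norm_map]))

theorem differentiableAt_moebiusWeight_isometry (V : CN N ≃ₗᵢ[ℂ] CN N) (hc : ‖c‖ < 1)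
    (he : ‖e‖ ≤ 1) : DifferentiableAt ℂ (fun z => moebiusWeight p c (V z)) e :=
  (differentiableAt_moebiusWeight hc (norm_mul_norm_lt_one hc (by rwa [V.norm_map]))).comp e
    V.differentiableAt

theorem norm_div_moebiusWeight_le (hp : 0 ≤ p) (V : CN N ≃ₗᵢ[ℂ] CN N) (hc : ‖c‖ < 1)
    (he : ‖e‖ ≤ 1) {x : ℂ} {M : ℝ} (hx : ‖x‖ ≤ M) :
    ‖x / moebiusWeight p c (V e)‖ ≤ M / (defect c / 2) ^ p := by
  have hs := defect_pos hc
  have hM : 0 ≤ M := (norm_nonneg _).trans hx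
  have hpos := norm_pos_iff.2 (one_sub_inner_isometry_ne_zero V hc he)
  have htwo : ‖(1 - inner ℂ c (V e) : ℂ)‖ ≤ 2 :=
    norm_one_sub_inner_le_two hc.le (by rwa [V.norm_map])
  rw [norm_div, norm_moebiusWeight hc]
  gcongr

theorem tendsto_norm_div_moebiusWeight (V : CN N ≃ₗᵢ[ℂ] CN N) (hc : ‖c‖ < 1) (he : ‖e‖ ≤ 1)
    {ψ : CN N → ℂ} {s : Set (CN N)} {L : ℝ}
    (hψ : Tendsto (fun z => ‖ψ z‖) (𝓝[s] e) (𝓝 L)) :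
    Tendsto (fun z => ‖ψ z / moebiusWeight p c (V z)‖) (𝓝[s] e)
      (𝓝 (L / dilation c V e ^ (p / 2))) := by
  simp only [norm_div]
  rw [← norm_moebiusWeight_eq_dilation V hc]
  exact hψ.div ((differentiableAt_moebiusWeight_isometry V hc he).continuousAt.norm.mono_left
    nhdsWithin_le_nhds) (norm_ne_zero_iff.2 (moebiusWeight_isometry_ne_zero V hc he))

end WeightRatio

section OrbitGrowth

variable {N : ℕ} {p κ s t A B : ℝ} {H : Type*} [NormedAddCommGroup H] [InnerProductSpace ℂ H]
  {ev : H →ₗ[ℂ] (CN N → ℂ)} {φ χ : CN N → CN N} {a b : CN N} {ψ k W : CN N → ℂ}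
  {T U : H →L[ℂ] H}

/-- Exponential growth rates of a weighted composition operator `T` whose symbol attracts to the
boundary point `a`: the rate is at most `max s t` in general, at most `t` on functions that vanish
to a high order at `a`, and at most `s` for the values at the origin. -/
structure HasOrbitGrowth (ev : H →ₗ[ℂ] (CN N → ℂ)) (a : CN N) (s t : ℝ) (T : H →L[ℂ] H) :
    Prop where
  norm_pow : ∀ μ, max s t < μ → ∃ C : ℝ, ∀ n : ℕ, ‖T ^ n‖ ≤ C * μ ^ n
  norm_pow_apply : ∀ μ, t < μ → ∃ m : ℕ, ∀ (f : H) (D : ℝ),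
    (∀ z ∈ ball (0 : CN N) 1, ‖ev f z‖ ≤ D * ‖(1 - inner ℂ a z : ℂ)‖ ^ m) →
    ∃ C : ℝ, ∀ n : ℕ, ‖(T ^ n) f‖ ≤ C * μ ^ n
  norm_ev_pow : ∀ μ, s < μ → ∃ C : ℝ, 0 ≤ C ∧
    ∀ (n : ℕ) (f : H), ‖ev ((T ^ n) f) 0‖ ≤ C * μ ^ n * ‖f‖

namespace IsContractiveFactorization

theorem exists_norm_pow_apply_le_of_norm_ev_le (hT : IsContractiveFactorization ev φ k W U T)
    (hH : IsBallSpace N p ev) (hφ : IsHyperbolicAut φ a b κ) (hχ : MapsTo χ (ball 0 1) (ball 0 1))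
    (hχd : DifferentiableOn ℂ χ (ball 0 1)) (hinv : InvOn χ φ (ball 0 1) (ball 0 1)) {μ r : ℝ}
    (hμ : 0 < μ) (hr : 0 ≤ r)
    (hW : ∀ z ∈ ball (0 : CN N) 1, height a b z ≤ -r → ‖W z‖ ≤ μ) :
    ∃ m : ℕ, ∀ (f : H) (D : ℝ),
      (∀ z ∈ ball (0 : CN N) 1, ‖ev f z‖ ≤ D * ‖(1 - inner ℂ a z : ℂ)‖ ^ m) →
      ∃ C : ℝ, ∀ n : ℕ, ‖(T ^ n) f‖ ≤ C * μ ^ n := by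
  obtain ⟨c, hc⟩ := hT.exists_norm_pow_apply_le hH hχ hχd hinv.1 hinv.2 hφ.height_apply
    (Real.log_pos hφ.one_lt) hμ hr hW
  obtain ⟨m, hm⟩ := exists_nat_ge c
  refine ⟨m, fun f D hD => hc f (D * 2 ^ m) fun z hz => ?_⟩
  have hpos := norm_pos_iff.2 (one_sub_inner_ne_zero_of_mem_ball hφ.norm_attracting hz)
  calc ‖ev f z‖ * Real.exp (c * max (height a b z) 0)
      ≤ (D * ‖(1 - inner ℂ a z : ℂ)‖ ^ m) * (2 / ‖(1 - inner ℂ a z : ℂ)‖) ^ m :=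
        mul_le_mul (hD z hz)
          (exp_mul_max_height_le hφ.norm_attracting hφ.norm_repelling hz hm) (by positivity)
          ((norm_nonneg _).trans (hD z hz))
    _ = D * 2 ^ m := by
        rw [div_pow]
        field_simp

theorem hasOrbitGrowth (hT : IsContractiveFactorization ev φ k W U T)
    (hH : IsBallSpace N p ev) (hφ : IsHyperbolicAut φ a b κ) (hχ : MapsTo χ (ball 0 1) (ball 0 1))
    (hχd : DifferentiableOn ℂ χ (ball 0 1)) (hinv : InvOn χ φ (ball 0 1) (ball 0 1))
    (hWa : Tendsto (fun z => ‖W z‖) (𝓝[ball 0 1] a) (𝓝 s))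
    (hWb : Tendsto (fun z => ‖W z‖) (𝓝[ball 0 1] b) (𝓝 t)) : HasOrbitGrowth ev a s t T := by
  have ha := hφ.norm_attracting
  have hb := hφ.norm_repelling
  have := nhdsWithin_ball_neBot ha
  have := nhdsWithin_ball_neBot hb
  have hs : 0 ≤ s := ge_of_tendsto' hWa fun _ => norm_nonneg _
  have ht : 0 ≤ t := ge_of_tendsto' hWb fun _ => norm_nonneg _
  have hκ := Real.log_pos hφ.one_lt
  have hnear_b : ∀ μ, t < μ → ∃ r, 0 ≤ r ∧
      ∀ z ∈ ball (0 : CN N) 1, height a b z ≤ -r → ‖W z‖ ≤ μ := fun μ hμ => by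
    obtain ⟨r, hr, hW⟩ := exists_norm_le_of_le_height hb ha hWb hμ
    exact ⟨r, hr, fun z hz hzr => hW z hz (by linarith [height_swap a b z])⟩
  refine ⟨fun μ hμ => ?_, fun μ hμ => ?_, fun μ hμ => ?_⟩
  · obtain ⟨hsμ, htμ⟩ := max_lt_iff.1 hμ
    obtain ⟨r₁, hr₁, hW₁⟩ := exists_norm_le_of_le_height ha hb hWa hsμ
    obtain ⟨r₂, -, hW₂⟩ := hnear_b μ htμ
    refine hT.exists_norm_pow_le hH hφ.height_apply hκ (hs.trans_lt hsμ)
      (hr₁.trans (le_max_left r₁ r₂)) fun z hz hzr => ?_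
    exact (le_abs.1 hzr).elim (fun h => hW₁ z hz ((le_max_left _ _).trans h))
      fun h => hW₂ z hz (by linarith [le_max_right r₁ r₂])
  · obtain ⟨r, hr, hW⟩ := hnear_b μ hμ
    exact hT.exists_norm_pow_apply_le_of_norm_ev_le hH hφ hχ hχd hinv (ht.trans_lt hμ) hr hW
  · obtain ⟨r, -, hW⟩ := exists_norm_le_of_le_height ha hb hWa hμ
    exact hT.exists_norm_ev_pow_le hH hφ.height_apply hκ (hs.trans_lt hμ) hW

end IsContractiveFactorization

theorem IsBallSpace.exists_isContractiveFactorization (hH : IsBallSpace N p ev) (hp : 0 ≤ p)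
    {c : CN N} {V : CN N ≃ₗᵢ[ℂ] CN N} (hc : ‖c‖ < 1) (hφ : DifferentiableOn ℂ φ (ball 0 1))
    (hφV : EqOn φ (ballAut c V) (ball 0 1)) (hψ : DifferentiableOn ℂ ψ (ball 0 1)) {M : ℝ}
    (hM : ∀ z ∈ ball (0 : CN N) 1, ‖ψ z‖ ≤ M) :
    ∃ U T : H →L[ℂ] H, IsContractiveFactorization ev φ (fun z => moebiusWeight p c (V z))
      (fun z => ψ z / moebiusWeight p c (V z)) U T ∧ IsWeightedComp ev ψ φ T := by
  have hle : ∀ z ∈ ball (0 : CN N) 1, ‖z‖ ≤ 1 := fun z hz => (mem_ball_zero_iff.1 hz).le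
  obtain ⟨U, hU, hUle⟩ := hH.exists_contraction_ballAut hc V
  have hUφ : IsWeightedComp ev (fun z => moebiusWeight p c (V z)) φ U := fun f z hz => by
    rw [hU f z hz, hφV hz]
  have hWd : DifferentiableOn ℂ (fun z => ψ z / moebiusWeight p c (V z)) (ball 0 1) := by
    simp only [div_eq_mul_inv]
    exact hψ.fun_mul (DifferentiableOn.fun_inv (fun z hz =>
      (differentiableAt_moebiusWeight_isometry V hc (hle z hz)).differentiableWithinAt)
      fun z hz => moebiusWeight_isometry_ne_zero V hc (hle z hz))
  have hWM : ∀ z ∈ ball (0 : CN N) 1,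
      ‖ψ z / moebiusWeight p c (V z)‖ ≤ M / (defect c / 2) ^ p := fun z hz =>
    norm_div_moebiusWeight_le hp V hc (hle z hz) (hM z hz)
  obtain ⟨P, hP⟩ := hH.exists_multiplication hWd hWM
  refine ⟨U, P * U, ⟨(mapsTo_ballAut V hc).congr hφV.symm, hφ, hUφ, hUle, hWd, ⟨_, hWM⟩,
    fun f z hz => hP (U f) z hz⟩, fun f z hz => ?_⟩
  rw [mul_apply_eq_comp, hP _ z hz, id_eq, hUφ f z hz, ← mul_assoc,
    div_mul_cancel₀ _ (moebiusWeight_isometry_ne_zero V hc (hle z hz))]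

namespace IsHyperbolicAut

theorem exists_hasOrbitGrowth (hφ : IsHyperbolicAut φ a b κ) (hH : IsBallSpace N p ev)
    (hp : 0 ≤ p) (hφd : DifferentiableOn ℂ φ (ball 0 1)) (hχ : MapsTo χ (ball 0 1) (ball 0 1))
    (hχd : DifferentiableOn ℂ χ (ball 0 1)) (hinv : InvOn χ φ (ball 0 1) (ball 0 1))
    (hψ : DifferentiableOn ℂ ψ (ball 0 1)) {M : ℝ} (hM : ∀ z ∈ ball (0 : CN N) 1, ‖ψ z‖ ≤ M)
    (hA : Tendsto (fun z => ‖ψ z‖) (𝓝[ball 0 1] a) (𝓝 A))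
    (hB : Tendsto (fun z => ‖ψ z‖) (𝓝[ball 0 1] b) (𝓝 B)) :
    ∃ T : H →L[ℂ] H, IsWeightedComp ev ψ φ T ∧
      HasOrbitGrowth ev a (A * κ ^ (p / 2)) (B * κ ^ (-(p / 2))) T := by
  have ha := hφ.norm_attracting
  have hb := hφ.norm_repelling
  obtain ⟨c, V, hc, hφV, hfa, hfb, hdil⟩ := hφ.exists_eqOn_ballAut
  obtain ⟨U, T, hfac, hT⟩ := hH.exists_isContractiveFactorization hp hc hφd hφV hψ hM
  have hWa := tendsto_norm_div_moebiusWeight (p := p) V hc ha.le hA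
  have hWb := tendsto_norm_div_moebiusWeight (p := p) V hc hb.le hB
  rw [dilation_eq_inv V hc ha hb hφ.ne hfa hfb, hdil, Real.inv_rpow hφ.pos.le, div_inv_eq_mul]
    at hWa
  rw [hdil, div_eq_mul_inv, ← Real.rpow_neg hφ.pos.le] at hWb
  exact ⟨T, hT, hfac.hasOrbitGrowth hH hφ hχ hχd hinv hWa hWb⟩

/-- Multiplication by `h ^ (i t)`, where `h` is the half-plane coordinate, conjugates `T` to the
multiple `κ ^ (i t) T`. -/
theorem isRotationInvariant (hφ : IsHyperbolicAut φ a b κ) (hH : IsBallSpace N p ev)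
    (hT : IsWeightedComp ev ψ φ T) : IsRotationInvariant T := by
  intro θ
  have ha := hφ.norm_attracting
  have hb := hφ.norm_repelling
  set t := θ / Real.log κ
  have hθ : t * Real.log κ = θ := div_mul_cancel₀ _ (Real.log_pos hφ.one_lt).ne'
  have hmul : ∀ t : ℝ, ∃ P : H →L[ℂ] H, IsWeightedComp ev (halfPlanePow a b t) id P := fun t =>
    hH.exists_multiplication (differentiableOn_halfPlanePow ha hb t)
      fun z _ => norm_halfPlanePow_le a b t z
  obtain ⟨P, hP⟩ := hmul t
  obtain ⟨Q, hQ⟩ := hmul (-t)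
  have hPQ : P * Q = 1 := ContinuousLinearMap.ext fun f => hH.ext fun z hz => by
    rw [mul_apply_eq_comp, hP _ z hz, id_eq, hQ _ z hz, id_eq, ← mul_assoc,
      halfPlanePow_mul_neg, one_mul, one_apply_eq_self]
  have hQP : Q * P = 1 := ContinuousLinearMap.ext fun f => hH.ext fun z hz => by
    rw [mul_apply_eq_comp, hQ _ z hz, id_eq, hP _ z hz, id_eq, ← mul_assoc,
      mul_comm (halfPlanePow a b (-t) z), halfPlanePow_mul_neg, one_mul, one_apply_eq_self]
  refine ⟨⟨P, Q, hPQ, hQP⟩, ContinuousLinearMap.ext fun f => hH.ext fun z hz => ?_⟩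
  change ev (T (P f)) z = ev (Complex.exp (θ * Complex.I) • P (T f)) z
  rw [map_smul, Pi.smul_apply, hT _ z hz, hP _ _ (hφ.mapsTo hz), hP _ z hz, id_eq, id_eq,
    hT _ z hz, halfPlanePow_eq_mul ha hb hφ.pos hz (hφ.halfPlane_apply z hz), hθ, smul_eq_mul]
  ring

end IsHyperbolicAut

end OrbitGrowth

section BoundaryFixedPoints

variable {N : ℕ} {φ χ : CN N → CN N} {a b c e : CN N} {V : CN N ≃ₗᵢ[ℂ] CN N} {κ : ℝ}

theorem isHolomorphicExtension_ballAut (hc : ‖c‖ < 1) (hφV : EqOn φ (ballAut c V) (ball 0 1)) :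
    IsHolomorphicExtension φ (ballAut c V) :=
  ⟨⟨{z | (1 - inner ℂ c (V z) : ℂ) ≠ 0}, isOpen_ne_fun (by fun_prop) (by fun_prop),
    fun _ hz => one_sub_inner_isometry_ne_zero V hc (mem_closedBall_zero_iff.1 hz),
    fun _ hz => (hasFDerivAt_ballAut V hc hz).differentiableAt.differentiableWithinAt⟩, hφV.symm⟩

theorem tendsto_of_eqOn_ballAut (hc : ‖c‖ < 1) (hφV : EqOn φ (ballAut c V) (ball 0 1))
    (he : ‖e‖ ≤ 1) : Tendsto φ (𝓝[ball 0 1] e) (𝓝 (ballAut c V e)) :=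
  ((hasFDerivAt_ballAut V hc
    (one_sub_inner_isometry_ne_zero V hc he)).continuousAt.mono_left nhdsWithin_le_nhds).congr'
      (eventually_nhdsWithin_of_forall fun _ hz => (hφV hz).symm)

theorem IsBoundaryFixedPt.norm_eq_one (he : IsBoundaryFixedPt φ e) : ‖e‖ = 1 :=
  mem_sphere_zero_iff_norm.1 he.1

theorem IsBoundaryFixedPt.ballAut_eq (he : IsBoundaryFixedPt φ e) (hc : ‖c‖ < 1)
    (hφV : EqOn φ (ballAut c V) (ball 0 1)) : ballAut c V e = e :=
  have := nhdsWithin_ball_neBot he.norm_eq_one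
  tendsto_nhds_unique (tendsto_of_eqOn_ballAut hc hφV he.norm_eq_one.le) he.2

theorem ballAut_eq_of_leftInvOn (hc : ‖c‖ < 1) (hχV : EqOn χ (ballAut c V) (ball 0 1))
    (hinv : LeftInvOn χ φ (ball 0 1)) (he : ‖e‖ = 1)
    (hφ : Tendsto φ (𝓝[ball 0 1] e) (𝓝[ball 0 1] e)) : ballAut c V e = e := by
  have := nhdsWithin_ball_neBot he
  have hid : Tendsto (χ ∘ φ) (𝓝[ball 0 1] e) (𝓝 e) :=
    (tendsto_id.mono_left nhdsWithin_le_nhds).congr'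
      (eventually_nhdsWithin_of_forall fun _ hz => (hinv hz).symm)
  exact tendsto_nhds_unique ((tendsto_of_eqOn_ballAut hc hχV he.le).comp hφ) hid

theorem halfPlane_iterate_zero (hφ : MapsTo φ (ball 0 1) (ball 0 1))
    (hφh : ∀ z ∈ ball (0 : CN N) 1, halfPlane a b (φ z) = κ * halfPlane a b z) (n : ℕ) :
    halfPlane a b (φ^[n] 0) = κ ^ n := by
  induction n with
  | zero => simp [halfPlane_zero]
  | succ n ih =>
    rw [Function.iterate_succ_apply', hφh _ (hφ.iterate n (mem_ball_self one_pos)), ih, pow_succ']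

theorem one_lt_of_tendsto_iterate_zero (ha : ‖a‖ = 1) (hb : ‖b‖ = 1) (hab : a ≠ b)
    (hκ : 0 < κ) (hφ : MapsTo φ (ball 0 1) (ball 0 1))
    (hφh : ∀ z ∈ ball (0 : CN N) 1, halfPlane a b (φ z) = κ * halfPlane a b z)
    (hlim : Tendsto (fun n => φ^[n] 0) atTop (𝓝 a)) : 1 < κ := by
  by_contra! hκ1
  have hle : ∀ n, ‖(1 - inner ℂ b (φ^[n] 0) : ℂ)‖ ≤ ‖(1 - inner ℂ a (φ^[n] 0) : ℂ)‖ := fun n => by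
    have hpos := norm_pos_iff.2
      (one_sub_inner_ne_zero_of_mem_ball ha (hφ.iterate n (mem_ball_self one_pos)))
    rw [← div_le_one hpos, ← norm_div, ← halfPlane, halfPlane_iterate_zero hφ hφh, norm_pow,
      Complex.norm_real, Real.norm_of_nonneg hκ.le]
    exact pow_le_one₀ hκ.le hκ1
  have hcont : ∀ e : CN N, Tendsto (fun n => ‖(1 - inner ℂ e (φ^[n] 0) : ℂ)‖) atTop
      (𝓝 ‖(1 - inner ℂ e a : ℂ)‖) := fun e =>
    ((continuous_const.sub (innerSL ℂ e).continuous).norm.tendsto a).comp hlim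
  have hlimit := le_of_tendsto_of_tendsto' (hcont b) (hcont a) hle
  rw [inner_self_eq_one ha, sub_self, norm_zero] at hlimit
  exact one_sub_inner_ne_zero_of_ne hb ha hab.symm (norm_le_zero_iff.1 hlimit)

theorem IsDenjoyWolffPt.tendsto_iterate_zero (ha : IsDenjoyWolffPt φ a) :
    Tendsto (fun n => φ^[n] 0) atTop (𝓝 a) :=
  (ha {0} isCompact_singleton (singleton_subset_iff.2 (mem_ball_self one_pos))).tendsto_at
    (mem_singleton _)

theorem isHyperbolicAut_of_isDenjoyWolffPt (hc : ‖c‖ < 1)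
    (hφV : EqOn φ (ballAut c V) (ball 0 1)) (ha : IsBoundaryFixedPt φ a)
    (hb : IsBoundaryFixedPt φ b) (hab : a ≠ b) (hDW : IsDenjoyWolffPt φ a) :
    IsHyperbolicAut φ a b (dilation c V b) where
  norm_attracting := ha.norm_eq_one
  norm_repelling := hb.norm_eq_one
  ne := hab
  one_lt := by
    refine one_lt_of_tendsto_iterate_zero ha.norm_eq_one hb.norm_eq_one hab
      (dilation_pos V hc hb.norm_eq_one.le) ((mapsTo_ballAut V hc).congr hφV.symm)
      (fun z hz => ?_) hDW.tendsto_iterate_zero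
    rw [hφV hz]
    exact halfPlane_ballAut V hc ha.norm_eq_one hb.norm_eq_one hab (ha.ballAut_eq hc hφV)
      (hb.ballAut_eq hc hφV) (mem_ball_zero_iff.1 hz)
  exists_eqOn_ballAut := ⟨c, V, hc, hφV, ha.ballAut_eq hc hφV, hb.ballAut_eq hc hφV, rfl⟩

namespace IsHyperbolicAut

theorem tendsto_attracting (hφ : IsHyperbolicAut φ a b κ) :
    Tendsto φ (𝓝[ball 0 1] a) (𝓝[ball 0 1] a) := by
  obtain ⟨c, V, hc, hφV, hfa, -, -⟩ := hφ.exists_eqOn_ballAut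
  have hlim := tendsto_of_eqOn_ballAut hc hφV hφ.norm_attracting.le
  rw [hfa] at hlim
  exact tendsto_nhdsWithin_iff.2
    ⟨hlim, eventually_nhdsWithin_of_forall fun _ hz => hφ.mapsTo hz⟩

theorem tendsto_repelling (hφ : IsHyperbolicAut φ a b κ) :
    Tendsto φ (𝓝[ball 0 1] b) (𝓝[ball 0 1] b) := by
  obtain ⟨c, V, hc, hφV, -, hfb, -⟩ := hφ.exists_eqOn_ballAut
  have hlim := tendsto_of_eqOn_ballAut hc hφV hφ.norm_repelling.le
  rw [hfb] at hlim
  exact tendsto_nhdsWithin_iff.2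
    ⟨hlim, eventually_nhdsWithin_of_forall fun _ hz => hφ.mapsTo hz⟩

theorem inverse (hφ : IsHyperbolicAut φ a b κ) (hχ : IsBallAut χ)
    (hinv : LeftInvOn χ φ (ball 0 1)) : IsHyperbolicAut χ b a κ := by
  have ha := hφ.norm_attracting
  have hb := hφ.norm_repelling
  have hzero : (0 : CN N) ∈ ball (0 : CN N) 1 := mem_ball_self one_pos
  obtain ⟨c, V, hc, hχV⟩ := hχ.exists_eqOn_ballAut
  have hfa := ballAut_eq_of_leftInvOn hc hχV hinv ha hφ.tendsto_attracting
  have hfb := ballAut_eq_of_leftInvOn hc hχV hinv hb hφ.tendsto_repelling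
  have hdil : dilation c V b * κ = 1 := by
    have hh := halfPlane_ballAut V hc ha hb hφ.ne hfa hfb (mem_ball_zero_iff.1 (hφ.mapsTo hzero))
    rw [← hχV (hφ.mapsTo hzero), hinv hzero, hφ.halfPlane_apply 0 hzero, halfPlane_zero,
      mul_one] at hh
    exact_mod_cast hh.symm
  refine ⟨hb, ha, hφ.ne.symm, hφ.one_lt, c, V, hc, hχV, hfb, hfa, ?_⟩
  rw [dilation_eq_inv V hc ha hb hφ.ne hfa hfb]
  exact inv_eq_of_mul_eq_one_right hdil

end IsHyperbolicAut

end BoundaryFixedPoints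

section TestVectors

variable {N : ℕ} {p : ℝ} {H : Type*} [NormedAddCommGroup H] [InnerProductSpace ℂ H]
  {ev : H →ₗ[ℂ] (CN N → ℂ)}

namespace IsBallSpace

theorem ne_zero_of_ev_ne_zero {f : H} {z : CN N} (h : ev f z ≠ 0) : f ≠ 0 := by
  rintro rfl
  exact h (by rw [map_zero, Pi.zero_apply])

theorem nontrivial (hH : IsBallSpace N p ev) : Nontrivial H := by
  obtain ⟨f, hf⟩ := hH.exists_one
  refine nontrivial_of_ne f 0 (ne_zero_of_ev_ne_zero (ev := ev) (z := 0) ?_)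
  rw [hf 0 (mem_ball_self one_pos)]
  exact one_ne_zero

theorem exists_kernel_zero [CompleteSpace H] (hH : IsBallSpace N p ev) :
    ∃ g : H, g ≠ 0 ∧ ∀ f : H, inner ℂ g f = ev f 0 := by
  let L : H →L[ℂ] ℂ := ((LinearMap.proj (0 : CN N)).comp ev).mkContinuous 1 fun f => by
    rw [one_mul]
    exact hH.norm_apply_zero_le f
  have hL : ∀ f, inner ℂ ((InnerProductSpace.toDual ℂ H).symm L) f = ev f 0 := fun f =>
    InnerProductSpace.toDual_symm_apply
  refine ⟨_, fun hzero => ?_, hL⟩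
  obtain ⟨f, hf⟩ := hH.exists_one
  have hone := hL f
  rw [hzero, inner_zero_left, hf 0 (mem_ball_self one_pos)] at hone
  exact zero_ne_one hone

theorem exists_pow_mul_pow (hH : IsBallSpace N p ev) {a b : CN N} (ha : ‖a‖ ≤ 1) (hb : ‖b‖ ≤ 1)
    (m n : ℕ) : ∃ g : H, g ≠ 0 ∧
      (∀ z ∈ ball (0 : CN N) 1, ‖ev g z‖ ≤ 2 ^ n * ‖(1 - inner ℂ a z : ℂ)‖ ^ m) ∧
      ∀ z ∈ ball (0 : CN N) 1, ‖ev g z‖ ≤ 2 ^ m * ‖(1 - inner ℂ b z : ℂ)‖ ^ n := by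
  have hle : ∀ e : CN N, ‖e‖ ≤ 1 → ∀ z ∈ ball (0 : CN N) 1, ‖(1 - inner ℂ e z : ℂ)‖ ≤ 2 :=
    fun e he z hz => norm_one_sub_inner_le_two he (mem_ball_zero_iff.1 hz).le
  obtain ⟨f, hf⟩ := hH.exists_one
  obtain ⟨g, hg, -⟩ := hH.exists_mul
    (fun z => (1 - inner ℂ a z : ℂ) ^ m * (1 - inner ℂ b z : ℂ) ^ n) (2 ^ m * 2 ^ n)
    (((differentiableOn_one_sub_inner a _).pow m).mul ((differentiableOn_one_sub_inner b _).pow n))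
    (fun z hz => by
      rw [norm_mul, norm_pow, norm_pow]
      gcongr
      exacts [hle a ha z hz, hle b hb z hz]) f
  have hg_norm : ∀ z ∈ ball (0 : CN N) 1, ‖ev g z‖ =
      ‖(1 - inner ℂ a z : ℂ)‖ ^ m * ‖(1 - inner ℂ b z : ℂ)‖ ^ n := fun z hz => by
    rw [hg z hz, hf z hz, mul_one, norm_mul, norm_pow, norm_pow]
  refine ⟨g, ne_zero_of_ev_ne_zero (ev := ev) (z := 0) ?_, fun z hz => ?_, fun z hz => ?_⟩
  · rw [hg 0 (mem_ball_self one_pos), hf 0 (mem_ball_self one_pos)]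
    simp
  · rw [hg_norm z hz, mul_comm]
    gcongr
    exact hle b hb z hz
  · rw [hg_norm z hz]
    gcongr
    exact hle a ha z hz

end IsBallSpace

theorem norm_adjoint_apply_le [CompleteSpace H] {T : H →L[ℂ] H} {g : H} {R : ℝ} (hR : 0 ≤ R)
    (h : ∀ f : H, ‖(inner ℂ g (T f) : ℂ)‖ ≤ R * ‖f‖) :
    ‖ContinuousLinearMap.adjoint T g‖ ≤ R := by
  rw [← (InnerProductSpace.toDual ℂ H).norm_map]
  refine ContinuousLinearMap.opNorm_le_bound _ hR fun f => ?_
  rw [InnerProductSpace.toDual_apply_apply, ContinuousLinearMap.adjoint_inner_left]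
  exact h f

end TestVectors

section Spectrum

variable {N : ℕ} {p κ s t r A B : ℝ} {H : Type*} [NormedAddCommGroup H] [InnerProductSpace ℂ H]
  {ev : H →ₗ[ℂ] (CN N → ℂ)} {φ χ : CN N → CN N} {a b : CN N} {ψ ω : CN N → ℂ}

theorem IsWeightedComp.mul_eq_one {T S : H →L[ℂ] H} (hT : IsWeightedComp ev ψ φ T)
    (hS : IsWeightedComp ev ω χ S) (hH : IsBallSpace N p ev) (hφ : MapsTo φ (ball 0 1) (ball 0 1))
    (hinv : LeftInvOn χ φ (ball 0 1)) (hψω : ∀ z ∈ ball (0 : CN N) 1, ψ z * ω (φ z) = 1) :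
    T * S = 1 :=
  ContinuousLinearMap.ext fun f => hH.ext fun z hz => by
    rw [mul_apply_eq_comp, hT _ z hz, hS _ _ (hφ hz), hinv hz, ← mul_assoc, hψω z hz, one_mul,
      one_apply_eq_self]

theorem pos_of_boundedAwayFromZero (ha : ‖a‖ = 1) (hψ : BoundedAwayFromZero ψ)
    (hA : Tendsto (fun z => ‖ψ z‖) (𝓝[ball 0 1] a) (𝓝 A)) : 0 < A := by
  obtain ⟨ε, hε, hψε⟩ := hψ
  have := nhdsWithin_ball_neBot ha
  exact hε.trans_le (ge_of_tendsto hA (eventually_nhdsWithin_of_forall hψε))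

theorem IsHyperbolicAut.exists_hasOrbitGrowth_inverse (hφ : IsHyperbolicAut φ a b κ)
    (hφd : DifferentiableOn ℂ φ (ball 0 1)) (hχ : IsHyperbolicAut χ b a κ)
    (hχd : DifferentiableOn ℂ χ (ball 0 1)) (hinv : InvOn χ φ (ball 0 1) (ball 0 1))
    (hH : IsBallSpace N p ev) (hp : 0 ≤ p) (hψ : DifferentiableOn ℂ ψ (ball 0 1))
    (hψ_inf : BoundedAwayFromZero ψ)
    (hA : Tendsto (fun z => ‖ψ z‖) (𝓝[ball 0 1] a) (𝓝 A))
    (hB : Tendsto (fun z => ‖ψ z‖) (𝓝[ball 0 1] b) (𝓝 B)) :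
    ∃ S : H →L[ℂ] H, IsWeightedComp ev (fun z => (ψ (χ z))⁻¹) χ S ∧
      HasOrbitGrowth ev b (B * κ ^ (-(p / 2)))⁻¹ (A * κ ^ (p / 2))⁻¹ S := by
  have hA_pos := pos_of_boundedAwayFromZero hφ.norm_attracting hψ_inf hA
  have hB_pos := pos_of_boundedAwayFromZero hφ.norm_repelling hψ_inf hB
  obtain ⟨ε, hε, hψε⟩ := hψ_inf
  have hlim : ∀ {e : CN N} {L : ℝ}, 0 < L → Tendsto χ (𝓝[ball 0 1] e) (𝓝[ball 0 1] e) →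
      Tendsto (fun z => ‖ψ z‖) (𝓝[ball 0 1] e) (𝓝 L) →
      Tendsto (fun z => ‖(ψ (χ z))⁻¹‖) (𝓝[ball 0 1] e) (𝓝 L⁻¹) := fun hL hχe hψe => by
    simp only [norm_inv]
    exact (hψe.comp hχe).inv₀ hL.ne'
  have hd : DifferentiableOn ℂ (fun z => (ψ (χ z))⁻¹) (ball 0 1) :=
    (hψ.comp hχd hχ.mapsTo).fun_inv fun z hz =>
      norm_pos_iff.1 (hε.trans_le (hψε _ (hχ.mapsTo hz)))
  have hle : ∀ z ∈ ball (0 : CN N) 1, ‖(ψ (χ z))⁻¹‖ ≤ ε⁻¹ := fun z hz => by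
    rw [norm_inv]
    exact inv_anti₀ hε (hψε _ (hχ.mapsTo hz))
  obtain ⟨S, hS, hgrowth⟩ := hχ.exists_hasOrbitGrowth hH hp hχd hφ.mapsTo hφd hinv.symm hd hle
    (hlim hB_pos hχ.tendsto_attracting hB) (hlim hA_pos hχ.tendsto_repelling hA)
  refine ⟨S, hS, ?_⟩
  rwa [mul_inv, mul_inv, ← Real.rpow_neg hφ.pos.le, ← Real.rpow_neg hφ.pos.le, neg_neg]

variable [CompleteSpace H]

namespace IsBallSpace

theorem exists_hasEigenvalue (hH : IsBallSpace N p ev) (ha : ‖a‖ ≤ 1) (hb : ‖b‖ ≤ 1)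
    {u : (H →L[ℂ] H)ˣ} (hu : HasOrbitGrowth ev a s t (u : H →L[ℂ] H))
    (hu_inv : HasOrbitGrowth ev b t⁻¹ s⁻¹ (↑u⁻¹ : H →L[ℂ] H)) (ht : 0 < t) (hr : r ∈ Ioo t s) :
    ∃ l : ℂ, ‖l‖ = r ∧ Module.End.HasEigenvalue ((u : H →L[ℂ] H) : H →ₗ[ℂ] H) l := by
  have hr_pos : 0 < r := ht.trans hr.1
  have hs : 0 < s := hr_pos.trans hr.2
  obtain ⟨μ, htμ, hμr⟩ := exists_between hr.1
  obtain ⟨ν, hsν, hνr⟩ := exists_between ((inv_lt_inv₀ hs hr_pos).2 hr.2)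
  obtain ⟨m, hfwd⟩ := hu.norm_pow_apply μ htμ
  obtain ⟨n, hbwd⟩ := hu_inv.norm_pow_apply ν hsν
  obtain ⟨g, hg, hga, hgb⟩ := hH.exists_pow_mul_pow ha hb m n
  obtain ⟨C, hC⟩ := hfwd g _ hga
  obtain ⟨D, hD⟩ := hbwd g _ hgb
  exact exists_hasEigenvalue_of_norm_pow_apply_le u hg (ht.trans htμ).le hμr
    ((inv_pos.2 hs).trans hsν).le hνr hC hD

theorem exists_hasEigenvalue_adjoint (hH : IsBallSpace N p ev) {u : (H →L[ℂ] H)ˣ}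
    (hu : HasOrbitGrowth ev a s t (u : H →L[ℂ] H))
    (hu_inv : HasOrbitGrowth ev b t⁻¹ s⁻¹ (↑u⁻¹ : H →L[ℂ] H)) (hs : 0 < s) (hr : r ∈ Ioo s t) :
    ∃ l : ℂ, ‖l‖ = r ∧
      Module.End.HasEigenvalue (ContinuousLinearMap.adjoint (u : H →L[ℂ] H) : H →ₗ[ℂ] H) l := by
  have hr_pos : 0 < r := hs.trans hr.1
  have ht : 0 < t := hr_pos.trans hr.2
  obtain ⟨μ, hsμ, hμr⟩ := exists_between hr.1
  obtain ⟨ν, htν, hνr⟩ := exists_between ((inv_lt_inv₀ ht hr_pos).2 hr.2)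
  have hμ : 0 < μ := hs.trans hsμ
  have hν : 0 < ν := (inv_pos.2 ht).trans htν
  obtain ⟨C, hC, hfwd⟩ := hu.norm_ev_pow μ hsμ
  obtain ⟨D, hD, hbwd⟩ := hu_inv.norm_ev_pow ν htν
  obtain ⟨g, hg, hg_inner⟩ := hH.exists_kernel_zero
  refine exists_hasEigenvalue_of_norm_pow_apply_le (star u) (C := C) (D := D) hg hμ.le hμr hν.le hνr
    (fun n => ?_) fun n => ?_
  · rw [Units.coe_star, ← star_pow, ContinuousLinearMap.star_eq_adjoint]
    exact norm_adjoint_apply_le (by positivity) fun f => by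
      rw [hg_inner]
      exact hfwd n f
  · rw [← star_inv, Units.coe_star, ← star_pow, ContinuousLinearMap.star_eq_adjoint]
    exact norm_adjoint_apply_le (by positivity) fun f => by
      rw [hg_inner]
      exact hbwd n f

theorem hasAnnularSpectrum (hH : IsBallSpace N p ev) (ha : ‖a‖ ≤ 1) (hb : ‖b‖ ≤ 1)
    {u : (H →L[ℂ] H)ˣ} (hu : HasOrbitGrowth ev a s t (u : H →L[ℂ] H))
    (hu_inv : HasOrbitGrowth ev b t⁻¹ s⁻¹ (↑u⁻¹ : H →L[ℂ] H))
    (hrot : IsRotationInvariant (u : H →L[ℂ] H)) (hs : 0 < s) (ht : 0 < t) :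
    HasAnnularSpectrum (u : H →L[ℂ] H) s t := by
  have := hH.nontrivial
  refine hrot.hasAnnularSpectrum hs ht
    (spectrum_subset_closedAnnulus u hs ht hu.norm_pow hu_inv.norm_pow) fun r hr => ?_
  rcases le_total t s with hts | hst
  · rw [min_eq_right hts, max_eq_left hts] at hr
    obtain ⟨l, hl, heig⟩ := hH.exists_hasEigenvalue ha hb hu hu_inv ht hr
    exact ⟨l, hl, Or.inl heig⟩
  · rw [min_eq_left hst, max_eq_right hst] at hr
    obtain ⟨l, hl, heig⟩ := hH.exists_hasEigenvalue_adjoint hu hu_inv hs hr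
    exact ⟨l, hl, Or.inr heig⟩

end IsBallSpace

theorem IsHyperbolicAut.exists_hasAnnularSpectrum (hφ : IsHyperbolicAut φ a b κ)
    (hφ_aut : IsBallAut φ) (hH : IsBallSpace N p ev) (hp : 0 ≤ p)
    (hψ : DifferentiableOn ℂ ψ (ball 0 1)) {M : ℝ} (hM : ∀ z ∈ ball (0 : CN N) 1, ‖ψ z‖ ≤ M)
    (hψ_inf : BoundedAwayFromZero ψ)
    (hA : Tendsto (fun z => ‖ψ z‖) (𝓝[ball 0 1] a) (𝓝 A))
    (hB : Tendsto (fun z => ‖ψ z‖) (𝓝[ball 0 1] b) (𝓝 B)) :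
    ∃ T : H →L[ℂ] H, IsWeightedComp ev ψ φ T ∧
      HasAnnularSpectrum T (A * κ ^ (p / 2)) (B * κ ^ (-(p / 2))) := by
  obtain ⟨hφd, hφm, χ, hχd, hχm, hinv⟩ := hφ_aut
  have hχ := hφ.inverse ⟨hχd, hχm, φ, hφd, hφm, hinv.symm⟩ hinv.1
  have hψ_ne : ∀ z ∈ ball (0 : CN N) 1, ψ z ≠ 0 := fun z hz => by
    obtain ⟨ε, hε, hψε⟩ := hψ_inf
    exact norm_pos_iff.1 (hε.trans_le (hψε z hz))
  obtain ⟨T, hT, hT_growth⟩ := hφ.exists_hasOrbitGrowth hH hp hφd hχm hχd hinv hψ hM hA hB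
  obtain ⟨S, hS, hS_growth⟩ :=
    hφ.exists_hasOrbitGrowth_inverse hφd hχ hχd hinv hH hp hψ hψ_inf hA hB
  have hTS : T * S = 1 := hT.mul_eq_one hS hH hφm hinv.1 fun z hz => by
    rw [hinv.1 hz, mul_inv_cancel₀ (hψ_ne z hz)]
  have hST : S * T = 1 := hS.mul_eq_one hT hH hχm hinv.2 fun z hz =>
    inv_mul_cancel₀ (hψ_ne _ (hχm hz))
  have hκ := hφ.pos
  have hA_pos := pos_of_boundedAwayFromZero hφ.norm_attracting hψ_inf hA
  have hB_pos := pos_of_boundedAwayFromZero hφ.norm_repelling hψ_inf hB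
  exact ⟨T, hT, hH.hasAnnularSpectrum (u := ⟨T, S, hTS, hST⟩) hφ.norm_attracting.le
    hφ.norm_repelling.le hT_growth hS_growth (hφ.isRotationInvariant hH hT) (by positivity)
    (by positivity)⟩

end Spectrum

section Symbol

variable {N : ℕ} {φ : CN N → CN N} {a b c e : CN N} {V : CN N ≃ₗᵢ[ℂ] CN N} {ψ : CN N → ℂ}

theorem IsHyperbolicAut.exists_isHolomorphicExtension {κ : ℝ} (hφ : IsHyperbolicAut φ a b κ) :
    ∃ Φ : CN N → CN N, IsHolomorphicExtension φ Φ ∧ (fderiv ℂ Φ a).IsInvertible ∧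
      κ = specRad (fderiv ℂ Φ a).inverse ∧ κ = specRad (fderiv ℂ Φ b) := by
  have ha := hφ.norm_attracting
  have hb := hφ.norm_repelling
  obtain ⟨c, V, hc, hφV, hfa, hfb, rfl⟩ := hφ.exists_eqOn_ballAut
  have hderiv_a := isBoundaryDilation_fderiv_ballAut V hc ha hfa
  have hderiv_b := isBoundaryDilation_fderiv_ballAut V hc hb hfb
  have hdil := dilation_eq_inv V hc ha hb hφ.ne hfa hfb
  have hpos := dilation_pos V hc ha.le
  have hle : dilation c V a ≤ 1 := hdil ▸ inv_le_one_of_one_le₀ hφ.one_lt.le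
  refine ⟨ballAut c V, isHolomorphicExtension_ballAut hc hφV, hderiv_a.isInvertible hpos.ne', ?_,
    (hderiv_b.specRad_eq hb hφ.one_lt.le).symm⟩
  rw [hderiv_a.specRad_inverse_eq ha hpos hle, hdil, inv_inv]

theorem MemBallAlgebra.exists_norm_le (hψ : MemBallAlgebra ψ) :
    ∃ M, ∀ z ∈ ball (0 : CN N) 1, ‖ψ z‖ ≤ M := by
  obtain ⟨M, hM⟩ := (isCompact_closedBall (0 : CN N) 1).exists_bound_of_continuousOn hψ.1
  exact ⟨M, fun z hz => hM z (ball_subset_closedBall hz)⟩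

theorem MemBallAlgebra.tendsto_norm (hψ : MemBallAlgebra ψ) (he : ‖e‖ ≤ 1) :
    Tendsto (fun z => ‖ψ z‖) (𝓝[ball 0 1] e) (𝓝 ‖ψ e‖) :=
  ((hψ.1 e (mem_closedBall_zero_iff.2 he)).mono ball_subset_closedBall).norm

end Symbol

end WCO

theorem theorem3p11_general (N : ℕ) [NeZero N] (φ : CN N → CN N) (hφ : IsBallAut φ)
    (a b : CN N) (ha : IsBoundaryFixedPt φ a) (hb : IsBoundaryFixedPt φ b) (hab : a ≠ b)
    (hDW : IsDenjoyWolffPt φ a) (ψ : CN N → ℂ) (hψ : DifferentiableOn ℂ ψ (ball 0 1))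
    (hψ_bdd : ∃ M, ∀ z ∈ ball (0 : CN N) 1, ‖ψ z‖ ≤ M) (hψ_inf : BoundedAwayFromZero ψ) (A B : ℝ)
    (hA : Tendsto (fun z => ‖ψ z‖) (𝓝[ball 0 1] a) (𝓝 A))
    (hB : Tendsto (fun z => ‖ψ z‖) (𝓝[ball 0 1] b) (𝓝 B)) :
    ∃ Φ : CN N → CN N, IsHolomorphicExtension φ Φ ∧ (fderiv ℂ Φ a).IsInvertible ∧
    ∃ ρ : ℝ, ρ = specRad (fderiv ℂ Φ a).inverse ∧ ρ = specRad (fderiv ℂ Φ b) ∧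
      (∃ (_ : CompleteSpace (HardySpace N)) (T : HardySpace N →L[ℂ] HardySpace N),
        IsWeightedComp (HardySpace.evalMap N) ψ φ T ∧
        HasAnnularSpectrum T (A * ρ ^ ((N : ℝ) / 2)) (B * ρ ^ (-((N : ℝ) / 2)))) ∧
      ∀ (γ : ℝ) (hγ : -1 < γ - 2) (K : ℝ), K = ((N : ℝ) - 1 + γ) / 2 →
        ∃ (_ : CompleteSpace (BergmanSpace N hγ)) (T : BergmanSpace N hγ →L[ℂ] BergmanSpace N hγ),
          IsWeightedComp (BergmanSpace.evalMap N hγ) ψ φ T ∧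
          HasAnnularSpectrum T (A * ρ ^ K) (B * ρ ^ (-K)) := by
  obtain ⟨c, V, hc, hφV⟩ := hφ.exists_eqOn_ballAut
  have hhyp := isHyperbolicAut_of_isDenjoyWolffPt hc hφV ha hb hab hDW
  obtain ⟨Φ, hΦ, hinv, hρa, hρb⟩ := hhyp.exists_isHolomorphicExtension
  obtain ⟨M, hM⟩ := hψ_bdd
  have hN : (0 : ℝ) ≤ N := N.cast_nonneg
  refine ⟨Φ, hΦ, hinv, dilation c V b, hρa, hρb, ?_, fun γ hγ K hK => ?_⟩
  · have := HardySpace.isBallSpace.completeSpace (N := N) hN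
    exact ⟨this, hhyp.exists_hasAnnularSpectrum hφ HardySpace.isBallSpace hN hψ hM hψ_inf hA hB⟩
  · have hp : (0 : ℝ) ≤ N + 1 + (γ - 2) := by linarith
    have := (BergmanSpace.isBallSpace hγ).completeSpace (N := N) hp
    obtain rfl : K = (N + 1 + (γ - 2)) / 2 := by rw [hK]; ring
    exact ⟨this, hhyp.exists_hasAnnularSpectrum hφ (BergmanSpace.isBallSpace hγ) hp hψ hM hψ_inf
      hA hB⟩

theorem theorem3p11 (N : ℕ) [NeZero N] (φ : CN N → CN N) (hφ : IsBallAut φ)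
    (hfix : ∀ z ∈ ball (0 : CN N) 1, φ z ≠ z)
    (a b : CN N) (ha : IsBoundaryFixedPt φ a) (hb : IsBoundaryFixedPt φ b) (hab : a ≠ b)
    (hDW : IsDenjoyWolffPt φ a)
    (ψ : CN N → ℂ) (hψ : MemBallAlgebra ψ) (hψ0 : BoundedAwayFromZero ψ) :
    ∃ Φ : CN N → CN N, IsHolomorphicExtension φ Φ ∧ (fderiv ℂ Φ a).IsInvertible ∧
    ∃ ρ : ℝ, ρ = specRad (fderiv ℂ Φ a).inverse ∧ ρ = specRad (fderiv ℂ Φ b) ∧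
      (∃ (_ : CompleteSpace (HardySpace N)) (T : HardySpace N →L[ℂ] HardySpace N),
        (∀ (f : HardySpace N), ∀ z ∈ ball (0 : CN N) 1, (T f) z = ψ z * f (φ z)) ∧
        spectrum ℂ T = closedAnnulus (‖ψ a‖ * ρ ^ ((N : ℝ) / 2)) (‖ψ b‖ * ρ ^ (-((N : ℝ) / 2))) ∧
        ∀ l ∈ interior
            (closedAnnulus (‖ψ a‖ * ρ ^ ((N : ℝ) / 2)) (‖ψ b‖ * ρ ^ (-((N : ℝ) / 2)))),
          Module.End.HasEigenvalue (T : HardySpace N →ₗ[ℂ] HardySpace N) l ∨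
          Module.End.HasEigenvalue
            (ContinuousLinearMap.adjoint T : HardySpace N →ₗ[ℂ] HardySpace N) l) ∧
      (∀ (γ : ℝ) (hγ : -1 < γ - 2) (K : ℝ), K = ((N : ℝ) - 1 + γ) / 2 →
        ∃ (_ : CompleteSpace (BergmanSpace N hγ)) (T : BergmanSpace N hγ →L[ℂ] BergmanSpace N hγ),
          (∀ (f : BergmanSpace N hγ), ∀ z ∈ ball (0 : CN N) 1, (T f) z = ψ z * f (φ z)) ∧
          spectrum ℂ T = closedAnnulus (‖ψ a‖ * ρ ^ K) (‖ψ b‖ * ρ ^ (-K)) ∧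
          ∀ l ∈ interior (closedAnnulus (‖ψ a‖ * ρ ^ K) (‖ψ b‖ * ρ ^ (-K))),
            Module.End.HasEigenvalue (T : BergmanSpace N hγ →ₗ[ℂ] BergmanSpace N hγ) l ∨
            Module.End.HasEigenvalue
              (ContinuousLinearMap.adjoint T : BergmanSpace N hγ →ₗ[ℂ] BergmanSpace N hγ) l) :=
  theorem3p11_general N φ hφ a b ha hb hab hDW ψ hψ.2 hψ.exists_norm_le hψ0 _ _
    (hψ.tendsto_norm ha.norm_eq_one.le) (hψ.tendsto_norm hb.norm_eq_one.le)
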